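/- **Conventions.** Let $S^1=\mathbb R/\mathbb Z$. For homeomorphisms $f_1,\dots,f_n$ of $S^1$, $IFS(f_1,\dots,f_n)$ is the set of all compositions of nonempty finite words in the $f_i$, and $O(x)=\{\phi(x):\phi\in IFS(f_1,\dots,f_n)\}$. A *minimal set* is a nonempty closed $M\subset S^1$ with $f_i(M)\subset M$ for all $i$ and $\overline{O(x)}=M$ for all $x\in M$. A homeomorphism *has rotation number $0$* if it has a continuous monotone degree-one lift to $\mathbb R$ with integer translation number. A *Cantor set* is a nonempty, perfect, totally disconnected set. For closed $M$, $\mathcal I$ is the family of components of $\mathrm{int}(M)$ (also its union), $\partial\mathcal I=\bigcup_{C\in\mathcal I}\partial C$, and $M=\mathcal I\sqcup K\sqcup N$, where $K$ is the largest Cantor set in $M\setminus\mathrm{int}(M)$ (or $\emptyset$) and $N$ is countable. Intervals are nondegenerate; $I'\subset I$, $J'\subset J$ below are closed intervals of $S^1$, the first in the interior of the second, and the second not all of $S^1$. *Building blocks.* * A pair $f_{K,I},g_{K,I}$: homeomorphisms equal to the identity off $I$, with a Cantor set $K\subset I'\subset I$ that is minimal for $IFS(f_{K,I},g_{K,I})$,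 with $f_{K,I}^{-1}(K)\cap I'\subset K$, $g_{K,I}^{-1}(K)\cap I'\subset K$, and $K\subset\overline{O(x)}$ for all $x\in I'$. * $T^{+}_{I'I},T^{-}_{I'I}$, with $I'=[a,b]$: homeomorphisms equal to the identity off $I$ and affine contractions on $I'$ fixing $b$ and $a$ respectively, with $T^+(I')\cup T^-(I')=I'$. * $h_{J',J,A}$, with $J\cap A=\emptyset$: a homeomorphism equal to the identity on $J'$ with $h(J^c)\subset A$. * A push on $[s,t]$ (where $s<t\le s+1$): a homeomorphism equal to the identity off $[s,t]$ that moves each $x\in(s,t)$ to a point of $(x,t)$. **Statement.** In each of the following cases there are homeomorphisms of $S^1$ as described, all generators having rotation number $0$ (in 1(b), first sentence, only a fixed point is assumed). 1. (a) *$M=K$ is a Cantor set.* There are $C^\infty$ diffeomorphisms $f,g$ and $I'=[a,b]\subset I$ such that $f(x)=a+\frac{x-a}3$ and $g(x)=b+\frac{x-b}3$ on $I'$, both maps are the identity off $I$, and $M=\bigcap_k\Lambda_k$, with $\Lambda_0=I'$, $\Lambda_{k+1}=f(\Lambda_k)\cup g(\Lambda_k)$, is the affine copy of the usual triadic Cantor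 set in $I'$; $(f,g)$ is a pair $f_{M,I},g_{M,I}$ as above, so $M$ is minimal. It is not the only minimal set of $IFS(f,g)$. (b) *$M$ is finite.* If $f$ is a homeomorphism with a fixed point, then $IFS(f)$ has a finite minimal set. The same holds if $f$ has rotation number $0$. 2. *$M=S^1$.* There are $T^\pm_{I'I}$, an interval $J\subset I'$, and $H_1,H_2$ with $S^1\setminus I'\subset H_1(J)$ and $H_2(S^1\setminus I')\subset J$, such that $S^1$ is minimal for $IFS(T^+_{I'I},T^-_{I'I},H_1,H_2)$. 3. *$M=\mathcal I\cup K\cup N$ with $\partial\mathcal I=N$, all three nonempty.* There are a pair $f_{K,I_0},g_{K,I_0}$ for which the interval $[a,b]\subset I_0$ in the definition has $a,b\in K$, a component $I\subset[a,b]$ of $K^c$, maps $T^\pm_{I'\overline I}$, and $h=h_{J',J,I'}$ with $J\cap I_0=\emptyset$, such that $$M=K\cup\bigcup_{\phi\in IFS(f_{K,I_0},g_{K,I_0})}\phi(I')\cup I'$$ is minimal for $IFS(f_{K,I_0},g_{K,I_0},h,T^+_{I'\overline I},T^-_{I'\overline I})$. 4. *$M=\mathcal I\cup K\cup N$ with $\mathcal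 I,K\ne\emptyset$, $\partial\mathcal I\cap N\neq\emptyset$ and $N\not\subset\partial\mathcal I$.* With $f_{K,I_0},g_{K,I_0},I,J$ as in 3 and $\mathcal F=IFS(f_{K,I_0},g_{K,I_0})$, there are $[s,t]\subset I$, a push $\varphi$ on $[s,t]$, intervals $I_1\subset\widehat I_1\subset(s,t)$ with $\varphi^n(I_1)\cap I_1=\emptyset$ for $n\ge1$ and $\varphi(I_1)\cap\widehat I_1=\emptyset$, and maps $T^\pm_{I_1\widehat I_1}$ and $h_{J',J,I_1}$, such that $$M=K\cup\bigcup_{n\ge0}\varphi^n(I_1)\cup\bigcup_{\phi\in\mathcal F}\phi\Big(\bigcup_{n\ge0}\varphi^n(I_1)\Big)\cup\bigcup_{\phi\in\mathcal F}\{\phi(t)\}\cup\{t\}$$ is minimal for $IFS(f_{K,I_0},g_{K,I_0},\varphi,h_{J',J,I_1},T^+_{I_1\widehat I_1},T^-_{I_1\widehat I_1})$. 5. *$M=\mathcal I\cup N$ is a union of disjoint nondegenerate closed intervals, with $K=\emptyset$, $N=\partial\mathcal I$.* (a) *Infinitely many.* There are a push $\psi$ on $[s,c]$, an interval $I=[c,d]$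 with $d<s+1$, intervals $I_0\subset I_1\subset(s,c)$ with $\psi^n(I_1)\cap I_1=\emptyset$ for $n\ge1$, maps $T^\pm_{I_0I_1}$, $h_{J',J,I_0}$ with $J$ disjoint from $\bigcup_{n\ge0}\psi^n(I_1)\cup I$, and $H$ with $H(I_0)=I$ and $H(\bigcup_{n\ge1}\psi^n(I_0)\cup I)\subset\psi(I_0)$, such that $M=\bigcup_{n\ge0}\psi^n(I_0)\cup I$ is minimal for $IFS(T^+_{I_0I_1},T^-_{I_0I_1},H,\psi,h_{J',J,I_0})$. All components of $M$ are nontrivial and there are infinitely many. (b) *Finitely many.* For each $k\ge1$ there is a finite family of homeomorphisms with a minimal set $M\ne S^1$ that has exactly $k$ components, all nontrivial. 6. *$M=\mathcal I\cup N$ with $\mathcal I$ infinite, $K=\emptyset$, $N=\partial\mathcal I\cup\{0\}$ and $0\notin\partial\mathcal I$.* There are a push $\psi$ on $[0,1]$ (with $0$ and $1$ the same point of $S^1$), intervals $I'\subset I\subset(0,1)$ with $I\cap\psi(I)=\emptyset$, and maps $T^\pm_{I'I}$ and $h_{J',J,I'}$ with $J\cap\psi^n(I)=\emptyset$ for $n\ge0$,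 such that $M=\{0\}\cup\bigcup_{n\ge0}\psi^n(I')$ is minimal for $IFS(\psi,h_{J',J,I'},T^+_{I'I},T^-_{I'I})$. 7. *$M=\mathcal I\cup K$ with $\mathcal I,K\ne\emptyset$, $N=\emptyset$, $\partial\mathcal I\subset K$.* There are $I'=[a,b]\subset I$ and $f,g,h$, equal to the identity off $I$ and affine of slope $\frac15$ on $I'$, carrying $I'$ onto its first, third and fifth fifth. Put $K=\bigcap_k\Lambda_k$ with $\Lambda_0=I'$, $\Lambda_{k+1}=f(\Lambda_k)\cup g(\Lambda_k)\cup h(\Lambda_k)$; let $I_0=(c,d)$ be the second and $I_1$ the fourth open fifth of $I'$, $\mathcal F_1=IFS(f,g,h)$ and $\mathcal H=\{\phi(I_0):\phi\in\mathcal F_1\}$. There are points $\alpha<x_0<c<d<y_0<\beta$ of $I'$, with $\alpha,x_0,y_0,\beta\in K$ and $[\alpha,\beta]\cap I_1=\emptyset$, such that $K\cap[\alpha,\beta]$, $K\cap[\alpha,x_0]$, $K\cap[y_0,\beta]$ are Cantor sets, and there are $T^+,T^-$ such that: $T^+$ is the identity off $[\alpha,d]$, maps $[\alpha,x_0]$ onto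 $[\alpha,c]$, $K\cap[\alpha,x_0]$ onto $K\cap[\alpha,c]$ and members of $\mathcal H$ inside $[\alpha,x_0]$ to members of $\mathcal H$, and is increasing and affine on $[x_0,c]$ and on $[c,d]$, with $T^+(x_0)=c$, $T^+(c)\in(c,d)$, $T^+(d)=d$; $T^-$ is the identity off $[c,\beta]$, maps $[y_0,\beta]$ onto $[d,\beta]$, $K\cap[y_0,\beta]$ onto $K\cap[d,\beta]$ and members of $\mathcal H$ inside $[y_0,\beta]$ to members of $\mathcal H$, and is increasing and affine on $[c,d]$ and on $[d,y_0]$, with $T^-(c)=c$, $T^-(d)\in(c,d)$, $T^-(y_0)=d$; the interval $[c,d]$ is minimal for $IFS(T^+,T^-)$; and $$M=K\cup\bigcup_{\phi\in\mathcal F_1}\phi([c,d])\cup[c,d]$$ is minimal for $IFS(f,g,h,T^+,T^-)$. Moreover $M$ is a symmetric Cantorval: it is nonempty and compact, it is the closure of its interior, and each endpoint of a nontrivial component of $M$ is an accumulation point of one-point components of $M$. -/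

import Mathlib

open Set Filter
open scoped Topology ContDiff

/-! The circle is `UnitAddCircle = ℝ / ℤ`; a real number `x` is also regarded as a point of it. -/

/-! ### Iterated function systems on the circle and their minimal sets -/

/-- The IFS generated by a set of homeomorphisms of the circle: all compositions of nonempty
finite words in the generators. -/
def IFS (G : Set (UnitAddCircle ≃ₜ UnitAddCircle)) :
    Subsemigroup (UnitAddCircle ≃ₜ UnitAddCircle) :=
  Subsemigroup.closure G

/-- The orbit of a point under the IFS generated by `G`. -/
def ifsOrbit (G : Set (UnitAddCircle ≃ₜ UnitAddCircle)) (x : UnitAddCircle) :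
    Set UnitAddCircle :=
  {y | ∃ φ ∈ IFS G, φ x = y}

/-- A minimal set of an IFS: nonempty, closed, (forward) invariant under every generator, and
equal to the closure of the orbit of each of its points. -/
structure IsMinimalSet (G : Set (UnitAddCircle ≃ₜ UnitAddCircle))
    (M : Set UnitAddCircle) : Prop where
  nonempty : M.Nonempty
  isClosed : IsClosed M
  invariant : ∀ f ∈ G, f '' M ⊆ M
  dense_orbit : ∀ x ∈ M, closure (ifsOrbit G x) = M

/-- The homeomorphism `f` preserves orientation and has rotation number `ρ ∈ ℝ / ℤ`: it has a
continuous monotone degree-one lift to the line whose translation number is `ρ` mod `1`. -/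
def HasRotationNumber (f : UnitAddCircle ≃ₜ UnitAddCircle) (ρ : UnitAddCircle) : Prop :=
  ∃ F : CircleDeg1Lift, Continuous F ∧ (∀ x : ℝ, ((F x : ℝ) : UnitAddCircle) = f x) ∧
    ((F.translationNumber : ℝ) : UnitAddCircle) = ρ

/-- `f` is a `C^∞` (orientation preserving) diffeomorphism of the circle. -/
def IsSmoothDiffeo (f : UnitAddCircle ≃ₜ UnitAddCircle) : Prop :=
  ∃ F : ℝ → ℝ, ContDiff ℝ ∞ F ∧ (∀ x, 0 < deriv F x) ∧
    ∀ x : ℝ, ((F x : ℝ) : UnitAddCircle) = f x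

/-! ### The decomposition of a closed subset of the circle -/

/-- A Cantor set: nonempty, perfect and totally disconnected (as a subset of the circle it is
then compact). -/
def IsCantorSet (K : Set UnitAddCircle) : Prop :=
  K.Nonempty ∧ Perfect K ∧ IsTotallyDisconnected K

/-- The set of connected components of a subset of the circle. -/
def components (A : Set UnitAddCircle) : Set (Set UnitAddCircle) :=
  {C | ∃ x ∈ A, C = connectedComponentIn A x}

/-- For the family of the connected components of the interior of `M`, the union of the
boundaries of its members. -/
def componentBoundary (M : Set UnitAddCircle) : Set UnitAddCircle :=
  ⋃ C ∈ components (interior M), frontier C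

/-- `M` is the disjoint union of its interior (the union of the components of the interior), of
`K` and of `N`, where `K` is empty or a Cantor set, `K` contains every Cantor set included in
`M \ interior M`, and `N` is countable. -/
structure IsDecomposition (M K N : Set UnitAddCircle) : Prop where
  cantor : K = ∅ ∨ IsCantorSet K
  subset : K ⊆ M \ interior M
  maximal : ∀ K', IsCantorSet K' → K' ⊆ M \ interior M → K' ⊆ K
  eq_rest : N = M \ (interior M ∪ K)
  countable : N.Countable

/-- A symmetric Cantorval: a nonempty compact set which is the closure of its interior and such
that the endpoints of any nontrivial component are accumulation points of one-point components. -/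
structure IsSymmetricCantorval (M : Set UnitAddCircle) : Prop where
  nonempty : M.Nonempty
  isCompact : IsCompact M
  closure_interior : closure (interior M) = M
  endpoints : ∀ C ∈ components M, C.Nontrivial → ∀ e ∈ frontier C,
    AccPt e (𝓟 {y | {y} ∈ components M})

/-! ### Arcs and the building blocks -/

/-- The closed arc from `a` to `b`. -/
def arc (a b : ℝ) : Set UnitAddCircle := (fun x : ℝ => (x : UnitAddCircle)) '' Icc a b

/-- The open arc from `a` to `b`. -/
def openArc (a b : ℝ) : Set UnitAddCircle := (fun x : ℝ => (x : UnitAddCircle)) '' Ioo a b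

/-- The sets `Λ₀ = A`, `Λ_{k+1} = ⋃_{f ∈ G} f(Λ_k)`. -/
def nestedImages (G : Set (UnitAddCircle ≃ₜ UnitAddCircle)) (A : Set UnitAddCircle) :
    ℕ → Set UnitAddCircle
  | 0 => A
  | k + 1 => ⋃ f ∈ G, f '' nestedImages G A k

/-- The set `⋂ₖ Λₖ`. -/
def limitSet (G : Set (UnitAddCircle ≃ₜ UnitAddCircle)) (A : Set UnitAddCircle) :
    Set UnitAddCircle :=
  ⋂ k, nestedImages G A k

/-- The usual triadic Cantor set, carried affinely from `[0, 1]` to the arc from `a` to `b`. -/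
def triadicSet (a b : ℝ) : Set UnitAddCircle :=
  (fun x : ℝ => ((a + (b - a) * x : ℝ) : UnitAddCircle)) '' cantorSet

/-- A pair `f, g` of homeomorphisms with minimal Cantor set `K`, where `K ⊆ I' = [a, b]` and
`I' ⊆ I = [a', b']`: both maps are the identity off `I`, preimages of `K` in `I'` lie in `K`, and
the orbit of any point of `I'` accumulates on all of `K`. -/
structure IsCantorPair (f g : UnitAddCircle ≃ₜ UnitAddCircle) (K : Set UnitAddCircle)
    (a b a' b' : ℝ) : Prop where
  left : a' < a
  lt : a < b
  right : b < b'
  proper : b' < a' + 1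
  cantor : IsCantorSet K
  subset : K ⊆ arc a b
  minimal : IsMinimalSet {f, g} K
  eq_self : ∀ x ∉ arc a' b', f x = x ∧ g x = x
  preimage_left : f ⁻¹' K ∩ arc a b ⊆ K
  preimage_right : g ⁻¹' K ∩ arc a b ⊆ K
  orbit : ∀ x ∈ arc a b, K ⊆ closure (ifsOrbit {f, g} x)

/-- The maps `T⁺, T⁻` for `I' = [a, b]` inside `I = [a', b']`: on `I'` they are affine
contractions fixing `b`, respectively `a`, whose images cover `I'`; off `I` they are the
identity. -/
structure IsTPair (Tp Tm : UnitAddCircle ≃ₜ UnitAddCircle) (a b a' b' : ℝ) : Prop where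
  left : a' < a
  lt : a < b
  right : b < b'
  proper : b' < a' + 1
  affine : ∃ r s : ℝ, 0 < r ∧ r < 1 ∧ 0 < s ∧ s < 1 ∧
    (∀ x ∈ Icc a b, Tp x = ((b + r * (x - b) : ℝ) : UnitAddCircle)) ∧
    (∀ x ∈ Icc a b, Tm x = ((a + s * (x - a) : ℝ) : UnitAddCircle))
  cover : Tp '' arc a b ∪ Tm '' arc a b = arc a b
  eq_self : ∀ x ∉ arc a' b', Tp x = x ∧ Tm x = x

/-- The auxiliary homeomorphism `h` for `J' = [u', v']`, `J = [u, v]` and `A`: the identity on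
`J'`, mapping the complement of `J` into `A`, where `J` is disjoint from `A`. -/
structure IsAuxMap (h : UnitAddCircle ≃ₜ UnitAddCircle) (u' v' u v : ℝ)
    (A : Set UnitAddCircle) : Prop where
  left : u < u'
  lt : u' < v'
  right : v' < v
  proper : v < u + 1
  disjoint : Disjoint (arc u v) A
  eq_self : ∀ x ∈ arc u' v', h x = x
  maps : h '' (arc u v)ᶜ ⊆ A

/-- A homeomorphism which is the identity off `[a, b]` and pushes every point of `(a, b)` towards
`b`. -/
structure IsPush (p : UnitAddCircle ≃ₜ UnitAddCircle) (a b : ℝ) : Prop where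
  lt : a < b
  le : b ≤ a + 1
  eq_self : ∀ x ∉ arc a b, p x = x
  push : ∀ x ∈ Ioo a b, ∃ y ∈ Ioo x b, p x = (y : UnitAddCircle)

/-- Three maps that are affine of slope `1/5` on `I' = [a, b]`, carry `I'` onto the first, third
and fifth of its fifths, and are the identity off `I = [a', b']`. -/
structure IsFifthsTriple (f g h : UnitAddCircle ≃ₜ UnitAddCircle) (a b a' b' : ℝ) : Prop where
  left : a' < a
  lt : a < b
  right : b < b'
  proper : b' < a' + 1
  first : ∀ x ∈ Icc a b, f x = ((a + (x - a) / 5 : ℝ) : UnitAddCircle)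
  third : ∀ x ∈ Icc a b, g x = ((a + 2 * (b - a) / 5 + (x - a) / 5 : ℝ) : UnitAddCircle)
  fifth : ∀ x ∈ Icc a b, h x = ((a + 4 * (b - a) / 5 + (x - a) / 5 : ℝ) : UnitAddCircle)
  eq_self : ∀ x ∉ arc a' b', f x = x ∧ g x = x ∧ h x = x

/-- The maps `T⁺, T⁻` adapted to a Cantor set `K` and a family `𝓗` of gaps of `K`, on the arc
`[α, β]` around the gap `[c, d]`, with `α < x₀ < c < d < y₀ < β`. The map `T⁺` is the identity off
`[α, d]`, carries `[α, x₀]` onto `[α, c]` respecting `K` and `𝓗`, and is affine on `[x₀, c]` and on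
`[c, d]`, both of which it maps into `[c, d]`; symmetrically for `T⁻`. The arc `[c, d]` is minimal
for the two maps. -/
structure IsAdaptedTPair (Tp Tm : UnitAddCircle ≃ₜ UnitAddCircle) (K : Set UnitAddCircle)
    (𝓗 : Set (Set UnitAddCircle)) (α x₀ c d y₀ β : ℝ) : Prop where
  lt₁ : α < x₀
  lt₂ : x₀ < c
  lt₃ : c < d
  lt₄ : d < y₀
  lt₅ : y₀ < β
  mem₁ : (α : UnitAddCircle) ∈ K
  mem₂ : (x₀ : UnitAddCircle) ∈ K
  mem₃ : (y₀ : UnitAddCircle) ∈ K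
  mem₄ : (β : UnitAddCircle) ∈ K
  cantor : IsCantorSet (K ∩ arc α β)
  cantor_left : IsCantorSet (K ∩ arc α x₀)
  cantor_right : IsCantorSet (K ∩ arc y₀ β)
  plus_image : Tp '' arc α x₀ = arc α c
  plus_cantor : Tp '' (K ∩ arc α x₀) = K ∩ arc α c
  plus_gaps : ∀ C ∈ 𝓗, C ⊆ arc α x₀ → Tp '' C ∈ 𝓗
  plus_affine : ∃ m : ℝ, c < m ∧ m < d ∧
    (∀ x ∈ Icc x₀ c, Tp x = ((c + (m - c) / (c - x₀) * (x - x₀) : ℝ) : UnitAddCircle)) ∧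
    (∀ x ∈ Icc c d, Tp x = ((m + (d - m) / (d - c) * (x - c) : ℝ) : UnitAddCircle))
  plus_eq_self : ∀ x ∉ arc α d, Tp x = x
  minus_image : Tm '' arc y₀ β = arc d β
  minus_cantor : Tm '' (K ∩ arc y₀ β) = K ∩ arc d β
  minus_gaps : ∀ C ∈ 𝓗, C ⊆ arc y₀ β → Tm '' C ∈ 𝓗
  minus_affine : ∃ m : ℝ, c < m ∧ m < d ∧
    (∀ x ∈ Icc c d, Tm x = ((c + (m - c) / (d - c) * (x - c) : ℝ) : UnitAddCircle)) ∧
    (∀ x ∈ Icc d y₀, Tm x = ((m + (d - m) / (y₀ - d) * (x - d) : ℝ) : UnitAddCircle))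
  minus_eq_self : ∀ x ∉ arc c β, Tm x = x
  minimal : IsMinimalSet {Tp, Tm} (arc c d)

/-! Minimality of `M` comes down to three facts: `M` is closed, the generators map it into itself,
and each point of `M` reaches each other one, in the sense that the second lies in the orbit closure
of the first. Reaching is transitive (`Reaches.trans`), so it can be checked along a route through
one distinguished interval or point. In the cases with intervals, apart from the circle and the
Cantorval, the auxiliary homeomorphism throws all of `M` into a basic interval, the maps `T⁺, T⁻`
make every orbit dense there because they contract it and their images cover it
(`reaches_of_contraction`), and the other generators carry this interval to the remaining pieces of
`M`, or to points accumulating on them. On the circle `H₂` brings points into the interval and `H₁`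
leads out of it. In the Cantorval case nothing has to be thrown: every orbit accumulates at the
endpoint `c` of the gap, and from there `T⁺, T⁻` reach the whole gap.

The Cantor sets are limit sets of finitely many contractions of a compact set `A` with disjoint
images. Disjointness allows letters to be peeled off: if `x ∈ A` and `f x` lies in the limit set, so
does `x`, and the same holds when a set `P` in a gap is added together with all its images
(`mem_filledSet_of_apply`). Hence inside each image of `A` the set `M` is a copy of itself, and
questions about `M` become questions about one gap. In particular a single point of `A` missing from
`M` keeps the whole limit set out of the interior, since its images are also missing and accumulate
on the whole limit set (`disjoint_limitSet_interior`).

For the decomposition of `M`, the maximality of `K` is automatic once the rest is countable, because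
nonempty perfect sets are uncountable. It remains to identify the interior: each closed piece of `M`
is isolated in an open window, or its endpoints are limits of points outside `M`.

The homeomorphisms are given by lifts, piecewise affine or smoothed by a cutoff, that fix a real
number; this yields rotation number `0`.

For the Cantorval the second fifth is filled and the fourth is left open. The map `T⁺` acts as `f⁻¹`
on `f(f(I'))` and `T⁻` as `g h⁻¹ g⁻¹` on `g(h(I'))`, which makes them compatible with the
self-similar structure. The fixed point of `g` is enclosed between two missing points, and so are
its images at every scale, so it is a one-point component, and its images are dense in `K`. -/

/-! ### Orbits and words -/

/-- The orbit of `x` accumulates at `y` or contains it. -/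
def Reaches (G : Set (UnitAddCircle ≃ₜ UnitAddCircle)) (x y : UnitAddCircle) : Prop :=
  y ∈ closure (ifsOrbit G x)

section Words

variable {G G' : Set (UnitAddCircle ≃ₜ UnitAddCircle)} {A M : Set UnitAddCircle}
  {x y z : UnitAddCircle} {φ : UnitAddCircle ≃ₜ UnitAddCircle}

/-- Peels off the outermost letter. The single-letter case is separate because there is no empty
word. -/
theorem mem_IFS_cases (hφ : φ ∈ IFS G) :
    φ ∈ G ∨ ∃ f ∈ G, ∃ ψ ∈ IFS G, φ = f * ψ := by
  induction hφ using Subsemigroup.closure_induction with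
  | mem f hf => exact .inl hf
  | mul f g hf hg ihf _ =>
    right
    rcases ihf with h | ⟨k, hk, ψ, hψ, rfl⟩
    · exact ⟨f, h, g, hg, rfl⟩
    · exact ⟨k, hk, ψ * g, mul_mem hψ hg, mul_assoc _ _ _⟩

theorem mem_IFS_of_mem {f : UnitAddCircle ≃ₜ UnitAddCircle} (hf : f ∈ G) : f ∈ IFS G :=
  Subsemigroup.subset_closure hf

theorem image_subset_of_mem_IFS (h : ∀ f ∈ G, f '' A ⊆ A) (hφ : φ ∈ IFS G) : φ '' A ⊆ A := by
  induction hφ using Subsemigroup.closure_induction with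
  | mem f hf => exact h f hf
  | mul f g _ _ ihf ihg =>
    rintro _ ⟨a, ha, rfl⟩
    exact ihf ⟨g a, ihg ⟨a, ha, rfl⟩, rfl⟩

theorem countable_IFS (hG : G.Countable) :
    (IFS G : Set (UnitAddCircle ≃ₜ UnitAddCircle)).Countable := by
  have : Countable G := hG
  have hc : (range fun l : List G => (l.map Subtype.val).prod).Countable := countable_range _
  refine hc.mono fun φ hφ => ?_
  induction hφ using Subsemigroup.closure_induction with
  | mem f hf => exact ⟨[⟨f, hf⟩], by simp⟩
  | mul f g _ _ ihf ihg =>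
    obtain ⟨l, rfl⟩ := ihf
    obtain ⟨l', rfl⟩ := ihg
    exact ⟨l ++ l', by simp⟩

theorem ifsOrbit_mono (h : G ⊆ G') (x : UnitAddCircle) : ifsOrbit G x ⊆ ifsOrbit G' x := by
  rintro _ ⟨φ, hφ, rfl⟩
  exact ⟨φ, Subsemigroup.closure_mono h hφ, rfl⟩

theorem Reaches.mono (h : G ⊆ G') (hxy : Reaches G x y) : Reaches G' x y :=
  closure_mono (ifsOrbit_mono h x) hxy

theorem reaches_of_mem_IFS (hφ : φ ∈ IFS G) : Reaches G x (φ x) :=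
  subset_closure ⟨φ, hφ, rfl⟩

theorem reaches_of_mem (hφ : φ ∈ G) : Reaches G x (φ x) :=
  reaches_of_mem_IFS (mem_IFS_of_mem hφ)

/-- By continuity each word maps the orbit closure of `x` into itself, so this closed set contains
the orbit of `y` and hence its closure. -/
theorem Reaches.trans (hxy : Reaches G x y) (hyz : Reaches G y z) : Reaches G x z := by
  refine closure_minimal ?_ isClosed_closure hyz
  rintro _ ⟨φ, hφ, rfl⟩
  refine map_mem_closure φ.continuous hxy ?_
  rintro _ ⟨ψ, hψ, rfl⟩
  exact ⟨φ * ψ, mul_mem hφ hψ, rfl⟩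

theorem Reaches.apply (hxy : Reaches G x y) (hφ : φ ∈ IFS G) : Reaches G x (φ y) :=
  hxy.trans (reaches_of_mem_IFS hφ)

theorem Reaches.iterate (hxy : Reaches G x y) (hφ : φ ∈ G) (n : ℕ) : Reaches G x (φ^[n] y) := by
  induction n with
  | zero => exact hxy
  | succ n ih =>
    rw [Function.iterate_succ_apply']
    exact ih.apply (mem_IFS_of_mem hφ)

theorem reaches_of_tendsto {u : ℕ → UnitAddCircle} (hu : ∀ n, Reaches G x (u n))
    (h : Tendsto u atTop (𝓝 y)) : Reaches G x y :=
  isClosed_closure.mem_of_tendsto h (Eventually.of_forall hu)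

/-- Invariance and closedness keep every orbit closure inside `M`, so only the opposite inclusion
has to be proved in each case. -/
theorem isMinimalSet_of_reaches (hne : M.Nonempty) (hcl : IsClosed M)
    (hinv : ∀ f ∈ G, f '' M ⊆ M) (h : ∀ x ∈ M, ∀ y ∈ M, Reaches G x y) :
    IsMinimalSet G M where
  nonempty := hne
  isClosed := hcl
  invariant := hinv
  dense_orbit x hx := by
    refine subset_antisymm (closure_minimal ?_ hcl) (h x hx)
    rintro _ ⟨φ, hφ, rfl⟩
    exact image_subset_of_mem_IFS hinv hφ ⟨x, hx, rfl⟩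

/-- A generator is needed: without one there are no words and the orbit of `x` is empty. -/
theorem isMinimalSet_singleton_of_fixed (hG : G.Nonempty) (h : ∀ f ∈ G, f x = x) :
    IsMinimalSet G {x} := by
  refine isMinimalSet_of_reaches (singleton_nonempty x) isClosed_singleton ?_ ?_
  · rintro f hf _ ⟨y, rfl, rfl⟩
    exact h f hf
  · rintro y rfl z rfl
    obtain ⟨f, hf⟩ := hG
    have := reaches_of_mem (x := z) hf
    rwa [h f hf] at this

end Words

/-! ### Components and decompositions -/

section Components

variable {M K U V B : Set UnitAddCircle} {x : UnitAddCircle}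

/-- A Cantor scheme embeds the binary sequences into the set, and Cantor's diagonal argument
excludes an enumeration of them. -/
theorem Perfect.not_countable_of_nonempty {C : Set UnitAddCircle} (h : Perfect C)
    (hne : C.Nonempty) : ¬ C.Countable := by
  intro hc
  obtain ⟨f, hf, -, hinj⟩ := h.exists_nat_bool_injection hne
  have h1 : (range f).Countable := hc.mono hf
  rw [← image_univ] at h1
  have h2 : Countable (ℕ → Bool) :=
    countable_univ_iff.1 (countable_of_injective_of_countable_image hinj.injOn h1)
  obtain ⟨s, hs⟩ := exists_surjective_nat (ℕ → Bool)
  obtain ⟨n, hn⟩ := hs fun n => !(s n n)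
  simpa using congrFun hn n

/-- A point of `K'` off the closed set `K` has a closed neighbourhood avoiding `K`; the part of `K'`
in its interior has a perfect closure, which lies in `K' \ K` and is uncountable. -/
theorem IsCantorSet.subset_of_countable_diff {K K' : Set UnitAddCircle} (h : IsCantorSet K')
    (hK : IsClosed K) (hc : (K' \ K).Countable) : K' ⊆ K := by
  intro x hx
  by_contra hxK
  obtain ⟨V, hxV, hV, hVK⟩ := exists_mem_nhds_isClosed_subset (hK.isOpen_compl.mem_nhds hxK)
  have hp := h.2.1.closure_nhds_inter x hx (mem_interior_iff_mem_nhds.2 hxV) isOpen_interior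
  refine hp.1.not_countable_of_nonempty hp.2
    (hc.mono (subset_trans (closure_mono (t := V ∩ K') ?_) ?_))
  · exact inter_subset_inter_left _ interior_subset
  · rw [(hV.inter h.2.1.closed).closure_eq]
    exact fun y hy => ⟨hy.2, hVK hy.1⟩

/-- Maximality of `K` costs nothing: a Cantor set in `M \ interior M` leaves `K` in an at most
countable set, so it is included in `K`. -/
theorem isDecomposition_of_countable (hK : K = ∅ ∨ IsCantorSet K) (hsub : K ⊆ M \ interior M)
    (hc : (M \ (interior M ∪ K)).Countable) : IsDecomposition M K (M \ (interior M ∪ K)) where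
  cantor := hK
  subset := hsub
  maximal K' hK' h := by
    have hcl : IsClosed K := by
      rcases hK with rfl | hK
      · exact isClosed_empty
      · exact hK.2.1.closed
    refine hK'.subset_of_countable_diff hcl (hc.mono ?_)
    rintro x ⟨hx, hxK⟩
    exact ⟨(h hx).1, fun h' => h'.elim (h hx).2 hxK⟩
  eq_rest := rfl
  countable := hc

/-- The hypothesis on the closure makes the open set `V` relatively closed in `U`, so no connected
subset of `U` can leave it. -/
theorem connectedComponentIn_eq_of_isOpen (hV : IsOpen V) (hVc : IsPreconnected V) (hx : x ∈ V)
    (hVU : V ⊆ U) (hcl : closure V ∩ U ⊆ V) : connectedComponentIn U x = V := by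
  refine subset_antisymm ?_ (hVc.subset_connectedComponentIn hx hVU)
  refine isPreconnected_connectedComponentIn.subset_of_closure_inter_subset hV
    ⟨x, mem_connectedComponentIn (hVU hx), hx⟩ ?_
  exact fun y hy => hcl ⟨hy.1, connectedComponentIn_subset _ _ hy.2⟩

/-- Since `M ∩ V = M ∩ B`, this trace is both open and closed in `M`: open because of `V`, closed
because of `B`. -/
theorem connectedComponentIn_subset_of_isClosed (hV : IsOpen V) (hB : IsClosed B)
    (hMV : M ∩ V ⊆ B) (hBV : B ⊆ V) (hx : x ∈ B) : connectedComponentIn M x ⊆ B := by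
  by_cases hxM : x ∈ M
  · have : connectedComponentIn M x ⊆ V := by
      refine isPreconnected_connectedComponentIn.subset_of_closure_inter_subset hV
        ⟨x, mem_connectedComponentIn hxM, hBV hx⟩ ?_
      rintro y ⟨hy, hyC⟩
      have h2 := isPreconnected_iff_subset_of_disjoint.1
        (isPreconnected_connectedComponentIn (F := M) (x := x)) V Bᶜ hV hB.isOpen_compl
        (fun z _ => (em (z ∈ V)).imp id fun h h' => h (hBV h'))
        (by
          rw [← disjoint_iff_inter_eq_empty, disjoint_left]
          rintro z hz ⟨hzV, hzB⟩
          exact hzB (hMV ⟨connectedComponentIn_subset _ _ hz, hzV⟩))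
      rcases h2 with h2 | h2
      · exact h2 hyC
      · exact absurd hx (h2 (mem_connectedComponentIn hxM))
    exact fun y hy => hMV ⟨connectedComponentIn_subset _ _ hy, this hy⟩
  · rw [connectedComponentIn_eq_empty hxM]
    exact empty_subset _

theorem components_eq_range {ι : Type*} {V : ι → Set UnitAddCircle} (hU : U = ⋃ i, V i)
    (ho : ∀ i, IsOpen (V i)) (hc : ∀ i, IsConnected (V i))
    (hcl : ∀ i, closure (V i) ∩ U ⊆ V i) : components U = range V := by
  have key : ∀ i, ∀ x ∈ V i, connectedComponentIn U x = V i := fun i x hx =>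
    connectedComponentIn_eq_of_isOpen (ho i) (hc i).isPreconnected hx
      (hU ▸ subset_iUnion V i) (hcl i)
  ext C
  constructor
  · rintro ⟨x, hx, rfl⟩
    rw [hU] at hx
    obtain ⟨i, hi⟩ := mem_iUnion.1 hx
    exact ⟨i, (key i x hi).symm⟩
  · rintro ⟨i, rfl⟩
    obtain ⟨x, hx⟩ := (hc i).nonempty
    exact ⟨x, hU ▸ mem_iUnion.2 ⟨i, hx⟩, (key i x hx).symm⟩

theorem interior_inter_of_inter_subset (hV : IsOpen V) (h : M ∩ V ⊆ B) :
    interior M ∩ V ⊆ interior B :=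
  interior_maximal (fun _ hy => h ⟨interior_subset hy.1, hy.2⟩) (isOpen_interior.inter hV)

/-- If a closed set `M` is a union of closures of open connected sets `V i` and of a set `R`, and
neither the boundary of the `V i` nor `R` meets the interior of `M`, then the `V i` are the
components of the interior. -/
theorem interior_eq_iUnion {ι : Type*} {V : ι → Set UnitAddCircle} {R : Set UnitAddCircle}
    (hM : M = (⋃ i, closure (V i)) ∪ R) (ho : ∀ i, IsOpen (V i))
    (hcl : ∀ i, closure (V i) ∩ interior M ⊆ V i) (hR : Disjoint R (interior M)) :
    interior M = ⋃ i, V i := by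
  refine subset_antisymm ?_ ?_
  · intro x hx
    have hxM := interior_subset hx
    rw [hM] at hxM
    rcases hxM with hxM | hxR
    · obtain ⟨i, hi⟩ := mem_iUnion.1 hxM
      exact mem_iUnion.2 ⟨i, hcl i ⟨hi, hx⟩⟩
    · exact absurd hx (disjoint_left.1 hR hxR)
  · refine interior_maximal ?_ (isOpen_iUnion ho)
    refine iUnion_subset fun i => subset_closure.trans ?_
    rw [hM]
    exact (subset_iUnion (fun i => closure (V i)) i).trans subset_union_left

end Components

/-! ### Contracting systems of homeomorphisms -/

section Contraction

variable {G : Set (UnitAddCircle ≃ₜ UnitAddCircle)} {A K : Set UnitAddCircle} {r : ℝ}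

/-- If the maps of `G` contract `A` and the images of `K ⊆ A` cover `K`, then every point of `K`
lies in images of `K` under words contracting `A` as much as desired. -/
theorem exists_mem_IFS_dist_le (hA : Bornology.IsBounded A) (hr : r < 1) (hr0 : 0 ≤ r)
    (hmaps : ∀ f ∈ G, f '' A ⊆ A)
    (hcon : ∀ f ∈ G, ∀ x ∈ A, ∀ y ∈ A, dist (f x) (f y) ≤ r * dist x y)
    (hcov : K ⊆ ⋃ f ∈ G, f '' K) {ε : ℝ} (hε : 0 < ε) {y : UnitAddCircle} (hy : y ∈ K) :
    ∃ φ ∈ IFS G, y ∈ φ '' K ∧ ∀ x ∈ A, ∀ z ∈ A, dist (φ x) (φ z) ≤ ε := by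
  obtain ⟨D, hD⟩ := Metric.isBounded_iff.1 hA
  -- The exponent is `n + 1` because words have at least one letter.
  have key : ∀ n : ℕ, ∀ y ∈ K, ∃ φ ∈ IFS G, y ∈ φ '' K ∧
      ∀ x ∈ A, ∀ z ∈ A, dist (φ x) (φ z) ≤ r ^ (n + 1) * dist x z := by
    intro n
    induction n with
    | zero =>
      intro y hy
      obtain ⟨f, hf, hyf⟩ := mem_iUnion₂.1 (hcov hy)
      exact ⟨f, mem_IFS_of_mem hf, hyf, by simpa using hcon f hf⟩
    | succ n ih =>
      intro y hy
      obtain ⟨f, hf, w, hw, rfl⟩ := mem_iUnion₂.1 (hcov hy)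
      obtain ⟨φ, hφ, ⟨v, hv, rfl⟩, hd⟩ := ih w hw
      refine ⟨f * φ, mul_mem (mem_IFS_of_mem hf) hφ, ⟨v, hv, rfl⟩, fun x hx z hz => ?_⟩
      have hφA := image_subset_of_mem_IFS hmaps hφ
      calc dist (f (φ x)) (f (φ z)) ≤ r * dist (φ x) (φ z) :=
            hcon f hf _ (hφA ⟨x, hx, rfl⟩) _ (hφA ⟨z, hz, rfl⟩)
        _ ≤ r * (r ^ (n + 1) * dist x z) := mul_le_mul_of_nonneg_left (hd x hx z hz) hr0
        _ = r ^ (n + 1 + 1) * dist x z := by ring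
  -- The bound `D` is not known to be nonnegative, whence `max D 0`.
  have hlim : Tendsto (fun n : ℕ => r ^ (n + 1) * max D 0) atTop (𝓝 0) := by
    have := ((tendsto_pow_atTop_nhds_zero_of_lt_one hr0 hr).comp
      (tendsto_add_atTop_nat 1)).mul_const
      (max D 0)
    simpa using this
  obtain ⟨n, hn⟩ := (hlim.eventually (gt_mem_nhds hε)).exists
  obtain ⟨φ, hφ, hyφ, hd⟩ := key n y hy
  refine ⟨φ, hφ, hyφ, fun x hx z hz => (hd x hx z hz).trans (le_trans ?_ hn.le)⟩
  exact mul_le_mul_of_nonneg_left ((hD hx hz).trans (le_max_left _ _)) (by positivity)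

/-- The target `y` lies in arbitrarily small images `φ(A)`, and each of them also contains the orbit
point `φ x`. -/
theorem reaches_of_contraction (hA : Bornology.IsBounded A) (hr : r < 1) (hr0 : 0 ≤ r)
    (hmaps : ∀ f ∈ G, f '' A ⊆ A)
    (hcon : ∀ f ∈ G, ∀ x ∈ A, ∀ y ∈ A, dist (f x) (f y) ≤ r * dist x y)
    (hKA : K ⊆ A) (hcov : K ⊆ ⋃ f ∈ G, f '' K) {x y : UnitAddCircle} (hx : x ∈ A) (hy : y ∈ K) :
    Reaches G x y := by
  refine Metric.mem_closure_iff.2 fun ε hε => ?_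
  obtain ⟨φ, hφ, ⟨v, hv, rfl⟩, hd⟩ :=
    exists_mem_IFS_dist_le hA hr hr0 hmaps hcon hcov (half_pos hε) hy
  exact ⟨φ x, ⟨φ, hφ, rfl⟩, (hd v (hKA hv) x hx).trans_lt (half_lt_self hε)⟩

end Contraction

/-- A finite system of homeomorphisms contracting a compact set `A` into itself,
images. -/
structure IsContractingSystem (G : Set (UnitAddCircle ≃ₜ UnitAddCircle)) (A : Set UnitAddCircle) :
    Prop where
  finite : G.Finite
  nontrivial : G.Nontrivial
  compact : IsCompact A
  nonempty : A.Nonempty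
  maps : ∀ f ∈ G, f '' A ⊆ A
  disjoint : ∀ f ∈ G, ∀ g ∈ G, f ≠ g → Disjoint (f '' A) (g '' A)
  contract : ∃ r : ℝ, 0 ≤ r ∧ r < 1 ∧
    ∀ f ∈ G, ∀ x ∈ A, ∀ y ∈ A, dist (f x) (f y) ≤ r * dist x y

namespace IsContractingSystem

variable {G : Set (UnitAddCircle ≃ₜ UnitAddCircle)} {A P : Set UnitAddCircle}
  {f g φ : UnitAddCircle ≃ₜ UnitAddCircle} {x y : UnitAddCircle}

theorem nestedImages_subset (h : IsContractingSystem G A) (k : ℕ) : nestedImages G A k ⊆ A := by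
  induction k with
  | zero => exact subset_rfl
  | succ k ih => exact iUnion₂_subset fun f hf => (image_mono ih).trans (h.maps f hf)

theorem nestedImages_succ_subset (h : IsContractingSystem G A) (k : ℕ) :
    nestedImages G A (k + 1) ⊆ nestedImages G A k := by
  induction k with
  | zero => exact h.nestedImages_subset 1
  | succ k ih => exact iUnion₂_mono fun f _ => image_mono ih

theorem isCompact_nestedImages (h : IsContractingSystem G A) (k : ℕ) :
    IsCompact (nestedImages G A k) := by
  induction k with
  | zero => exact h.compact
  | succ k ih => exact h.finite.isCompact_biUnion fun f _ => ih.image f.continuous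

theorem nestedImages_nonempty (h : IsContractingSystem G A) (k : ℕ) :
    (nestedImages G A k).Nonempty := by
  induction k with
  | zero => exact h.nonempty
  | succ k ih =>
    obtain ⟨f, hf⟩ := h.nontrivial.nonempty
    obtain ⟨x, hx⟩ := ih
    exact ⟨f x, mem_iUnion₂.2 ⟨f, hf, x, hx, rfl⟩⟩

theorem limitSet_subset (h : IsContractingSystem G A) : limitSet G A ⊆ A :=
  (iInter_subset _ 0).trans (h.nestedImages_subset 0)

theorem isClosed_limitSet (h : IsContractingSystem G A) : IsClosed (limitSet G A) :=
  isClosed_iInter fun k => (h.isCompact_nestedImages k).isClosed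

theorem limitSet_nonempty (h : IsContractingSystem G A) : (limitSet G A).Nonempty :=
  IsCompact.nonempty_iInter_of_sequence_nonempty_isCompact_isClosed _ h.nestedImages_succ_subset
    h.nestedImages_nonempty (h.isCompact_nestedImages 0)
    fun k => (h.isCompact_nestedImages k).isClosed

theorem image_limitSet_subset (h : IsContractingSystem G A) (hf : f ∈ G) :
    f '' limitSet G A ⊆ limitSet G A := by
  rintro _ ⟨x, hx, rfl⟩
  refine mem_iInter.2 fun k => ?_
  cases k with
  | zero => exact h.maps f hf ⟨x, h.limitSet_subset hx, rfl⟩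
  | succ k => exact mem_iUnion₂.2 ⟨f, hf, x, mem_iInter.1 hx k, rfl⟩

/-- Disjointness of the first-level images makes the letter and the preimage unique; all peeling
arguments below rest on this. -/
theorem eq_of_apply_mem (h : IsContractingSystem G A) (hf : f ∈ G) (hg : g ∈ G) (hx : x ∈ A)
    (hy : y ∈ A) (hxy : f x = g y) : f = g ∧ x = y := by
  have : f = g := by
    by_contra hne
    exact disjoint_left.1 (h.disjoint f hf g hg hne) ⟨x, hx, rfl⟩ ⟨y, hy, hxy.symm⟩
  subst this
  exact ⟨rfl, f.injective hxy⟩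

/-- For each `k` the point `f x` comes from level `k` by some letter, and uniqueness forces the
letter `f` and the preimage `x`. -/
theorem mem_limitSet_of_apply (h : IsContractingSystem G A) (hf : f ∈ G) (hx : x ∈ A)
    (hfx : f x ∈ limitSet G A) : x ∈ limitSet G A := by
  refine mem_iInter.2 fun k => ?_
  obtain ⟨g, hg, y, hy, hyx⟩ := mem_iUnion₂.1 (mem_iInter.1 hfx (k + 1))
  rwa [(h.eq_of_apply_mem hf hg hx (h.nestedImages_subset k hy) hyx.symm).2]

/-- In general a compactness argument selects one letter that works at all levels; here level `1`
already determines it. -/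
theorem limitSet_eq_iUnion (h : IsContractingSystem G A) :
    limitSet G A = ⋃ f ∈ G, f '' limitSet G A := by
  refine subset_antisymm ?_ (iUnion₂_subset fun f hf => h.image_limitSet_subset hf)
  intro x hx
  obtain ⟨f, hf, y, hy, rfl⟩ := mem_iUnion₂.1 (mem_iInter.1 hx 1)
  exact mem_iUnion₂.2 ⟨f, hf, y, h.mem_limitSet_of_apply hf hy hx, rfl⟩

theorem limitSet_inter_image (h : IsContractingSystem G A) (hφ : φ ∈ IFS G) :
    limitSet G A ∩ φ '' A = φ '' limitSet G A := by
  induction hφ using Subsemigroup.closure_induction with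
  | mem f hf =>
    refine subset_antisymm ?_ fun x hx =>
      ⟨h.image_limitSet_subset hf hx, image_mono h.limitSet_subset hx⟩
    rintro _ ⟨hx, y, hy, rfl⟩
    exact ⟨y, h.mem_limitSet_of_apply hf hy hx, rfl⟩
  | mul f g hf hg ihf ihg =>
    have e : ∀ S : Set UnitAddCircle,
        (f * g : UnitAddCircle ≃ₜ UnitAddCircle) '' S = f '' (g '' S) :=
      fun S => (image_image f g S).symm
    rw [e, e, ← ihg, image_inter f.injective, ← ihf, inter_assoc,
      inter_eq_self_of_subset_right (image_mono (image_subset_of_mem_IFS h.maps hg))]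

theorem isBounded (h : IsContractingSystem G A) : Bornology.IsBounded A := h.compact.isBounded

theorem exists_small_image (h : IsContractingSystem G A) {ε : ℝ} (hε : 0 < ε)
    (hx : x ∈ limitSet G A) :
    ∃ φ ∈ IFS G, x ∈ φ '' limitSet G A ∧ ∀ y ∈ A, ∀ z ∈ A, dist (φ y) (φ z) ≤ ε := by
  obtain ⟨r, hr0, hr, hcon⟩ := h.contract
  exact exists_mem_IFS_dist_le h.isBounded hr hr0 h.maps hcon h.limitSet_eq_iUnion.subset hε hx

theorem reaches_limitSet (h : IsContractingSystem G A) (hx : x ∈ A) (hy : y ∈ limitSet G A) :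
    Reaches G x y := by
  obtain ⟨r, hr0, hr, hcon⟩ := h.contract
  exact reaches_of_contraction h.isBounded hr hr0 h.maps hcon h.limitSet_subset
    h.limitSet_eq_iUnion.subset hx hy

theorem limitSet_nontrivial (h : IsContractingSystem G A) : (limitSet G A).Nontrivial := by
  obtain ⟨f, hf, g, hg, hne⟩ := h.nontrivial
  obtain ⟨x, hx⟩ := h.limitSet_nonempty
  refine ⟨f x, h.image_limitSet_subset hf ⟨x, hx, rfl⟩, g x,
    h.image_limitSet_subset hg ⟨x, hx, rfl⟩, fun he => hne ?_⟩
  exact (h.eq_of_apply_mem hf hg (h.limitSet_subset hx) (h.limitSet_subset hx) he).1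

/-- Each point lies in arbitrarily small copies `φ(K)`, and each copy has at least two points. -/
theorem perfect_limitSet (h : IsContractingSystem G A) : Perfect (limitSet G A) := by
  refine ⟨h.isClosed_limitSet, preperfect_iff_nhds.2 fun x hx U hU => ?_⟩
  obtain ⟨ε, hε, hεU⟩ := Metric.mem_nhds_iff.1 hU
  obtain ⟨φ, hφ, ⟨y, hy, rfl⟩, hd⟩ := h.exists_small_image (half_pos hε) hx
  obtain ⟨z, hz, hzy⟩ := h.limitSet_nontrivial.exists_ne y
  have hφK : φ '' limitSet G A ⊆ limitSet G A :=
    image_subset_of_mem_IFS (fun f hf => h.image_limitSet_subset hf) hφ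
  exact ⟨φ z, ⟨hεU ((hd z (h.limitSet_subset hz) y (h.limitSet_subset hy)).trans_lt
    (half_lt_self hε)), hφK ⟨z, hz, rfl⟩⟩, fun he => hzy (φ.injective he)⟩

/-- A connected subset lies in one of the finitely many disjoint closed images `f(A)`. Its preimage
under `f` is again a connected subset of the limit set, so by induction its diameter is at most `r ^
n * D` for every `n`. -/
theorem isTotallyDisconnected_limitSet (h : IsContractingSystem G A) :
    IsTotallyDisconnected (limitSet G A) := by
  obtain ⟨r, hr0, hr, hcon⟩ := h.contract
  obtain ⟨D, hD⟩ := Metric.isBounded_iff.1 h.isBounded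
  have key : ∀ n : ℕ, ∀ S ⊆ limitSet G A, IsPreconnected S →
      ∀ x ∈ S, ∀ y ∈ S, dist x y ≤ r ^ n * D := by
    intro n
    induction n with
    | zero =>
      intro S hS _ x hx y hy
      simpa using hD (h.limitSet_subset (hS hx)) (h.limitSet_subset (hS hy))
    | succ n ih =>
      intro S hS hSc x hx y hy
      have hxK := hS hx
      rw [h.limitSet_eq_iUnion] at hxK
      obtain ⟨f, hf, x', hx', rfl⟩ := mem_iUnion₂.1 hxK
      have hcl : IsClosed (⋃ g ∈ G \ {f}, g '' A) :=
        (h.finite.subset sdiff_subset).isClosed_biUnion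
          fun g _ => (h.compact.image g.continuous).isClosed
      have hSf : S ⊆ f '' A := by
        have h2 := isPreconnected_iff_subset_of_disjoint_closed.1 hSc (f '' A)
          (⋃ g ∈ G \ {f}, g '' A) (h.compact.image f.continuous).isClosed hcl ?_ ?_
        · rcases h2 with h2 | h2
          · exact h2
          · obtain ⟨g, hg, z, hz, hzx⟩ := mem_iUnion₂.1 (h2 hx)
            exact absurd (h.eq_of_apply_mem hg.1 hf hz (h.limitSet_subset hx') hzx).1 hg.2
        · intro z hz
          have hzK := hS hz
          rw [h.limitSet_eq_iUnion] at hzK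
          obtain ⟨g, hg, w, hw, rfl⟩ := mem_iUnion₂.1 hzK
          by_cases hgf : g = f
          · exact .inl ⟨w, h.limitSet_subset hw, by rw [hgf]⟩
          · exact .inr (mem_iUnion₂.2 ⟨g, ⟨hg, hgf⟩, w, h.limitSet_subset hw, rfl⟩)
        · rw [← disjoint_iff_inter_eq_empty, disjoint_left]
          rintro z _ ⟨⟨w, hw, rfl⟩, hz⟩
          obtain ⟨g, hg, v, hv, hvw⟩ := mem_iUnion₂.1 hz
          exact hg.2 (h.eq_of_apply_mem hg.1 hf hv hw hvw).1
      have hpre : ∀ z, f z ∈ S → z ∈ limitSet G A := by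
        intro z hz
        obtain ⟨w, hw, hwz⟩ := hSf hz
        rw [← f.injective hwz]
        exact h.mem_limitSet_of_apply hf hw (hwz ▸ hS hz)
      obtain ⟨y', hy', rfl⟩ := hSf hy
      have := ih (f ⁻¹' S) hpre (f.isPreconnected_preimage.2 hSc) x' hx y' hy
      calc dist (f x') (f y') ≤ r * dist x' y' :=
            hcon f hf _ (h.limitSet_subset hx') _ hy'
        _ ≤ r * (r ^ n * D) := mul_le_mul_of_nonneg_left this hr0
        _ = r ^ (n + 1) * D := by ring
  intro S hS hSc x hx y hy
  have hlim : Tendsto (fun n : ℕ => r ^ n * D) atTop (𝓝 0) := by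
    simpa using (tendsto_pow_atTop_nhds_zero_of_lt_one hr0 hr).mul_const D
  exact dist_le_zero.1 (ge_of_tendsto' hlim fun n => key n S hS hSc x hx y hy)

theorem isCantorSet_limitSet (h : IsContractingSystem G A) : IsCantorSet (limitSet G A) :=
  ⟨h.limitSet_nonempty, h.perfect_limitSet, h.isTotallyDisconnected_limitSet⟩

theorem isMinimalSet_limitSet (h : IsContractingSystem G A) : IsMinimalSet G (limitSet G A) :=
  isMinimalSet_of_reaches h.limitSet_nonempty h.isClosed_limitSet
    (fun _ hf => h.image_limitSet_subset hf)
    fun _ hx _ hy => h.reaches_limitSet (h.limitSet_subset hx) hy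

end IsContractingSystem

/-! ### Limit sets with a set and all its images added -/

/-- The limit set of a system together with all images of a set `P`. -/
def filledSet (G : Set (UnitAddCircle ≃ₜ UnitAddCircle)) (A P : Set UnitAddCircle) :
    Set UnitAddCircle :=
  limitSet G A ∪ (⋃ φ ∈ IFS G, φ '' P) ∪ P

section FilledSet

variable {G : Set (UnitAddCircle ≃ₜ UnitAddCircle)} {A P V : Set UnitAddCircle}
  {f g φ : UnitAddCircle ≃ₜ UnitAddCircle} {x y : UnitAddCircle}

theorem limitSet_subset_filledSet : limitSet G A ⊆ filledSet G A P :=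
  subset_union_left.trans subset_union_left

theorem subset_filledSet : P ⊆ filledSet G A P := subset_union_right

theorem image_subset_filledSet (hφ : φ ∈ IFS G) : φ '' P ⊆ filledSet G A P := fun _ hx =>
  .inl (.inr (mem_iUnion₂.2 ⟨φ, hφ, hx⟩))

namespace IsContractingSystem

theorem image_filledSet_subset (h : IsContractingSystem G A) (hφ : φ ∈ IFS G) :
    φ '' filledSet G A P ⊆ filledSet G A P := by
  rintro _ ⟨x, (hx | hx) | hx, rfl⟩
  · exact limitSet_subset_filledSet
      (image_subset_of_mem_IFS (fun f hf => h.image_limitSet_subset hf) hφ ⟨x, hx, rfl⟩)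
  · obtain ⟨ψ, hψ, y, hy, rfl⟩ := mem_iUnion₂.1 hx
    exact image_subset_filledSet (mul_mem hφ hψ) ⟨y, hy, rfl⟩
  · exact image_subset_filledSet hφ ⟨x, hx, rfl⟩

theorem filledSet_subset (h : IsContractingSystem G A) (hP : P ⊆ A) : filledSet G A P ⊆ A :=
  union_subset (union_subset h.limitSet_subset
    (iUnion₂_subset fun _ hφ => (image_mono hP).trans (image_subset_of_mem_IFS h.maps hφ))) hP

theorem filledSet_subset_iUnion (h : IsContractingSystem G A) :
    filledSet G A P ⊆ (⋃ f ∈ G, f '' filledSet G A P) ∪ P := by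
  rintro x ((hx | hx) | hx)
  · rw [h.limitSet_eq_iUnion] at hx
    exact .inl (iUnion₂_mono (fun f _ => image_mono limitSet_subset_filledSet) hx)
  · obtain ⟨φ, hφ, y, hy, rfl⟩ := mem_iUnion₂.1 hx
    rcases mem_IFS_cases hφ with hf | ⟨f, hf, ψ, hψ, rfl⟩
    · exact .inl (mem_iUnion₂.2 ⟨φ, hf, y, subset_filledSet hy, rfl⟩)
    · exact .inl (mem_iUnion₂.2 ⟨f, hf, ψ y, image_subset_filledSet hψ ⟨y, hy, rfl⟩, rfl⟩)
  · exact .inr hx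

/-- For each `k` the set is covered by the compact level `k` and a closed subset built from finitely
many images of `P`. A limit point outside the set must therefore lie in all levels, that is, in the
limit set. -/
theorem isClosed_filledSet (h : IsContractingSystem G A) (hP : P ⊆ A) (hPc : IsClosed P) :
    IsClosed (filledSet G A P) := by
  have key : ∀ k : ℕ, ∃ C, IsClosed C ∧ C ⊆ filledSet G A P ∧
      filledSet G A P ⊆ nestedImages G A k ∪ C := by
    intro k
    induction k with
    | zero =>
      exact ⟨∅, isClosed_empty, empty_subset _, (h.filledSet_subset hP).trans subset_union_left⟩
    | succ k ih =>
      obtain ⟨C, hC, hCM, hMC⟩ := ih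
      refine ⟨P ∪ ⋃ f ∈ G, f '' C, hPc.union (h.finite.isClosed_biUnion fun f _ =>
        f.isClosedMap _ hC), union_subset subset_filledSet (iUnion₂_subset fun f hf =>
        (image_mono hCM).trans (h.image_filledSet_subset (mem_IFS_of_mem hf))), fun x hx => ?_⟩
      rcases h.filledSet_subset_iUnion hx with hx | hx
      · obtain ⟨f, hf, y, hy, rfl⟩ := mem_iUnion₂.1 hx
        rcases hMC hy with hy | hy
        · exact .inl (mem_iUnion₂.2 ⟨f, hf, y, hy, rfl⟩)
        · exact .inr (.inr (mem_iUnion₂.2 ⟨f, hf, y, hy, rfl⟩))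
      · exact .inr (.inl hx)
  refine isClosed_of_closure_subset fun x hx => ?_
  by_contra hxM
  refine hxM (limitSet_subset_filledSet (mem_iInter.2 fun k => ?_))
  obtain ⟨C, hC, hCM, hMC⟩ := key k
  rcases closure_minimal hMC ((h.isCompact_nestedImages k).isClosed.union hC) hx with hx | hx
  · exact hx
  · exact absurd (hCM hx) hxM

/-- Letters can be peeled off here too: a point of `f(A)` is not in `P`, so it comes from the filled
set by one letter, which must be `f`. -/
theorem mem_filledSet_of_apply (h : IsContractingSystem G A) (hP : P ⊆ A)
    (hd : ∀ f ∈ G, Disjoint P (f '' A)) (hφ : φ ∈ IFS G) (hx : x ∈ A)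
    (hφx : φ x ∈ filledSet G A P) : x ∈ filledSet G A P := by
  induction hφ using Subsemigroup.closure_induction generalizing x with
  | mem f hf =>
    rcases h.filledSet_subset_iUnion hφx with hx' | hx'
    · obtain ⟨g, hg, y, hy, hyx⟩ := mem_iUnion₂.1 hx'
      rwa [(h.eq_of_apply_mem hf hg hx (h.filledSet_subset hP hy) hyx.symm).2]
    · exact absurd ⟨x, hx, rfl⟩ (disjoint_left.1 (hd f hf) hx')
  | mul f g hf hg ihf ihg =>
    exact ihg hx (ihf (image_subset_of_mem_IFS h.maps hg ⟨x, hx, rfl⟩) hφx)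

/-- One hole `y` in `A` suffices: its images accumulate at every point of the limit set, and peeling
shows that none of them is in the filled set. -/
theorem disjoint_limitSet_interior (h : IsContractingSystem G A) (hP : P ⊆ A)
    (hd : ∀ f ∈ G, Disjoint P (f '' A)) (hy : y ∈ A) (hyM : y ∉ filledSet G A P) :
    Disjoint (limitSet G A) (interior (filledSet G A P)) := by
  refine disjoint_left.2 fun x hx hxi => ?_
  obtain ⟨_, hz, φ, hφ, rfl⟩ := mem_closure_iff.1 (h.reaches_limitSet hy hx) _ isOpen_interior hxi
  exact hyM (h.mem_filledSet_of_apply hP hd hφ hy (interior_subset hz))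

/-- A gap avoids all first-level images, and outside them the filled set consists of `P` alone. -/
theorem filledSet_inter_subset (h : IsContractingSystem G A)
    (hV : ∀ f ∈ G, Disjoint V (f '' A)) (hP : P ⊆ A) : filledSet G A P ∩ V ⊆ P := by
  rintro x ⟨hx, hxV⟩
  rcases h.filledSet_subset_iUnion hx with hx | hx
  · obtain ⟨f, hf, hx⟩ := mem_iUnion₂.1 hx
    exact absurd (image_mono (h.filledSet_subset hP) hx) (disjoint_left.1 (hV f hf) hxV)
  · exact hx

/-- Near `x` the preimage of the interior stays in `A`, where it consists of points of the filled
set by peeling. -/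
theorem apply_notMem_interior (h : IsContractingSystem G A) (hP : P ⊆ A)
    (hd : ∀ f ∈ G, Disjoint P (f '' A)) (hφ : φ ∈ IFS G) (hx : x ∈ interior A)
    (hxi : x ∉ interior (filledSet G A P)) : φ x ∉ interior (filledSet G A P) := by
  intro hφx
  refine hxi (mem_interior.2 ⟨φ ⁻¹' interior (filledSet G A P) ∩ interior A, ?_,
    (isOpen_interior.preimage φ.continuous).inter isOpen_interior, hφx, hx⟩)
  exact fun y hy => h.mem_filledSet_of_apply hP hd hφ (interior_subset hy.2) (interior_subset hy.1)

theorem notMem_limitSet_of_apply (h : IsContractingSystem G A) (hφ : φ ∈ IFS G) (hx : x ∈ A)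
    (hxK : x ∉ limitSet G A) : φ x ∉ limitSet G A := by
  intro hφx
  obtain ⟨y, hy, hyx⟩ := (h.limitSet_inter_image hφ).subset ⟨hφx, x, hx, rfl⟩
  exact hxK (φ.injective hyx ▸ hy)

end IsContractingSystem

end FilledSet

/-! ### Arcs -/

section Arcs

variable {a b c d e x y : ℝ}

theorem coe_eq_coe_iff : (x : UnitAddCircle) = y ↔ ∃ n : ℤ, y + n = x := by
  rw [← sub_eq_zero, ← AddCircle.coe_sub, AddCircle.coe_eq_zero_iff]
  refine exists_congr fun n => ?_
  rw [zsmul_eq_mul, mul_one, eq_sub_iff_add_eq']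

theorem coe_add_one (x : ℝ) : ((x + 1 : ℝ) : UnitAddCircle) = x := by
  simp

/-- The two representatives differ by an integer of absolute value less than `1`. Through this,
membership in arcs becomes a matter of inequalities between reals. -/
theorem coe_inj_of_lt (h : (x : UnitAddCircle) = y) (hxy : x < y + 1) (hyx : y < x + 1) :
    x = y := by
  obtain ⟨n, rfl⟩ := coe_eq_coe_iff.1 h
  have h1 : (n : ℝ) < 1 := by linarith
  have h2 : (-1 : ℝ) < n := by linarith
  have h3 : n < 1 := by exact_mod_cast h1
  have h4 : -1 < n := by exact_mod_cast h2
  obtain rfl : n = 0 := by omega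
  simp

theorem exists_coe_eq (e : ℝ) (z : UnitAddCircle) :
    ∃ x ∈ Ico e (e + 1), (x : UnitAddCircle) = z := by
  have h : z ∈ ((↑) : ℝ → UnitAddCircle) '' Ico e (e + 1) := by
    rw [AddCircle.coe_image_Ico_eq]; trivial
  exact h

theorem coe_mem_arc (h : x ∈ Icc a b) : (x : UnitAddCircle) ∈ arc a b := ⟨x, h, rfl⟩

theorem coe_mem_openArc (h : x ∈ Ioo a b) : (x : UnitAddCircle) ∈ openArc a b := ⟨x, h, rfl⟩

theorem coe_mem_arc_iff (hxa : x < a + 1) (hbx : b < x + 1) :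
    (x : UnitAddCircle) ∈ arc a b ↔ x ∈ Icc a b := by
  refine ⟨?_, coe_mem_arc⟩
  rintro ⟨y, hy, hyx⟩
  rwa [← coe_inj_of_lt hyx (by linarith [hy.2]) (by linarith [hy.1])]

theorem coe_mem_openArc_iff (hxa : x < a + 1) (hbx : b ≤ x + 1) :
    (x : UnitAddCircle) ∈ openArc a b ↔ x ∈ Ioo a b := by
  refine ⟨?_, coe_mem_openArc⟩
  rintro ⟨y, hy, hyx⟩
  rwa [← coe_inj_of_lt hyx (by linarith [hy.2]) (by linarith [hy.1])]

theorem arc_mono (hca : c ≤ a) (hbd : b ≤ d) : arc a b ⊆ arc c d :=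
  image_mono (Icc_subset_Icc hca hbd)

theorem openArc_subset_arc : openArc a b ⊆ arc a b := image_mono Ioo_subset_Icc_self

theorem arc_subset_openArc (hca : c < a) (hbd : b < d) : arc a b ⊆ openArc c d :=
  image_mono (Icc_subset_Ioo hca hbd)

theorem arc_union_arc (hab : a ≤ b) (hbc : b ≤ c) : arc a b ∪ arc b c = arc a c := by
  rw [arc, arc, arc, ← image_union, Icc_union_Icc_eq_Icc hab hbc]

theorem disjoint_arc (hbc : b < c) (hda : d < a + 1) : Disjoint (arc a b) (arc c d) := by
  rw [disjoint_left]
  rintro _ ⟨x, hx, rfl⟩ ⟨y, hy, hyx⟩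
  have := coe_inj_of_lt hyx (by linarith [hx.1, hy.2]) (by linarith [hx.2, hy.1])
  linarith [hx.2, hy.1]

theorem disjoint_openArc_arc (hbc : b ≤ c) (hda : d ≤ a + 1) :
    Disjoint (openArc a b) (arc c d) := by
  rw [disjoint_left]
  rintro _ ⟨x, hx, rfl⟩ ⟨y, hy, hyx⟩
  have := coe_inj_of_lt hyx (by linarith [hx.1, hy.2]) (by linarith [hx.2, hy.1])
  linarith [hx.2, hy.1]

theorem isCompact_arc : IsCompact (arc a b) := isCompact_Icc.image (AddCircle.continuous_mk' 1)

theorem isClosed_arc : IsClosed (arc a b) := isCompact_arc.isClosed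

theorem isOpen_openArc : IsOpen (openArc a b) := QuotientAddGroup.isOpenMap_coe _ isOpen_Ioo

theorem isConnected_arc (h : a ≤ b) : IsConnected (arc a b) :=
  (isConnected_Icc h).image _ (AddCircle.continuous_mk' 1).continuousOn

theorem isConnected_openArc (h : a < b) : IsConnected (openArc a b) :=
  (isConnected_Ioo h).image _ (AddCircle.continuous_mk' 1).continuousOn

theorem closure_openArc (h : a < b) : closure (openArc a b) = arc a b := by
  refine subset_antisymm (closure_minimal openArc_subset_arc isClosed_arc) ?_
  rw [arc, ← closure_Ioo h.ne]
  exact image_closure_subset_closure_image (AddCircle.continuous_mk' 1)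

theorem arc_eq_openArc_union (h : a ≤ b) :
    arc a b = openArc a b ∪ {(a : UnitAddCircle), (b : UnitAddCircle)} := by
  rw [arc, openArc, ← Ioo_union_both h, image_union, image_pair]

theorem frontier_openArc (h : a < b) (hb : b ≤ a + 1) :
    frontier (openArc a b) = {(a : UnitAddCircle), (b : UnitAddCircle)} := by
  rw [isOpen_openArc.frontier_eq, closure_openArc h, arc_eq_openArc_union h.le, union_sdiff_left,
    sdiff_eq_left]
  rw [disjoint_left]
  rintro z (rfl | rfl) hz
  · rw [coe_mem_openArc_iff (by linarith) hb] at hz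
    exact lt_irrefl _ hz.1
  · rcases hb.eq_or_lt with rfl | hb
    · rw [coe_add_one, coe_mem_openArc_iff (by linarith) le_rfl] at hz
      exact lt_irrefl _ hz.1
    · rw [coe_mem_openArc_iff hb (by linarith)] at hz
      exact lt_irrefl _ hz.2

theorem interior_arc (h : a < b) (hb : b < a + 1) : interior (arc a b) = openArc a b := by
  refine subset_antisymm (fun z hz => ?_) (interior_maximal openArc_subset_arc isOpen_openArc)
  have hz' := interior_subset hz
  rw [arc_eq_openArc_union h.le] at hz'
  have hnear : ∀ x : ℝ, (x : UnitAddCircle) = z → ∃ δ > 0, ∀ y, |y - x| < δ →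
      (y : UnitAddCircle) ∈ arc a b := by
    rintro x rfl
    obtain ⟨δ, hδ, h⟩ := Metric.isOpen_iff.1
      (isOpen_interior.preimage (AddCircle.continuous_mk' (1 : ℝ))) x hz
    exact ⟨δ, hδ, fun y hy => interior_subset (h hy)⟩
  rcases hz' with hz' | rfl | rfl
  · exact hz'
  · obtain ⟨δ, hδ, hn⟩ := hnear a rfl
    -- The step is at most half the length of the complementary arc, so the nearby point really
    -- leaves the arc instead of wrapping around to its other end.
    set η := min (δ / 2) ((a + 1 - b) / 2) with hη
    have h1 : 0 < η := lt_min (by linarith) (by linarith)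
    have h2 : η ≤ δ / 2 := min_le_left _ _
    have h3 : η ≤ (a + 1 - b) / 2 := min_le_right _ _
    have := hn (a - η) (by rw [abs_lt]; constructor <;> linarith)
    rw [coe_mem_arc_iff (by linarith) (by linarith)] at this
    linarith [this.1]
  · obtain ⟨δ, hδ, hn⟩ := hnear b rfl
    set η := min (δ / 2) ((a + 1 - b) / 2) with hη
    have h1 : 0 < η := lt_min (by linarith) (by linarith)
    have h2 : η ≤ δ / 2 := min_le_left _ _
    have h3 : η ≤ (a + 1 - b) / 2 := min_le_right _ _
    have := hn (b + η) (by rw [abs_lt]; constructor <;> linarith)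
    rw [coe_mem_arc_iff (by linarith) (by linarith)] at this
    linarith [this.2]

theorem dist_coe_le : dist (x : UnitAddCircle) (y : UnitAddCircle) ≤ |x - y| := by
  rw [dist_eq_norm, ← AddCircle.coe_sub, UnitAddCircle.norm_eq]
  simpa using round_le (x - y) 0

/-- Circle and line distances agree only up to half a turn; this is why the arcs contracted below
have length at most `1 / 2`. -/
theorem dist_coe_eq (h : |x - y| ≤ 1 / 2) :
    dist (x : UnitAddCircle) (y : UnitAddCircle) = |x - y| := by
  rw [dist_eq_norm, ← AddCircle.coe_sub, (AddCircle.norm_coe_eq_abs_iff _ one_ne_zero).2]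
  simpa using h

end Arcs

/-! ### Lifts -/

/-- The homeomorphism `f` of the circle lifts to the increasing homeomorphism `F` of the line. -/
structure LiftedBy (f : UnitAddCircle ≃ₜ UnitAddCircle) (F : ℝ ≃o ℝ) : Prop where
  map_add_one : ∀ x, F (x + 1) = F x + 1
  coe : ∀ x : ℝ, f x = (F x : UnitAddCircle)

namespace LiftedBy

variable {f g : UnitAddCircle ≃ₜ UnitAddCircle} {F G : ℝ ≃o ℝ} {a b : ℝ}

theorem mul (hf : LiftedBy f F) (hg : LiftedBy g G) : LiftedBy (f * g) (G.trans F) where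
  map_add_one x := by simp [hg.map_add_one, hf.map_add_one]
  coe x := by
    change f (g x) = _
    rw [hg.coe, hf.coe]
    rfl

theorem image_arc (hf : LiftedBy f F) (a b : ℝ) : f '' arc a b = arc (F a) (F b) := by
  rw [arc, arc, ← F.image_Icc, image_image, image_image]
  exact image_congr fun x _ => hf.coe x

/-- A fixed point of the lift itself makes the translation number exactly `0`. -/
theorem hasRotationNumber (hf : LiftedBy f F) (h : F a = a) : HasRotationNumber f 0 := by
  refine ⟨⟨⟨F, F.monotone⟩, hf.map_add_one⟩, F.continuous, fun x => (hf.coe x).symm, ?_⟩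
  rw [CircleDeg1Lift.translationNumber_of_eq_add_int (x := a) (m := 0)]
  · simp
  · simpa using h

theorem eq_self (hf : LiftedBy f F) (h : ∀ x ∈ Icc b (a + 1), F x = x) :
    ∀ x ∉ arc a b, f x = x := by
  intro z hz
  obtain ⟨x, hx, rfl⟩ := exists_coe_eq a z
  rw [hf.coe, h x ⟨?_, hx.2.le⟩]
  by_contra! hxb
  exact hz (coe_mem_arc ⟨hx.1, hxb.le⟩)

end LiftedBy

/-! ### Periodic extensions and the homeomorphisms they induce -/

/-- The extension of a function on `[a, a + 1)` to the line that commutes with integer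
translations. -/
noncomputable def periodicExtension (B : ℝ → ℝ) (a x : ℝ) : ℝ := B (x - ⌊x - a⌋) + ⌊x - a⌋

section Construction

variable {B : ℝ → ℝ} {a b : ℝ}

theorem periodicExtension_of_mem_Ico {x : ℝ} {n : ℤ} (h : x - n ∈ Ico a (a + 1)) :
    periodicExtension B a x = B (x - n) + n := by
  have : ⌊x - a⌋ = n := Int.floor_eq_iff.2 ⟨by linarith [h.1], by linarith [h.2]⟩
  rw [periodicExtension, this]

theorem exists_sub_int_mem_Ico (a x : ℝ) : ∃ n : ℤ, x - n ∈ Ico a (a + 1) :=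
  ⟨⌊x - a⌋, by linarith [Int.floor_le (x - a)], by linarith [Int.lt_floor_add_one (x - a)]⟩

theorem periodicExtension_of_mem_Icc (h1 : B a = a) (h2 : B (a + 1) = a + 1) {x : ℝ}
    (h : x ∈ Icc a (a + 1)) : periodicExtension B a x = B x := by
  rcases h.2.eq_or_lt with rfl | hx
  · rw [periodicExtension_of_mem_Ico (n := 1) (by simp)]
    simp [h1, h2]
  · rw [periodicExtension_of_mem_Ico (n := 0) (by simpa using ⟨h.1, hx⟩)]
    simp

/-- Since `B` fixes both ends of a period, its translates fit together to an increasing surjection,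
hence an order isomorphism, of the line. The induced map of the circle is a continuous bijection of
a compact Hausdorff space, so its inverse is continuous. -/
theorem exists_liftedBy_periodicExtension (hB : StrictMonoOn B (Icc a (a + 1)))
    (hc : ContinuousOn B (Icc a (a + 1))) (h1 : B a = a) (h2 : B (a + 1) = a + 1) :
    ∃ (f : UnitAddCircle ≃ₜ UnitAddCircle) (F : ℝ ≃o ℝ), LiftedBy f F ∧
      ⇑F = periodicExtension B a := by
  have hle : a ≤ a + 1 := by linarith
  have hadd : ∀ x, periodicExtension B a (x + 1) = periodicExtension B a x + 1 := by
    intro x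
    obtain ⟨n, hn⟩ := exists_sub_int_mem_Ico a x
    rw [periodicExtension_of_mem_Ico hn, periodicExtension_of_mem_Ico (n := n + 1)]
    · push_cast
      rw [add_sub_add_right_eq_sub, add_assoc]
    · push_cast
      rwa [add_sub_add_right_eq_sub]
  have hmono : StrictMono (periodicExtension B a) := by
    intro x y hxy
    obtain ⟨n, hn⟩ := exists_sub_int_mem_Ico a x
    obtain ⟨m, hm⟩ := exists_sub_int_mem_Ico a y
    rw [periodicExtension_of_mem_Ico hn, periodicExtension_of_mem_Ico hm]
    have hnm : n ≤ m := by
      have : (n : ℝ) < m + 1 := by linarith [hn.1, hm.2]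
      exact Int.lt_add_one_iff.1 (by exact_mod_cast this)
    rcases hnm.eq_or_lt with rfl | hnm
    · have := hB (Ico_subset_Icc_self hn) (Ico_subset_Icc_self hm) (by linarith)
      linarith
    · have h3 : (n : ℝ) + 1 ≤ m := by exact_mod_cast hnm
      have h4 := hB (Ico_subset_Icc_self hn) (right_mem_Icc.2 hle) hn.2
      have h5 := hB.monotoneOn (left_mem_Icc.2 hle) (Ico_subset_Icc_self hm) hm.1
      linarith
  have hsurj : Function.Surjective (periodicExtension B a) := by
    intro y
    obtain ⟨n, hn⟩ := exists_sub_int_mem_Ico a y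
    obtain ⟨x, hx, hxy⟩ := intermediate_value_Icc hle hc (by
      rw [h1, h2]; exact Ico_subset_Icc_self hn)
    refine ⟨x + n, ?_⟩
    have hx1 : x < a + 1 := by
      refine lt_of_le_of_ne hx.2 ?_
      rintro rfl
      linarith [hn.2]
    rw [periodicExtension_of_mem_Ico (n := n) (by simpa using ⟨hx.1, hx1⟩)]
    simp [hxy]
  set F : ℝ ≃o ℝ := hmono.orderIsoOfSurjective _ hsurj
  have hFc : ⇑F = periodicExtension B a := hmono.coe_orderIsoOfSurjective _ hsurj
  have hper : ∀ (x : ℝ) (n : ℤ), F (x + n) = F x + n := by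
    intro x n
    exact (⟨⟨F, F.monotone⟩, by simpa [hFc] using hadd⟩ : CircleDeg1Lift).map_add_int x n
  have hFs : ∀ x : ℝ, Function.Periodic (fun x => ((F x : ℝ) : UnitAddCircle)) 1 := by
    intro _ x
    have := hper x 1
    rw [Int.cast_one] at this
    simp only [this, coe_add_one]
  let φ : UnitAddCircle → UnitAddCircle := (hFs 0).lift
  have hφ : ∀ x : ℝ, φ x = (F x : UnitAddCircle) := fun x => rfl
  have hφc : Continuous φ := by
    exact (QuotientAddGroup.isOpenQuotientMap_mk.isQuotientMap.continuous_iff (g := φ)).2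
      ((AddCircle.continuous_mk' 1).comp F.continuous)
  have hφb : Function.Bijective φ := by
    constructor
    · intro z w h
      obtain ⟨x, -, rfl⟩ := exists_coe_eq 0 z
      obtain ⟨y, -, rfl⟩ := exists_coe_eq 0 w
      rw [hφ, hφ] at h
      obtain ⟨n, hn⟩ := coe_eq_coe_iff.1 h
      rw [← hper] at hn
      exact coe_eq_coe_iff.2 ⟨n, F.injective hn⟩
    · intro z
      obtain ⟨x, -, rfl⟩ := exists_coe_eq 0 z
      exact ⟨(F.symm x : ℝ), by rw [hφ, F.apply_symm_apply]⟩
  refine ⟨hφc.homeoOfEquivCompactToT2 (f := Equiv.ofBijective φ hφb), F, ⟨?_, hφ⟩, hFc⟩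
  intro x
  simpa using hper x 1

theorem exists_liftedBy (hB : StrictMonoOn B (Icc a (a + 1)))
    (hc : ContinuousOn B (Icc a (a + 1))) (h1 : B a = a) (h2 : B (a + 1) = a + 1) :
    ∃ (f : UnitAddCircle ≃ₜ UnitAddCircle) (F : ℝ ≃o ℝ), LiftedBy f F ∧
      ∀ x ∈ Icc a (a + 1), F x = B x := by
  obtain ⟨f, F, h, hF⟩ := exists_liftedBy_periodicExtension hB hc h1 h2
  exact ⟨f, F, h, fun x hx => by rw [hF, periodicExtension_of_mem_Icc h1 h2 hx]⟩

/-- Smoothness is at stake only where periods are glued. There `B` is the identity on both sides, so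
the extension agrees near every point with a translate of `B`. -/
theorem exists_isSmoothDiffeo (hB : ContDiff ℝ ∞ B) (hd : ∀ x, 0 < deriv B x)
    (hb : b < a + 1) (h1 : ∀ x ≤ a, B x = x) (h2 : ∀ x, b ≤ x → B x = x) :
    ∃ (f : UnitAddCircle ≃ₜ UnitAddCircle) (F : ℝ ≃o ℝ), LiftedBy f F ∧
      (∀ x ∈ Icc a (a + 1), F x = B x) ∧ IsSmoothDiffeo f := by
  have hBa := h1 a le_rfl
  have hBa' := h2 (a + 1) hb.le
  obtain ⟨f, F, h, hF⟩ := exists_liftedBy_periodicExtension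
    ((strictMono_of_deriv_pos hd).strictMonoOn (Icc a (a + 1))) hB.continuous.continuousOn hBa hBa'
  have hloc : ∀ x, ∃ n : ℤ, ⇑F =ᶠ[𝓝 x] fun y => B (y - n) + n := by
    intro x
    obtain ⟨n, hn⟩ := exists_sub_int_mem_Ico a x
    refine ⟨n, ?_⟩
    -- To the left of `a + n` the extension uses the previous translate, at a point beyond `b`; this
    -- neighbourhood is small enough for that, and both translates equal the identity there.
    filter_upwards [Ioo_mem_nhds (show max b a - 1 + n < x by
      rcases max_cases b a with h | h <;> linarith [hn.1]) (show x < a + 1 + n by linarith [hn.2])]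
      with y hy
    have hyb := le_max_left b a
    have hya := le_max_right b a
    rw [hF]
    rcases le_or_gt a (y - n) with hay | hay
    · exact periodicExtension_of_mem_Ico ⟨hay, by linarith [hy.2]⟩
    · rw [periodicExtension_of_mem_Ico (n := n - 1), h1 _ hay.le, h2]
      · ring
      · push_cast
        linarith [hy.1]
      · push_cast
        constructor <;> linarith [hy.1]
  refine ⟨f, F, h, fun x hx => by rw [hF, periodicExtension_of_mem_Icc hBa hBa' hx], F, ?_, ?_,
    fun x => (h.coe x).symm⟩
  · refine contDiff_iff_contDiffAt.2 fun x => ?_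
    obtain ⟨n, hn⟩ := hloc x
    refine ContDiffAt.congr_of_eventuallyEq ?_ hn
    have : ContDiff ℝ ∞ fun y : ℝ => B (y - n) + n :=
      (hB.comp (contDiff_id.sub contDiff_const)).add contDiff_const
    exact this.contDiffAt
  · intro x
    obtain ⟨n, hn⟩ := hloc x
    rw [hn.deriv_eq, deriv_add_const, deriv_comp_sub_const]
    exact hd _

end Construction

/-! ### Piecewise affine homeomorphisms -/

section Bump

variable {a b m m' : ℝ}

/-- The piecewise affine map with vertices `(a, a)`, `(m, m')`, `(b, b)`, continued to the right by
the identity. -/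
noncomputable def bumpFun (a b m m' x : ℝ) : ℝ :=
  if x ≤ m then a + (m' - a) / (m - a) * (x - a)
  else if x ≤ b then m' + (b - m') / (b - m) * (x - m) else x

theorem bumpFun_left {x : ℝ} (h : x ≤ m) : bumpFun a b m m' x = a + (m' - a) / (m - a) * (x - a) :=
  if_pos h

theorem bumpFun_middle (ham : a < m) {x : ℝ} (h : m ≤ x) (hb : x ≤ b) :
    bumpFun a b m m' x = m' + (b - m') / (b - m) * (x - m) := by
  rcases h.eq_or_lt with rfl | h
  · rw [bumpFun_left le_rfl, div_mul_cancel₀ _ (by linarith : m - a ≠ 0)]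
    ring
  · rw [bumpFun, if_neg h.not_ge, if_pos hb]

theorem bumpFun_right (ham : a < m) (hmb : m < b) {x : ℝ} (h : b ≤ x) : bumpFun a b m m' x = x := by
  rcases h.eq_or_lt with rfl | h
  · rw [bumpFun_middle ham hmb.le le_rfl, div_mul_cancel₀ _ (by linarith : b - m ≠ 0)]
    ring
  · rw [bumpFun, if_neg (hmb.trans h).not_ge, if_neg h.not_ge]

theorem strictMonoOn_bumpFun (ham : a < m) (hmb : m < b) (ham' : a < m') (hmb' : m' < b) :
    StrictMonoOn (bumpFun a b m m') (Ici a) := by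
  have h1 : 0 < (m' - a) / (m - a) := div_pos (by linarith) (by linarith)
  have h2 : 0 < (b - m') / (b - m) := div_pos (by linarith) (by linarith)
  have s1 : StrictMonoOn (bumpFun a b m m') (Icc a m) := by
    intro x hx y hy hxy
    rw [bumpFun_left hx.2, bumpFun_left hy.2]
    gcongr
  have s2 : StrictMonoOn (bumpFun a b m m') (Icc m b) := by
    intro x hx y hy hxy
    rw [bumpFun_middle ham hx.1 hx.2, bumpFun_middle ham hy.1 hy.2]
    gcongr
  have s3 : StrictMonoOn (bumpFun a b m m') (Ici b) := by
    intro x hx y hy hxy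
    rwa [bumpFun_right ham hmb hx, bumpFun_right ham hmb hy]
  have s12 := s1.union s2 (isGreatest_Icc ham.le) (isLeast_Icc hmb.le)
  rw [Icc_union_Icc_eq_Icc ham.le hmb.le] at s12
  have s := s12.union s3 (isGreatest_Icc (ham.trans hmb).le) isLeast_Ici
  rwa [Icc_union_Ici_eq_Ici (ham.trans hmb).le] at s

theorem continuous_bumpFun (ham : a < m) (hmb : m < b) : Continuous (bumpFun a b m m') := by
  refine Continuous.if_le (by fun_prop) (Continuous.if_le (by fun_prop) continuous_id
    continuous_id continuous_const ?_) continuous_id continuous_const ?_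
  · rintro x rfl
    rw [div_mul_cancel₀ _ (by linarith : x - m ≠ 0)]
    ring
  · rintro x rfl
    rw [if_pos hmb.le, div_mul_cancel₀ _ (by linarith : x - a ≠ 0)]
    ring

theorem exists_bump (ham : a < m) (hmb : m < b) (ham' : a < m') (hmb' : m' < b) (hb : b ≤ a + 1) :
    ∃ (f : UnitAddCircle ≃ₜ UnitAddCircle) (F : ℝ ≃o ℝ), LiftedBy f F ∧
      (∀ x ∈ Icc a m, F x = a + (m' - a) / (m - a) * (x - a)) ∧
      (∀ x ∈ Icc m b, F x = m' + (b - m') / (b - m) * (x - m)) ∧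
      ∀ x ∈ Icc b (a + 1), F x = x := by
  obtain ⟨f, F, h, hF⟩ := exists_liftedBy (B := bumpFun a b m m')
    ((strictMonoOn_bumpFun ham hmb ham' hmb').mono Icc_subset_Ici_self)
    (continuous_bumpFun ham hmb).continuousOn (by rw [bumpFun_left ham.le]; simp)
    (bumpFun_right ham hmb hb)
  refine ⟨f, F, h, fun x hx => ?_, fun x hx => ?_, fun x hx => ?_⟩
  · rw [hF x ⟨hx.1, by linarith [hx.2]⟩, bumpFun_left hx.2]
  · rw [hF x ⟨by linarith [hx.1], by linarith [hx.2]⟩, bumpFun_middle ham hx.1 hx.2]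
  · rw [hF x ⟨by linarith [hx.1], hx.2⟩, bumpFun_right ham hmb hx.1]

theorem exists_interpolation_one (ham : a < m) (hmb : m < b) (ham' : a < m') (hmb' : m' < b)
    (hb : b ≤ a + 1) :
    ∃ (f : UnitAddCircle ≃ₜ UnitAddCircle) (F : ℝ ≃o ℝ), LiftedBy f F ∧ F a = a ∧ F m = m' ∧
      ∀ x ∈ Icc b (a + 1), F x = x := by
  obtain ⟨f, F, h, h1, h2, h3⟩ := exists_bump ham hmb ham' hmb' hb
  exact ⟨f, F, h, by rw [h1 a ⟨le_rfl, ham.le⟩]; simp, by rw [h2 m ⟨le_rfl, hmb.le⟩]; simp, h3⟩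

/-- Composition of two bumps: the first moves `n` to `n'`, and the second, supported on `[a, n']`,
corrects the image of `m` without moving `n'`. -/
theorem exists_interpolation_two {n n' : ℝ} (ham : a < m) (hmn : m < n) (hnb : n < b)
    (ham' : a < m') (hmn' : m' < n') (hnb' : n' < b) (hb : b ≤ a + 1) :
    ∃ (f : UnitAddCircle ≃ₜ UnitAddCircle) (F : ℝ ≃o ℝ), LiftedBy f F ∧ F a = a ∧ F m = m' ∧
      F n = n' ∧ ∀ x ∈ Icc b (a + 1), F x = x := by
  obtain ⟨f, F, hf, h1, h2, h3⟩ := exists_interpolation_one (ham.trans hmn) hnb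
    (ham'.trans hmn') hnb' hb
  obtain ⟨g, H, hg, k1, k2, k3⟩ := exists_interpolation_one (a := a) (b := n') (m := F m)
    (h1 ▸ F.strictMono ham) (h2 ▸ F.strictMono hmn) ham' hmn' (by linarith)
  refine ⟨g * f, F.trans H, hg.mul hf, ?_, k2, ?_, fun x hx => ?_⟩
  · simp [h1, k1]
  · change H (F n) = n'
    rw [h2, k3 n' ⟨le_rfl, by linarith⟩]
  · change H (F x) = x
    rw [h3 x hx, k3 x ⟨by linarith [hx.1], hx.2⟩]

theorem exists_interpolation_three {n n' o o' : ℝ} (ham : a < m) (hmn : m < n) (hno : n < o)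
    (hob : o < b) (ham' : a < m') (hmn' : m' < n') (hno' : n' < o') (hob' : o' < b)
    (hb : b ≤ a + 1) :
    ∃ (f : UnitAddCircle ≃ₜ UnitAddCircle) (F : ℝ ≃o ℝ), LiftedBy f F ∧ F a = a ∧ F m = m' ∧
      F n = n' ∧ F o = o' ∧ ∀ x ∈ Icc b (a + 1), F x = x := by
  obtain ⟨f, F, hf, h1, h2, h3⟩ := exists_interpolation_one ((ham.trans hmn).trans hno) hob
    ((ham'.trans hmn').trans hno') hob' hb
  obtain ⟨g, H, hg, k1, k2, k3, k4⟩ := exists_interpolation_two (a := a) (b := o') (m := F m)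
    (n := F n) (h1 ▸ F.strictMono ham) (F.strictMono hmn) (h2 ▸ F.strictMono hno) ham' hmn' hno'
    (by linarith)
  refine ⟨g * f, F.trans H, hg.mul hf, ?_, k2, k3, ?_, fun x hx => ?_⟩
  · simp [h1, k1]
  · change H (F o) = o'
    rw [h2, k4 o' ⟨le_rfl, by linarith⟩]
  · change H (F x) = x
    rw [h3 x hx, k4 x ⟨by linarith [hx.1], hx.2⟩]

end Bump

/-! ### Smooth local contractions -/

/-- The lift is `x - (1 - r) (x - z) χ(x)`, with a cutoff `χ` equal to `1` on `[a, b]` and to `0`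
off `[a', b']`. As `χ` rises to the left of `z` and falls to its right, the term with `χ'` only
increases the derivative, which is therefore at least `r`. -/
theorem exists_contraction {a' a b b' z r : ℝ} (ha : a' < a) (hb : b < b') (hz : z ∈ Icc a b)
    (hper : b' < a' + 1) (hr : 0 < r) (hr1 : r < 1) :
    ∃ (f : UnitAddCircle ≃ₜ UnitAddCircle) (F : ℝ ≃o ℝ), LiftedBy f F ∧
      (∀ x ∈ Icc a b, F x = z + r * (x - z)) ∧ F a' = a' ∧ (∀ x ∉ arc a' b', f x = x) ∧
      IsSmoothDiffeo f := by
  set σ : ℝ → ℝ := fun x => Real.smoothTransition ((x - a') / (a - a'))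
  set τ : ℝ → ℝ := fun x => Real.smoothTransition ((b' - x) / (b' - b))
  have hσc : ContDiff ℝ ∞ σ :=
    Real.smoothTransition.contDiff.comp ((contDiff_id.sub contDiff_const).div_const _)
  have hτc : ContDiff ℝ ∞ τ :=
    Real.smoothTransition.contDiff.comp ((contDiff_const.sub contDiff_id).div_const _)
  have hσ1 : ∀ x, a ≤ x → σ x = 1 := fun x hx =>
    Real.smoothTransition.one_of_one_le ((one_le_div (by linarith)).2 (by linarith))
  have hτ1 : ∀ x, x ≤ b → τ x = 1 := fun x hx =>
    Real.smoothTransition.one_of_one_le ((one_le_div (by linarith)).2 (by linarith))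
  have hσ0 : ∀ x, x ≤ a' → σ x = 0 := fun x hx =>
    Real.smoothTransition.zero_of_nonpos
      (div_nonpos_of_nonpos_of_nonneg (by linarith) (by linarith))
  have hτ0 : ∀ x, b' ≤ x → τ x = 0 := fun x hx =>
    Real.smoothTransition.zero_of_nonpos
      (div_nonpos_of_nonpos_of_nonneg (by linarith) (by linarith))
  have hσm : Monotone σ := fun x y hxy => Real.smoothTransition.monotone
    (div_le_div_of_nonneg_right (by linarith) (by linarith))
  have hτm : Antitone τ := fun x y hxy => Real.smoothTransition.monotone
    (div_le_div_of_nonneg_right (by linarith) (by linarith))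
  set χ : ℝ → ℝ := fun x => σ x * τ x with hχ
  have hχc : ContDiff ℝ ∞ χ := hσc.mul hτc
  have hχ0 : ∀ x, 0 ≤ χ x := fun x =>
    mul_nonneg (Real.smoothTransition.nonneg _) (Real.smoothTransition.nonneg _)
  have hχ1 : ∀ x, χ x ≤ 1 := fun x => mul_le_one₀ (Real.smoothTransition.le_one _)
    (Real.smoothTransition.nonneg _) (Real.smoothTransition.le_one _)
  have hχd : Differentiable ℝ χ := hχc.differentiable (by simp)
  -- On each side of `z` one of the two factors is identically `1`, so `χ` agrees locally with a
  -- monotone function.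
  have hsign : ∀ x, (x - z) * deriv χ x ≤ 0 := by
    intro x
    rcases lt_trichotomy x z with hx | rfl | hx
    · have : χ =ᶠ[𝓝 x] σ := by
        filter_upwards [Iio_mem_nhds (hx.trans_le hz.2)] with y hy
        rw [hχ]
        simp only
        rw [hτ1 y (le_of_lt hy), mul_one]
      rw [this.deriv_eq]
      exact mul_nonpos_of_nonpos_of_nonneg (by linarith) hσm.deriv_nonneg
    · simp
    · have : χ =ᶠ[𝓝 x] τ := by
        filter_upwards [Ioi_mem_nhds (hz.1.trans_lt hx)] with y hy
        rw [hχ]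
        simp only
        rw [hσ1 y (le_of_lt hy), one_mul]
      rw [this.deriv_eq]
      exact mul_nonpos_of_nonneg_of_nonpos (by linarith) hτm.deriv_nonpos
  set B : ℝ → ℝ := fun x => x - (1 - r) * ((x - z) * χ x) with hB
  have hBc : ContDiff ℝ ∞ B :=
    contDiff_id.sub (contDiff_const.mul ((contDiff_id.sub contDiff_const).mul hχc))
  have hBd : ∀ x, 0 < deriv B x := by
    intro x
    have h1 : HasDerivAt B (1 - (1 - r) * (1 * χ x + (x - z) * deriv χ x)) x :=
      (hasDerivAt_id x).sub ((((hasDerivAt_id x).sub_const z).mul (hχd x).hasDerivAt).const_mul _)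
    rw [h1.deriv]
    have h2 : (1 - r) * (1 * χ x + (x - z) * deriv χ x) ≤ (1 - r) * 1 :=
      mul_le_mul_of_nonneg_left (by linarith [hχ1 x, hsign x]) (by linarith)
    linarith
  have hBl : ∀ x ≤ a', B x = x := fun x hx => by simp [hB, hχ, hσ0 x hx]
  have hBr : ∀ x, b' ≤ x → B x = x := fun x hx => by simp [hB, hχ, hτ0 x hx]
  obtain ⟨f, F, h, hF, hs⟩ := exists_isSmoothDiffeo hBc hBd hper hBl hBr
  refine ⟨f, F, h, fun x hx => ?_, ?_, h.eq_self fun x hx => ?_, hs⟩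
  · rw [hF x ⟨by linarith [hx.1], by linarith [hx.2]⟩]
    simp only [hB, hχ]
    rw [hσ1 x hx.1, hτ1 x hx.2]
    ring
  · rw [hF a' ⟨le_rfl, by linarith⟩, hBl a' le_rfl]
  · rw [hF x ⟨by linarith [hx.1, hz.1, hz.2], hx.2⟩, hBr x hx.1]

/-! ### The building blocks -/

theorem arc_add_one (a b : ℝ) : arc (a + 1) (b + 1) = arc a b := by
  rw [arc, arc, ← image_add_const_Icc, image_image]
  exact image_congr fun x _ => coe_add_one x

section Blocks

variable {a b a' b' : ℝ} {Tp Tm : UnitAddCircle ≃ₜ UnitAddCircle}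

/-- Only the source distance has to be computed exactly, hence the bound `1 / 2` on the length; for
the images an upper bound is enough. -/
theorem dist_affine_le {f : UnitAddCircle ≃ₜ UnitAddCircle} {F : ℝ → ℝ} {r R : ℝ} (hr : 0 ≤ r)
    (hrR : r ≤ R) (hab : b - a ≤ 1 / 2) (hf : ∀ x ∈ Icc a b, f x = (F x : UnitAddCircle))
    (hF : ∀ x ∈ Icc a b, ∀ y ∈ Icc a b, F x - F y = r * (x - y)) :
    ∀ x ∈ arc a b, ∀ y ∈ arc a b, dist (f x) (f y) ≤ R * dist x y := by
  rintro _ ⟨x, hx, rfl⟩ _ ⟨y, hy, rfl⟩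
  rw [hf x hx, hf y hy, dist_coe_eq (x := x) (y := y)
    (abs_le.2 ⟨by linarith [hx.1, hy.2], by linarith [hx.2, hy.1]⟩)]
  refine dist_coe_le.trans ?_
  rw [hF x hx y hy, abs_mul, abs_of_nonneg hr]
  exact mul_le_mul_of_nonneg_right hrR (abs_nonneg _)

/-- Here the covered set is the whole arc: two contractions whose images cover it have dense orbits
in it. -/
theorem IsTPair.reaches (h : IsTPair Tp Tm a b a' b') (hab : b - a ≤ 1 / 2) {x y : UnitAddCircle}
    (hx : x ∈ arc a b) (hy : y ∈ arc a b) : Reaches {Tp, Tm} x y := by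
  obtain ⟨r, s, hr, hr1, hs, hs1, hp, hm⟩ := h.affine
  refine reaches_of_contraction (A := arc a b) (K := arc a b) (r := max r s)
    isCompact_arc.isBounded (max_lt hr1 hs1) (hr.le.trans (le_max_left _ _)) ?_ ?_
    subset_rfl ?_ hx hy
  · rintro f (rfl | rfl)
    · exact subset_union_left.trans h.cover.subset
    · exact subset_union_right.trans h.cover.subset
  · rintro f (rfl | rfl)
    · exact dist_affine_le hr.le (le_max_left _ _) hab hp fun x _ y _ => by ring
    · exact dist_affine_le hs.le (le_max_right _ _) hab hm fun x _ y _ => by ring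
  · rw [biUnion_pair]
    exact h.cover.symm.subset

theorem exists_isTPair (ha : a' < a) (hab : a < b) (hb : b < b') (hper : b' < a' + 1) :
    ∃ Tp Tm : UnitAddCircle ≃ₜ UnitAddCircle, IsTPair Tp Tm a b a' b' ∧
      HasRotationNumber Tp 0 ∧ HasRotationNumber Tm 0 := by
  -- Both ratios are `1 / 2`, so that the images are the two halves of the arc.
  obtain ⟨f, F, hf, h1, h2, h3, -⟩ := exists_contraction ha hb (right_mem_Icc.2 hab.le) hper
    (show (0 : ℝ) < 1 / 2 by norm_num) (by norm_num)
  obtain ⟨g, H, hg, k1, k2, k3, -⟩ := exists_contraction ha hb (left_mem_Icc.2 hab.le) hper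
    (show (0 : ℝ) < 1 / 2 by norm_num) (by norm_num)
  refine ⟨f, g, ⟨ha, hab, hb, hper, ⟨1 / 2, 1 / 2, by norm_num, by norm_num, by norm_num,
    by norm_num, fun x hx => by rw [hf.coe, h1 x hx], fun x hx => by rw [hg.coe, k1 x hx]⟩, ?_,
    fun x hx => ⟨h3 x hx, k3 x hx⟩⟩, hf.hasRotationNumber h2, hg.hasRotationNumber k2⟩
  rw [hf.image_arc, hg.image_arc, h1 a ⟨le_rfl, hab.le⟩, h1 b ⟨hab.le, le_rfl⟩,
    k1 a ⟨le_rfl, hab.le⟩, k1 b ⟨hab.le, le_rfl⟩, union_comm,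
    show b + 1 / 2 * (a - b) = a + 1 / 2 * (b - a) by ring]
  rw [sub_self, sub_self, mul_zero, add_zero, add_zero]
  exact arc_union_arc (by linarith) (by linarith)

/-- The support is the complementary arc `[v', u' + 1]` of `J'`. Inside it lies the lifted
complement of `J`, bounded by `v` and `u + 1`, and these points are sent to `p + 1` and `q + 1`. -/
theorem exists_isAuxMap {u v u' v' p q : ℝ} (hu : u < u') (huv : u' < v') (hv : v' < v)
    (hpq : p < q) (hq : q < u) (hp : v < p + 1) :
    ∃ h : UnitAddCircle ≃ₜ UnitAddCircle, IsAuxMap h u' v' u v (arc p q) ∧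
      HasRotationNumber h 0 := by
  obtain ⟨f, F, hf, h1, h2, h3, h4⟩ := exists_interpolation_two (a := v') (b := u' + 1) (m := v)
    (n := u + 1) (m' := p + 1) (n' := q + 1) hv (by linarith) (by linarith) (by linarith)
    (by linarith) (by linarith) (by linarith)
  refine ⟨f, ⟨hu, huv, hv, by linarith, (disjoint_arc hq hp).symm, ?_, ?_⟩,
    hf.hasRotationNumber h1⟩
  · rintro _ ⟨x, hx, rfl⟩
    simp only
    rw [← coe_add_one x, hf.coe, h4 (x + 1) ⟨by linarith [hx.1], by linarith [hx.2]⟩]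
  · rintro _ ⟨z, hz, rfl⟩
    obtain ⟨x, hx, rfl⟩ := exists_coe_eq u z
    have hvx : v ≤ x := by
      by_contra! hvx
      exact hz (coe_mem_arc ⟨hx.1, hvx.le⟩)
    rw [hf.coe, ← arc_add_one]
    exact coe_mem_arc ⟨h2 ▸ F.monotone hvx, h3 ▸ F.monotone hx.2.le⟩

theorem IsAuxMap.apply_mem {h : UnitAddCircle ≃ₜ UnitAddCircle} {u' v' u v : ℝ}
    {A M : Set UnitAddCircle} (hh : IsAuxMap h u' v' u v A) (hM : Disjoint (arc u v) M)
    {x : UnitAddCircle} (hx : x ∈ M) : h x ∈ A :=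
  hh.maps ⟨x, fun hxJ => disjoint_left.1 hM hxJ hx, rfl⟩

end Blocks

/-! ### Decompositions of unions of arcs -/

section Decomposition

variable {M K R : Set UnitAddCircle} {ι : Type*} {V : ι → Set UnitAddCircle} {x : UnitAddCircle}

theorem notMem_interior_of_tendsto {u : ℕ → UnitAddCircle} (hu : ∀ n, u n ∉ M)
    (h : Tendsto u atTop (𝓝 x)) : x ∉ interior M := fun hx =>
  let ⟨n, hn⟩ := (h.eventually (isOpen_interior.mem_nhds hx)).exists
  hu n (interior_subset hn)

/-- In the window `W` the set `M` has no points outside `closure B`, so an interior point of `M`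
there is interior to `closure B`. -/
theorem closure_inter_interior_subset {W B : Set UnitAddCircle} (hW : IsOpen W)
    (hBW : closure B ⊆ W) (hM : M ∩ W ⊆ closure B) (hB : interior (closure B) ⊆ B) :
    closure B ∩ interior M ⊆ B := fun _ hy =>
  hB (interior_inter_of_inter_subset hW hM ⟨hy.2, hBW hy.1⟩)

/-- The boundary of the family of components, when the components are known. -/
theorem componentBoundary_eq (h : components (interior M) = range V) :
    componentBoundary M = ⋃ i, frontier (V i) := by
  rw [componentBoundary, h, biUnion_range]

/-- Once boundaries, `K` and `R` are known to miss the interior, the interior is the union of the `V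
i`; what remains besides `K` is the countable set of boundary points and `R`. -/
theorem isDecomposition_iUnion [Countable ι] (hM : M = (⋃ i, closure (V i)) ∪ (K ∪ R))
    (ho : ∀ i, IsOpen (V i)) (hc : ∀ i, IsConnected (V i))
    (hf : ∀ i, (frontier (V i)).Countable) (hcl : ∀ i, closure (V i) ∩ interior M ⊆ V i)
    (hK : K = ∅ ∨ IsCantorSet K) (hKM : Disjoint K (interior M))
    (hRM : Disjoint R (interior M)) (hR : R.Countable) (hKV : ∀ i, Disjoint K (closure (V i)))
    (hKR : Disjoint K R) :
    interior M = ⋃ i, V i ∧ components (interior M) = range V ∧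
      componentBoundary M = ⋃ i, frontier (V i) ∧
      IsDecomposition M K ((⋃ i, frontier (V i)) ∪ R) := by
  have hint := interior_eq_iUnion hM ho hcl (hKM.union_left hRM)
  have hcomp := components_eq_range hint ho hc hcl
  have hN : M \ (interior M ∪ K) = (⋃ i, frontier (V i)) ∪ R := by
    ext y
    constructor
    · rintro ⟨hy, hyn⟩
      rw [hM] at hy
      rcases hy with hy | hy | hy
      · obtain ⟨i, hi⟩ := mem_iUnion.1 hy
        refine .inl (mem_iUnion.2 ⟨i, ?_⟩)
        rw [(ho i).frontier_eq]
        exact ⟨hi, fun hyi => hyn (.inl (hint ▸ mem_iUnion.2 ⟨i, hyi⟩))⟩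
      · exact absurd (.inr hy) hyn
      · exact .inr hy
    · rintro (hy | hy)
      · obtain ⟨i, hi⟩ := mem_iUnion.1 hy
        rw [(ho i).frontier_eq] at hi
        refine ⟨hM ▸ .inl (mem_iUnion.2 ⟨i, hi.1⟩), ?_⟩
        rintro (hyi | hyK)
        · exact hi.2 (hcl i ⟨hi.1, hyi⟩)
        · exact disjoint_left.1 (hKV i) hyK hi.1
      · refine ⟨hM ▸ .inr (.inr hy), ?_⟩
        rintro (hyi | hyK)
        · exact disjoint_left.1 hRM hy hyi
        · exact disjoint_left.1 hKR hyK hy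
  refine ⟨hint, hcomp, componentBoundary_eq hcomp, ?_⟩
  rw [← hN]
  refine isDecomposition_of_countable hK
    (fun y hy => ⟨hM ▸ .inr (.inl hy), disjoint_left.1 hKM hy⟩) ?_
  rw [hN]
  exact (countable_iUnion hf).union hR

theorem countable_frontier_openArc {a b : ℝ} (h : a < b) (hb : b ≤ a + 1) :
    (frontier (openArc a b)).Countable := by
  rw [frontier_openArc h hb]
  exact (finite_singleton _).insert _ |>.countable

/-- A union of closed sets converging to a point, together with the point, is closed. -/
theorem isClosed_iUnion_union_singleton {B : ℕ → Set UnitAddCircle} {δ : ℕ → ℝ}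
    (hB : ∀ n, IsClosed (B n)) (hδ : Tendsto δ atTop (𝓝 0)) (h : ∀ n, ∀ y ∈ B n, dist y x ≤ δ n) :
    IsClosed ((⋃ n, B n) ∪ {x}) := by
  refine isClosed_of_closure_subset fun y hy => ?_
  by_contra hyn
  have hyx : 0 < dist y x := dist_pos.2 fun he => hyn (.inr he)
  obtain ⟨N, hN⟩ := eventually_atTop.1 (hδ.eventually (gt_mem_nhds (half_pos hyx)))
  have hcl : IsClosed ((⋃ n ∈ Iio N, B n) ∪ Metric.closedBall x (dist y x / 2)) :=
    ((finite_Iio N).isClosed_biUnion fun n _ => hB n).union Metric.isClosed_closedBall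
  have hsub : (⋃ n, B n) ∪ {x} ⊆ (⋃ n ∈ Iio N, B n) ∪ Metric.closedBall x (dist y x / 2) := by
    rintro z (hz | rfl)
    · obtain ⟨n, hn⟩ := mem_iUnion.1 hz
      rcases lt_or_ge n N with hnN | hnN
      · exact .inl (mem_iUnion₂.2 ⟨n, hnN, hn⟩)
      · exact .inr ((h n z hn).trans (hN n hnN).le)
    · exact .inr (Metric.mem_closedBall_self (half_pos hyx).le)
  rcases closure_minimal hsub hcl hy with hy | hy
  · obtain ⟨n, -, hn⟩ := mem_iUnion₂.1 hy
    exact hyn (.inl (mem_iUnion.2 ⟨n, hn⟩))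
  · have := Metric.mem_closedBall.1 hy
    linarith

end Decomposition

/-! ### Pushes -/

/-- The point obtained from `x` by halving its distance to `t` exactly `n` times. -/
noncomputable def halving (t x : ℝ) (n : ℕ) : ℝ := t - (t - x) / 2 ^ n

section Halving

variable {t x y : ℝ} {n k : ℕ}

@[simp] theorem halving_zero : halving t x 0 = x := by simp [halving]

theorem halving_succ : halving t x (n + 1) = (halving t x n + t) / 2 := by
  rw [halving, halving, pow_succ]
  field_simp
  ring

theorem halving_lt_halving (h : x < y) : halving t x n < halving t y n := by
  unfold halving
  gcongr

theorem halving_le_halving (h : x ≤ y) : halving t x n ≤ halving t y n := by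
  unfold halving
  gcongr

theorem halving_lt (h : x < t) : halving t x n < t := by
  have : 0 < (t - x) / 2 ^ n := div_pos (by linarith) (by positivity)
  rw [halving]
  linarith

theorem le_halving (h : x ≤ t) : x ≤ halving t x n := by
  have : (t - x) / 2 ^ n ≤ t - x := div_le_self (by linarith) (one_le_pow₀ (by norm_num))
  rw [halving]
  linarith

theorem halving_mono (h : x ≤ t) (hnk : n ≤ k) : halving t x n ≤ halving t x k := by
  unfold halving
  have : (2 : ℝ) ^ n ≤ 2 ^ k := pow_le_pow_right₀ (by norm_num) hnk
  have : (t - x) / 2 ^ k ≤ (t - x) / 2 ^ n :=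
    div_le_div_of_nonneg_left (by linarith) (by positivity) this
  linarith

/-- One halving step moves `x` to `(x + t) / 2`, so the hypothesis puts `y` before the next image of
`x`, and this order persists at all later steps. -/
theorem halving_lt_of_lt (hx : x ≤ t) (h : y < (x + t) / 2) (hnk : n < k) :
    halving t y n < halving t x k := by
  refine lt_of_lt_of_le ?_ (halving_mono hx hnk)
  have : halving t x (n + 1) = halving t ((x + t) / 2) n := by
    unfold halving
    rw [pow_succ]
    field_simp
    ring
  rw [this]
  exact halving_lt_halving h

theorem tendsto_div_two_pow (C : ℝ) : Tendsto (fun n : ℕ => C / 2 ^ n) atTop (𝓝 0) := by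
  have := (tendsto_pow_atTop_nhds_zero_of_lt_one (r := (1 / 2 : ℝ)) (by norm_num)
    (by norm_num)).const_mul C
  simpa [div_eq_mul_inv] using this

theorem tendsto_halving (t x : ℝ) : Tendsto (halving t x) atTop (𝓝 t) := by
  have := (tendsto_div_two_pow (t - x)).const_sub t
  rwa [sub_zero] at this

theorem tendsto_coe_halving (t x : ℝ) :
    Tendsto (fun n => (halving t x n : UnitAddCircle)) atTop (𝓝 (t : UnitAddCircle)) :=
  ((AddCircle.continuous_mk' 1).tendsto t).comp (tendsto_halving t x)

end Halving

/-- A push on `[s, t]` which halves the distance to `t` on `[m, t]`. -/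
structure IsHalvingPush (ψ : UnitAddCircle ≃ₜ UnitAddCircle) (s m t : ℝ) : Prop where
  isPush : IsPush ψ s t
  hasRotationNumber : HasRotationNumber ψ 0
  apply : ∀ x ∈ Icc m t, ψ x = ((x + t) / 2 : ℝ)

theorem exists_isHalvingPush {s m t : ℝ} (hs : s < m) (ht : m < t) (hst : t ≤ s + 1) :
    ∃ ψ : UnitAddCircle ≃ₜ UnitAddCircle, IsHalvingPush ψ s m t := by
  obtain ⟨f, F, hf, h1, h2, h3⟩ := exists_bump (m' := (m + t) / 2) hs ht (by linarith)
    (by linarith) hst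
  have e : ∀ x ∈ Icc m t, F x = (x + t) / 2 := by
    intro x hx
    rw [h2 x hx]
    have : t - m ≠ 0 := by linarith
    field_simp
    ring
  have hfix : F s = s := by
    rw [h1 s ⟨le_rfl, hs.le⟩]
    simp
  refine ⟨f, ⟨hs.trans ht, hst, hf.eq_self h3, fun x hx => ⟨F x, ?_, hf.coe x⟩⟩,
    hf.hasRotationNumber hfix, fun x hx => by rw [hf.coe, e x hx]⟩
  rcases le_or_gt x m with hxm | hxm
  · have hlt : F x ≤ F m := F.monotone hxm
    rw [e m ⟨le_rfl, ht.le⟩] at hlt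
    refine ⟨?_, by linarith⟩
    rw [h1 x ⟨hx.1.le, hxm⟩]
    -- On `[s, m]` the map is a stretch from `s` of slope greater than `1`, so it moves points to
    -- the right.
    have h5 : 1 < ((m + t) / 2 - s) / (m - s) := (one_lt_div (by linarith)).2 (by linarith)
    nlinarith [hx.1]
  · rw [e x ⟨hxm.le, hx.2.le⟩]
    constructor <;> linarith [hx.2]

namespace IsHalvingPush

variable {ψ : UnitAddCircle ≃ₜ UnitAddCircle} {s m t x y p q p' q' : ℝ}

theorem apply_halving (h : IsHalvingPush ψ s m t) (hx : x ∈ Icc m t) (n : ℕ) :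
    ψ (halving t x n) = halving t x (n + 1) := by
  rw [h.apply, halving_succ]
  refine ⟨hx.1.trans (le_halving hx.2), ?_⟩
  rcases hx.2.eq_or_lt with rfl | h
  · simp [halving]
  · exact (halving_lt h).le

theorem iterate_apply (h : IsHalvingPush ψ s m t) (hx : x ∈ Icc m t) (n : ℕ) :
    ψ^[n] x = halving t x n := by
  induction n with
  | zero => simp
  | succ n ih => rw [Function.iterate_succ_apply', ih, h.apply_halving hx]

theorem image_arc (h : IsHalvingPush ψ s m t) (hm : m ≤ x) (hy : y ≤ t) (n : ℕ) :
    ψ^[n] '' arc x y = arc (halving t x n) (halving t y n) := by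
  have e : (fun z => halving t z n) '' Icc x y = Icc (halving t x n) (halving t y n) := by
    have h2 : (0 : ℝ) < 2 ^ n := by positivity
    have : (fun z => halving t z n) = fun z => (1 / 2 ^ n) * z + (t - t / 2 ^ n) := by
      funext z
      unfold halving
      field_simp
      ring
    rw [this, image_affine_Icc' (by positivity)]
    simp only [halving]
    congr 1 <;> field_simp <;> ring
  rw [arc, arc, ← e, image_image, image_image]
  exact image_congr fun z hz => h.iterate_apply ⟨hm.trans hz.1, hz.2.trans hy⟩ n

theorem image_arc_one (h : IsHalvingPush ψ s m t) (hm : m ≤ x) (hy : y ≤ t) :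
    ψ '' arc x y = arc (halving t x 1) (halving t y 1) := by
  simpa using h.image_arc hm hy 1

theorem apply_right (h : IsHalvingPush ψ s m t) (hm : m ≤ t) : ψ t = t := by
  rw [h.apply t ⟨hm, le_rfl⟩, add_self_div_two]

end IsHalvingPush

/-! ### Sequences of arcs converging to a point -/

/-- Disjoint closed arcs accumulating at `t`. -/
def arcSequence (t p q : ℝ) : Set UnitAddCircle := ⋃ n, arc (halving t p n) (halving t q n)

section ArcSequence

variable {s m t p q p' q' : ℝ} {ψ : UnitAddCircle ≃ₜ UnitAddCircle}

theorem IsHalvingPush.iUnion_image_arc (h : IsHalvingPush ψ s m t) (hm : m ≤ p) (hq : q ≤ t) :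
    ⋃ n : ℕ, ψ^[n] '' arc p q = arcSequence t p q :=
  iUnion_congr fun n => h.image_arc hm hq n

theorem isClosed_arcSequence (hq : q < t) :
    IsClosed (arcSequence t p q ∪ {(t : UnitAddCircle)}) := by
  refine isClosed_iUnion_union_singleton (fun _ => isClosed_arc) (tendsto_div_two_pow (t - p)) ?_
  rintro n _ ⟨x, hx, rfl⟩
  refine dist_coe_le.trans ?_
  have h1 := halving_lt (n := n) hq
  rw [abs_sub_comm, abs_of_nonneg (by linarith [hx.2])]
  have h2 := hx.1
  rw [halving] at h2
  linarith

theorem arcSequence_subset (hq : q < t) (hp : p ≤ t) : arcSequence t p q ⊆ arc p t :=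
  iUnion_subset fun _ => arc_mono (le_halving hp) (halving_lt hq).le

/-- The arc `[p, q']` fits in the fundamental domain between `p` and its image `(p + t) / 2`; `t < p
+ 1` excludes wrapping around the circle. -/
theorem disjoint_halving_arcs (hpq : p < q') (hq : q' < t) (hper : t < p + 1)
    (h : q' < (p + t) / 2) {n k : ℕ} (hnk : n ≠ k) :
    Disjoint (arc (halving t p n) (halving t q' n)) (arc (halving t p k) (halving t q' k)) := by
  have hp := hpq.trans hq
  rcases hnk.lt_or_gt with hnk | hnk
  · exact disjoint_arc (halving_lt_of_lt hp.le h hnk)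
      (by linarith [halving_lt (n := k) hq, le_halving (n := n) hp.le])
  · exact (disjoint_arc (halving_lt_of_lt hp.le h hnk)
      (by linarith [halving_lt (n := n) hq, le_halving (n := k) hp.le])).symm

/-- The slightly larger arcs `[p', q']` have disjoint images as well, so each image is a window that
sees only one arc of the sequence. -/
theorem arcSequence_inter_subset (hp : p' < p) (hpq : p < q) (hqq : q < q') (hq : q' < t)
    (hper : t < p' + 1) (h : q' < (p' + t) / 2) (n : ℕ) :
    (arcSequence t p q ∪ {(t : UnitAddCircle)}) ∩ arc (halving t p' n) (halving t q' n) ⊆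
      arc (halving t p n) (halving t q n) := by
  rintro x ⟨hx | rfl, hxn⟩
  · obtain ⟨k, hk⟩ := mem_iUnion.1 hx
    by_cases hkn : k = n
    · rwa [← hkn]
    · have hk' := arc_mono (halving_le_halving (n := k) (t := t) hp.le)
        (halving_le_halving (n := k) (t := t) hqq.le) hk
      exact absurd hxn (disjoint_left.1
        (disjoint_halving_arcs (hp.trans (hpq.trans hqq)) hq hper h hkn) hk')
  · have h1 := halving_lt (n := n) hq
    have h2 := le_halving (n := n) (x := p') (t := t) (by linarith)
    rw [coe_mem_arc_iff (by linarith) (by linarith)] at hxn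
    linarith [hxn.2]

/-- The right ends of the windows are missing points converging to `t`, which will show that `t` is
not an interior point. -/
theorem halving_notMem_arcSequence (hp : p' < p) (hpq : p < q) (hqq : q < q') (hq : q' < t)
    (hper : t < p' + 1) (h : q' < (p' + t) / 2) (n : ℕ) :
    (halving t q' n : UnitAddCircle) ∉ arcSequence t p q ∪ {(t : UnitAddCircle)} := by
  intro hx
  have h3 := halving_lt_halving (n := n) (t := t) (hp.trans (hpq.trans hqq))
  have hx' := arcSequence_inter_subset hp hpq hqq hq hper h n
    ⟨hx, coe_mem_arc ⟨h3.le, le_rfl⟩⟩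
  have h1 := halving_lt (n := n) hq
  have h2 := le_halving (n := n) (x := p) (t := t) (by linarith)
  have h4 := halving_lt_halving (n := n) (t := t) hqq
  rw [coe_mem_arc_iff (by linarith) (by linarith)] at hx'
  linarith [hx'.2]

end ArcSequence

/-! ### The triadic Cantor set -/

section Affine

variable {f : UnitAddCircle ≃ₜ UnitAddCircle} {x y r z : ℝ}

theorem image_arc_of_affine (hr : 0 < r)
    (h : ∀ w ∈ Icc x y, f w = ((r * w + z : ℝ) : UnitAddCircle)) :
    f '' arc x y = arc (r * x + z) (r * y + z) := by
  rw [arc, arc, ← image_affine_Icc' hr, image_image, image_image]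
  exact image_congr h

end Affine

theorem mem_limitSet_of_fixed {G : Set (UnitAddCircle ≃ₜ UnitAddCircle)}
    {A : Set UnitAddCircle} {f : UnitAddCircle ≃ₜ UnitAddCircle} (hf : f ∈ G)
    {x : UnitAddCircle} (hx : x ∈ A) (hfx : f x = x) : x ∈ limitSet G A := by
  refine mem_iInter.2 fun k => ?_
  induction k with
  | zero => exact hx
  | succ k ih => exact mem_iUnion₂.2 ⟨f, hf, x, ih, hfx⟩

/-- Two smooth contractions of the arc `[1/8, 1/2]` onto its first and last third, which are the
identity off the arc `[1/16, 9/16]`. -/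
structure IsTriadicPair (f g : UnitAddCircle ≃ₜ UnitAddCircle) : Prop where
  left : ∀ x ∈ Icc (1 / 8 : ℝ) (1 / 2), f x = ((1 / 8 + (x - 1 / 8) / 3 : ℝ) : UnitAddCircle)
  right : ∀ x ∈ Icc (1 / 8 : ℝ) (1 / 2), g x = ((1 / 2 + (x - 1 / 2) / 3 : ℝ) : UnitAddCircle)
  eq_self : ∀ x ∉ arc (1 / 16) (9 / 16), f x = x ∧ g x = x
  smooth_left : IsSmoothDiffeo f
  smooth_right : IsSmoothDiffeo g
  rotation_left : HasRotationNumber f 0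
  rotation_right : HasRotationNumber g 0

theorem exists_isTriadicPair : ∃ f g, IsTriadicPair f g := by
  obtain ⟨f, F, hf, h1, h2, h3, h4⟩ := exists_contraction (a' := 1 / 16) (a := 1 / 8) (b := 1 / 2)
    (b' := 9 / 16) (z := 1 / 8) (r := 1 / 3) (by norm_num) (by norm_num) (by norm_num)
    (by norm_num) (by norm_num) (by norm_num)
  obtain ⟨g, H, hg, k1, k2, k3, k4⟩ := exists_contraction (a' := 1 / 16) (a := 1 / 8) (b := 1 / 2)
    (b' := 9 / 16) (z := 1 / 2) (r := 1 / 3) (by norm_num) (by norm_num) (by norm_num)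
    (by norm_num) (by norm_num) (by norm_num)
  refine ⟨f, g, fun x hx => ?_, fun x hx => ?_, fun x hx => ⟨h3 x hx, k3 x hx⟩, h4, k4,
    hf.hasRotationNumber h2, hg.hasRotationNumber k2⟩
  · rw [hf.coe, h1 x hx, one_div_mul_eq_div]
  · rw [hg.coe, k1 x hx, one_div_mul_eq_div]

/-- The triadic Cantor set in the arc `[1/8, 1/2]`. -/
def triadicLimit (f g : UnitAddCircle ≃ₜ UnitAddCircle) : Set UnitAddCircle :=
  limitSet {f, g} (arc (1 / 8) (1 / 2))

namespace IsTriadicPair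

variable {f g : UnitAddCircle ≃ₜ UnitAddCircle}

theorem image_left (h : IsTriadicPair f g) : f '' arc (1 / 8) (1 / 2) = arc (1 / 8) (1 / 4) := by
  rw [image_arc_of_affine (r := 1 / 3) (z := 1 / 12) (by norm_num) fun w hw => by
    rw [h.left w hw]; congr 1; ring]
  norm_num

theorem image_right (h : IsTriadicPair f g) : g '' arc (1 / 8) (1 / 2) = arc (3 / 8) (1 / 2) := by
  rw [image_arc_of_affine (r := 1 / 3) (z := 1 / 3) (by norm_num) fun w hw => by
    rw [h.right w hw]; congr 1; ring]
  norm_num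

theorem disjoint_images (h : IsTriadicPair f g) :
    Disjoint (f '' arc (1 / 8) (1 / 2)) (g '' arc (1 / 8) (1 / 2)) := by
  rw [h.image_left, h.image_right]
  exact disjoint_arc (by norm_num) (by norm_num)

theorem isContractingSystem (h : IsTriadicPair f g) :
    IsContractingSystem {f, g} (arc (1 / 8) (1 / 2)) where
  finite := (finite_singleton g).insert f
  nontrivial := nontrivial_pair <| by
    rintro rfl
    have hm : ((1 / 8 : ℝ) : UnitAddCircle) ∈ arc (1 / 8) (1 / 2) := coe_mem_arc (by norm_num)
    exact disjoint_left.1 h.disjoint_images ⟨_, hm, rfl⟩ ⟨_, hm, rfl⟩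
  compact := isCompact_arc
  nonempty := ⟨_, coe_mem_arc (left_mem_Icc.2 (by norm_num))⟩
  maps := by
    rintro k (rfl | rfl)
    · rw [h.image_left]
      exact arc_mono (by norm_num) (by norm_num)
    · rw [h.image_right]
      exact arc_mono (by norm_num) (by norm_num)
  disjoint := by
    rintro k (rfl | rfl) l (rfl | rfl) hkl
    · exact absurd rfl hkl
    · exact h.disjoint_images
    · exact h.disjoint_images.symm
    · exact absurd rfl hkl
  contract := by
    refine ⟨1 / 3, by norm_num, by norm_num, ?_⟩
    rintro k (rfl | rfl)
    · exact dist_affine_le (by norm_num) le_rfl (by norm_num) h.left fun x _ y _ => by ring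
    · exact dist_affine_le (by norm_num) le_rfl (by norm_num) h.right fun x _ y _ => by ring

theorem subset_arc (h : IsTriadicPair f g) : triadicLimit f g ⊆ arc (1 / 8) (1 / 2) :=
  h.isContractingSystem.limitSet_subset

theorem left_mem (h : IsTriadicPair f g) : ((1 / 8 : ℝ) : UnitAddCircle) ∈ triadicLimit f g := by
  refine mem_limitSet_of_fixed (G := {f, g}) (f := f) (mem_insert _ _)
    (coe_mem_arc (x := 1 / 8) (a := 1 / 8) (b := 1 / 2) (by norm_num)) ?_
  rw [h.left _ (by norm_num)]
  norm_num

theorem right_mem (h : IsTriadicPair f g) : ((1 / 2 : ℝ) : UnitAddCircle) ∈ triadicLimit f g := by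
  refine mem_limitSet_of_fixed (G := {f, g}) (f := g) (mem_insert_of_mem _ rfl)
    (coe_mem_arc (x := 1 / 2) (a := 1 / 8) (b := 1 / 2) (by norm_num)) ?_
  rw [h.right _ (by norm_num)]
  norm_num

theorem gap_left_mem (h : IsTriadicPair f g) :
    ((1 / 4 : ℝ) : UnitAddCircle) ∈ triadicLimit f g := by
  have := h.isContractingSystem.image_limitSet_subset (mem_insert _ _) ⟨_, h.right_mem, rfl⟩
  rw [h.left _ (by norm_num)] at this
  norm_num at this
  exact_mod_cast this

theorem gap_right_mem (h : IsTriadicPair f g) :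
    ((3 / 8 : ℝ) : UnitAddCircle) ∈ triadicLimit f g := by
  have := h.isContractingSystem.image_limitSet_subset (mem_insert_of_mem _ rfl)
    ⟨_, h.left_mem, rfl⟩
  rw [h.right _ (by norm_num)] at this
  norm_num at this
  exact_mod_cast this

theorem disjoint_gap (h : IsTriadicPair f g) :
    ∀ k ∈ ({f, g} : Set (UnitAddCircle ≃ₜ UnitAddCircle)),
      Disjoint (openArc (1 / 4) (3 / 8)) (k '' arc (1 / 8) (1 / 2)) := by
  rintro k (rfl | rfl)
  · rw [h.image_left, ← arc_add_one]
    exact disjoint_openArc_arc (by norm_num) (by norm_num)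
  · rw [h.image_right]
    exact disjoint_openArc_arc (by norm_num) (by norm_num)

theorem disjoint_gap_limit (h : IsTriadicPair f g) :
    Disjoint (openArc (1 / 4) (3 / 8)) (triadicLimit f g) := by
  rw [triadicLimit, h.isContractingSystem.limitSet_eq_iUnion, disjoint_iUnion₂_right]
  exact fun k hk => (h.disjoint_gap k hk).mono_right (image_mono h.subset_arc)

/-- The middle third is open, connected and free of points of the limit set, while both its
endpoints, `f(1/2)` and `g(1/8)`, belong to it. -/
theorem gap_mem_components (h : IsTriadicPair f g) :
    openArc (1 / 4) (3 / 8) ∈ components (triadicLimit f g)ᶜ := by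
  have hx : ((5 / 16 : ℝ) : UnitAddCircle) ∈ openArc (1 / 4) (3 / 8) :=
    coe_mem_openArc (by norm_num)
  refine ⟨_, disjoint_left.1 h.disjoint_gap_limit hx, (connectedComponentIn_eq_of_isOpen
    isOpen_openArc (isConnected_openArc (by norm_num)).isPreconnected hx
    (fun y hy => disjoint_left.1 h.disjoint_gap_limit hy) ?_).symm⟩
  rw [closure_openArc (by norm_num), arc_eq_openArc_union (by norm_num)]
  rintro y ⟨hy | rfl | rfl, hyK⟩
  · exact hy
  · exact absurd h.gap_left_mem hyK
  · exact absurd h.gap_right_mem hyK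

theorem isCantorPair (h : IsTriadicPair f g) :
    IsCantorPair f g (triadicLimit f g) (1 / 8) (1 / 2) (1 / 16) (9 / 16) where
  left := by norm_num
  lt := by norm_num
  right := by norm_num
  proper := by norm_num
  cantor := h.isContractingSystem.isCantorSet_limitSet
  subset := h.subset_arc
  minimal := h.isContractingSystem.isMinimalSet_limitSet
  eq_self := h.eq_self
  preimage_left x hx :=
    h.isContractingSystem.mem_limitSet_of_apply (mem_insert _ _) hx.2 hx.1
  preimage_right x hx :=
    h.isContractingSystem.mem_limitSet_of_apply (mem_insert_of_mem _ rfl) hx.2 hx.1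
  orbit _ hx _ hy := h.isContractingSystem.reaches_limitSet hx hy

/-- The criterion for filled sets is applied with nothing filled in; the hole is the centre `5 / 16`
of the middle third. -/
theorem interior_eq_empty (h : IsTriadicPair f g) : interior (triadicLimit f g) = ∅ := by
  have e : filledSet {f, g} (arc (1 / 8) (1 / 2)) ∅ = triadicLimit f g := by
    simp [filledSet, triadicLimit]
  have hx : ((5 / 16 : ℝ) : UnitAddCircle) ∈ openArc (1 / 4) (3 / 8) :=
    coe_mem_openArc (by norm_num)
  have := h.isContractingSystem.disjoint_limitSet_interior (empty_subset _)
    (fun _ _ => empty_disjoint _) (coe_mem_arc (x := 5 / 16) (by norm_num))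
    (e ▸ disjoint_left.1 h.disjoint_gap_limit hx)
  rw [e] at this
  exact disjoint_self.1 (this.mono_left interior_subset)

theorem isDecomposition (h : IsTriadicPair f g) :
    IsDecomposition (triadicLimit f g) (triadicLimit f g) ∅ where
  cantor := .inr h.isCantorPair.cantor
  subset := by simp [h.interior_eq_empty]
  maximal K' _ hK' := hK'.trans sdiff_subset
  eq_rest := (eq_empty_of_forall_notMem fun _ hx => hx.2 (.inr hx.1)).symm
  countable := countable_empty

theorem eq_triadicSet (h : IsTriadicPair f g) :
    triadicLimit f g = triadicSet (1 / 8) (1 / 2) := by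
  set κ : ℝ → UnitAddCircle := fun x => ((1 / 8 + (1 / 2 - 1 / 8) * x : ℝ) : UnitAddCircle) with hκ
  have hmem : ∀ x ∈ Icc (0 : ℝ) 1, 1 / 8 + (1 / 2 - 1 / 8) * x ∈ Icc (1 / 8 : ℝ) (1 / 2) := by
    intro x hx
    constructor <;> linarith [hx.1, hx.2]
  have key : ∀ k, nestedImages {f, g} (arc (1 / 8) (1 / 2)) k = κ '' preCantorSet k := by
    intro k
    induction k with
    | zero =>
      have e : (fun x : ℝ => 1 / 8 + (1 / 2 - 1 / 8) * x) '' Icc 0 1 = Icc (1 / 8) (1 / 2) := by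
        have : (fun x : ℝ => 1 / 8 + (1 / 2 - 1 / 8) * x) = fun x => (3 / 8 : ℝ) * x + 1 / 8 := by
          funext x
          ring
        rw [this, image_affine_Icc' (by norm_num)]
        norm_num
      rw [preCantorSet_zero, nestedImages, arc, ← e, image_image]
    | succ k ih =>
      rw [preCantorSet_succ, nestedImages, biUnion_pair, ih, image_union, image_image, image_image,
        image_image, image_image]
      congr 1
      · refine image_congr fun x hx => ?_
        rw [hκ]
        simp only
        rw [h.left _ (hmem x (preCantorSet_subset_unitInterval hx))]
        congr 1
        ring
      · refine image_congr fun x hx => ?_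
        rw [hκ]
        simp only
        rw [h.right _ (hmem x (preCantorSet_subset_unitInterval hx))]
        congr 1
        ring
  -- Injectivity on the unit interval is what allows the image to commute with the intersection of
  -- the levels.
  have hinj : InjOn κ (Icc 0 1) := by
    intro x hx y hy hxy
    have := coe_inj_of_lt hxy (by linarith [hx.2, hy.1]) (by linarith [hx.1, hy.2])
    linarith
  rw [triadicLimit, limitSet, triadicSet, cantorSet, iInter_congr key]
  exact ((hinj.mono (iUnion_subset fun k => preCantorSet_subset_unitInterval)).image_iInter_eq).symm

end IsTriadicPair

theorem exists_cantor_minimalSet :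
    ∃ (f g : UnitAddCircle ≃ₜ UnitAddCircle) (a b a' b' : ℝ) (M : Set UnitAddCircle),
      IsCantorPair f g M a b a' b' ∧
      (∀ x ∈ Icc a b, f x = ((a + (x - a) / 3 : ℝ) : UnitAddCircle)) ∧
      (∀ x ∈ Icc a b, g x = ((b + (x - b) / 3 : ℝ) : UnitAddCircle)) ∧
      M = limitSet {f, g} (arc a b) ∧ M = triadicSet a b ∧
      IsSmoothDiffeo f ∧ IsSmoothDiffeo g ∧
      (∀ φ ∈ ({f, g} : Set (UnitAddCircle ≃ₜ UnitAddCircle)), HasRotationNumber φ 0) ∧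
      IsMinimalSet {f, g} M ∧ IsCantorSet M ∧ interior M = ∅ ∧ IsDecomposition M M ∅ ∧
      ∃ M' : Set UnitAddCircle, IsMinimalSet {f, g} M' ∧ M' ≠ M := by
  obtain ⟨f, g, h⟩ := exists_isTriadicPair
  -- The point `0` lies off the supports of both maps, so it is fixed and forms a second minimal
  -- set.
  have h0 : ((0 : ℝ) : UnitAddCircle) ∉ arc (1 / 16) (9 / 16) := by
    rw [coe_mem_arc_iff (by norm_num) (by norm_num)]
    norm_num
  refine ⟨f, g, 1 / 8, 1 / 2, 1 / 16, 9 / 16, triadicLimit f g, h.isCantorPair, h.left, h.right,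
    rfl, h.eq_triadicSet, h.smooth_left, h.smooth_right, ?_, h.isCantorPair.minimal,
    h.isCantorPair.cantor, h.interior_eq_empty, h.isDecomposition, {((0 : ℝ) : UnitAddCircle)},
    isMinimalSet_singleton_of_fixed ⟨f, mem_insert _ _⟩ ?_, ?_⟩
  · rintro φ (rfl | rfl)
    · exact h.rotation_left
    · exact h.rotation_right
  · rintro φ (rfl | rfl)
    · exact (h.eq_self _ h0).1
    · exact (h.eq_self _ h0).2
  · intro he
    exact h0 (arc_mono (by norm_num) (by norm_num) (h.subset_arc (he.subset rfl)))

/-! ### Finite minimal sets -/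

theorem exists_finite_minimalSet_of_fixed (f : UnitAddCircle ≃ₜ UnitAddCircle)
    (h : ∃ x, f x = x) : ∃ M : Set UnitAddCircle, M.Finite ∧ IsMinimalSet {f} M := by
  obtain ⟨x, hx⟩ := h
  refine ⟨{x}, finite_singleton x, isMinimalSet_singleton_of_fixed (singleton_nonempty f) ?_⟩
  rintro _ rfl
  exact hx

/-- A continuous lift moves some point by exactly its translation number, which is here an integer.
-/
theorem HasRotationNumber.exists_fixed {f : UnitAddCircle ≃ₜ UnitAddCircle}
    (h : HasRotationNumber f 0) : ∃ x, f x = x := by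
  obtain ⟨F, hF, hFf, h0⟩ := h
  obtain ⟨x, hx⟩ := F.exists_eq_add_translationNumber hF
  refine ⟨x, ?_⟩
  rw [← hFf, hx, AddCircle.coe_add, h0, add_zero]

/-! ### The circle -/

/-- With `I' = [-1/4, 1/4]` and `J = [0, 1/4]`, `H₁` stretches `J` to `[0, 3/4]` and `H₂` squeezes
`[0, 3/4]` to `J`, both fixing `0`. Any orbit enters `I'`, if necessary by `H₂`, is dense there
under `T⁺, T⁻`, and leaves through `H₁`. -/
theorem exists_minimal_circle :
    ∃ (Tp Tm H₁ H₂ : UnitAddCircle ≃ₜ UnitAddCircle) (a b a' b' c d : ℝ),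
      IsTPair Tp Tm a b a' b' ∧ c < d ∧ arc c d ⊆ arc a b ∧
      (arc a b)ᶜ ⊆ H₁ '' arc c d ∧ H₂ '' (arc a b)ᶜ ⊆ arc c d ∧
      (∀ φ ∈ ({Tp, Tm, H₁, H₂} : Set (UnitAddCircle ≃ₜ UnitAddCircle)),
        HasRotationNumber φ 0) ∧
      IsMinimalSet {Tp, Tm, H₁, H₂} univ := by
  obtain ⟨Tp, Tm, hT, hTp, hTm⟩ := exists_isTPair (a' := -3 / 8) (a := -1 / 4) (b := 1 / 4)
    (b' := 3 / 8) (by norm_num) (by norm_num) (by norm_num) (by norm_num)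
  obtain ⟨f, F, hf, f1, f2, -⟩ := exists_interpolation_one (a := 0) (b := 1) (m := 1 / 4)
    (m' := 3 / 4) (by norm_num) (by norm_num) (by norm_num) (by norm_num) (by norm_num)
  obtain ⟨g, H, hg, g1, g2, -⟩ := exists_interpolation_one (a := 0) (b := 1) (m := 3 / 4)
    (m' := 1 / 4) (by norm_num) (by norm_num) (by norm_num) (by norm_num) (by norm_num)
  have hcompl : (arc (-1 / 4) (1 / 4))ᶜ ⊆ arc (1 / 4) (3 / 4) := by
    intro z hz
    obtain ⟨x, hx, rfl⟩ := exists_coe_eq (-1 / 4) z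
    refine coe_mem_arc ⟨?_, by linarith [hx.2]⟩
    by_contra! hlt
    exact hz (coe_mem_arc ⟨hx.1, hlt.le⟩)
  have hsub : arc 0 (1 / 4) ⊆ arc (-1 / 4) (1 / 4) := arc_mono (by norm_num) le_rfl
  have h1 : (arc (-1 / 4) (1 / 4))ᶜ ⊆ f '' arc 0 (1 / 4) := by
    rw [hf.image_arc, f1, f2]
    exact hcompl.trans (arc_mono (by norm_num) le_rfl)
  have h2 : g '' (arc (-1 / 4) (1 / 4))ᶜ ⊆ arc 0 (1 / 4) := by
    refine (image_mono hcompl).trans ?_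
    rw [hg.image_arc, g2]
    exact arc_mono (g1 ▸ H.monotone (by norm_num)) le_rfl
  refine ⟨Tp, Tm, f, g, -1 / 4, 1 / 4, -3 / 8, 3 / 8, 0, 1 / 4, hT, by norm_num, hsub, h1, h2, ?_,
    isMinimalSet_of_reaches univ_nonempty isClosed_univ (fun _ _ => subset_univ _) ?_⟩
  · rintro φ (rfl | rfl | rfl | rfl)
    exacts [hTp, hTm, hf.hasRotationNumber f1, hg.hasRotationNumber g1]
  · have hTG : ({Tp, Tm} : Set (UnitAddCircle ≃ₜ UnitAddCircle)) ⊆ {Tp, Tm, f, g} := by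
      simp [insert_subset_iff]
    have hin : ∀ x ∈ arc (-1 / 4) (1 / 4), ∀ y, Reaches {Tp, Tm, f, g} x y := by
      intro x hx y
      by_cases hy : y ∈ arc (-1 / 4) (1 / 4)
      · exact (hT.reaches (by norm_num) hx hy).mono hTG
      · obtain ⟨w, hw, rfl⟩ := h1 hy
        exact ((hT.reaches (by norm_num) hx (hsub hw)).mono hTG).apply
          (mem_IFS_of_mem (by simp))
    intro x _ y _
    by_cases hx : x ∈ arc (-1 / 4) (1 / 4)
    · exact hin x hx y
    · exact (reaches_of_mem (φ := g) (by simp)).trans (hin _ (hsub (h2 ⟨x, hx, rfl⟩)) y)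

/-- The set of fixed points is closed, so the endpoints of the supporting arc are fixed too. -/
theorem eq_self_of_notMem_openArc {f : UnitAddCircle ≃ₜ UnitAddCircle} {a b : ℝ}
    (hb : b < a + 1) (h : ∀ x ∉ arc a b, f x = x) : ∀ x ∉ openArc a b, f x = x := by
  intro z hz
  have hcl : IsClosed {x | f x = x} := isClosed_eq f.continuous continuous_id
  have hsub : closure (openArc b (a + 1)) ⊆ {x | f x = x} := by
    refine closure_minimal (fun x hx => h x fun hxa => ?_) hcl
    rw [← arc_add_one] at hxa
    exact disjoint_left.1 (disjoint_openArc_arc le_rfl (by linarith)) hx hxa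
  apply hsub
  rw [closure_openArc hb]
  obtain ⟨x, hx, rfl⟩ := exists_coe_eq a z
  rcases hx.1.eq_or_lt with rfl | hax
  · rw [← coe_add_one]
    exact coe_mem_arc ⟨hb.le, le_rfl⟩
  · refine coe_mem_arc ⟨?_, hx.2.le⟩
    by_contra! hxb
    exact hz (coe_mem_openArc ⟨hax, hxb⟩)

/-- Within the support `M` is only the basic arc, which both maps preserve; elsewhere they are the
identity. -/
theorem IsTPair.image_subset {a b a' b' : ℝ} {Tp Tm : UnitAddCircle ≃ₜ UnitAddCircle}
    (h : IsTPair Tp Tm a b a' b') {M : Set UnitAddCircle}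
    (habM : arc a b ⊆ M) (hM : M ∩ openArc a' b' ⊆ arc a b) :
    Tp '' M ⊆ M ∧ Tm '' M ⊆ M := by
  constructor
  · rintro _ ⟨x, hx, rfl⟩
    by_cases hxI : x ∈ openArc a' b'
    · exact habM (h.cover.subset (.inl ⟨x, hM ⟨hx, hxI⟩, rfl⟩))
    · rwa [eq_self_of_notMem_openArc h.proper (fun x hx => (h.eq_self x hx).1) x hxI]
  · rintro _ ⟨x, hx, rfl⟩
    by_cases hxI : x ∈ openArc a' b'
    · exact habM (h.cover.subset (.inr ⟨x, hM ⟨hx, hxI⟩, rfl⟩))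
    · rwa [eq_self_of_notMem_openArc h.proper (fun x hx => (h.eq_self x hx).2) x hxI]

/-! ### Filling the gaps of a Cantor set -/

namespace IsContractingSystem

variable {G G' : Set (UnitAddCircle ≃ₜ UnitAddCircle)} {A P V R : Set UnitAddCircle}
  {φ : UnitAddCircle ≃ₜ UnitAddCircle} {x y : UnitAddCircle}

theorem reaches_filledSet (h : IsContractingSystem G A) (hG : G ⊆ G') (hx : x ∈ A)
    (hP : ∀ y ∈ P, Reaches G' x y) : ∀ y ∈ filledSet G A P, Reaches G' x y := by
  rintro y ((hy | hy) | hy)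
  · exact (h.reaches_limitSet hx hy).mono hG
  · obtain ⟨φ, hφ, z, hz, rfl⟩ := mem_iUnion₂.1 hy
    exact (hP z hz).apply (Subsemigroup.closure_mono hG hφ)
  · exact hP y hy

theorem disjoint_image_of_mem_IFS (h : IsContractingSystem G A)
    (hV : ∀ f ∈ G, Disjoint V (f '' A)) (hφ : φ ∈ IFS G) : Disjoint V (φ '' A) := by
  rcases mem_IFS_cases hφ with hf | ⟨f, hf, ψ, hψ, rfl⟩
  · exact hV φ hf
  · refine (hV f hf).mono_right ?_
    rintro _ ⟨x, hx, rfl⟩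
    exact ⟨ψ x, image_subset_of_mem_IFS h.maps hψ ⟨x, hx, rfl⟩, rfl⟩

theorem disjoint_limitSet (h : IsContractingSystem G A) (hV : ∀ f ∈ G, Disjoint V (f '' A)) :
    Disjoint V (limitSet G A) := by
  rw [h.limitSet_eq_iUnion, disjoint_iUnion₂_right]
  exact fun f hf => (hV f hf).mono_right (image_mono h.limitSet_subset)

/-- The identity is allowed beside the words because `P` itself belongs to the filled set and there
is no empty word. -/
theorem filledSet_inter_image_subset (h : IsContractingSystem G A) (hVA : V ⊆ A)
    (hV : ∀ f ∈ G, Disjoint V (f '' A)) (hPV : P ⊆ V) (hφ : φ = 1 ∨ φ ∈ IFS G)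
    {W : Set UnitAddCircle} (hW : W ⊆ V) : filledSet G A P ∩ φ '' W ⊆ φ '' (P ∩ W) := by
  rintro _ ⟨hx, x, hxW, rfl⟩
  refine ⟨x, ⟨?_, hxW⟩, rfl⟩
  have hxM : x ∈ filledSet G A P := by
    rcases hφ with rfl | hφ
    · exact hx
    · exact h.mem_filledSet_of_apply (hPV.trans hVA) (fun f hf => (hV f hf).mono_left hPV) hφ
        (hVA (hW hxW)) hx
  exact h.filledSet_inter_subset hV (hPV.trans hVA) ⟨hxM, hW hxW⟩

/-- A window around a piece of `P` in the gap is transported by `φ` to a window around the image of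
that piece. -/
theorem frontier_image_inter_interior (h : IsContractingSystem G A) (hVA : V ⊆ A)
    (hV : ∀ f ∈ G, Disjoint V (f '' A)) (hPV : P ⊆ V) (hφ : φ = 1 ∨ φ ∈ IFS G)
    {U W : Set UnitAddCircle} (hW : W ⊆ V) (hWo : IsOpen W) (hUW : closure U ⊆ W)
    (hPW : P ∩ W ⊆ closure U) (hU : interior (closure U) ⊆ U) :
    closure (φ '' U) ∩ interior (filledSet G A P) ⊆ φ '' U := by
  have e : closure (φ '' U) = φ '' closure U := (φ.image_closure U).symm
  refine closure_inter_interior_subset (W := φ '' W) (φ.isOpenMap _ hWo) ?_ ?_ ?_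
  · rw [e]
    exact image_mono hUW
  · rw [e]
    exact (h.filledSet_inter_image_subset hVA hV hPV hφ hW).trans (image_mono hPW)
  · rw [e, ← φ.image_interior]
    exact image_mono hU

/-- The decomposition of the union of the limit set and all images of a set `P` in a gap. -/
theorem isDecomposition_filledSet (h : IsContractingSystem G A) (hVo : IsOpen V) (hVA : V ⊆ A)
    (hV : ∀ f ∈ G, Disjoint V (f '' A)) (hPV : P ⊆ V) (hyV : y ∈ V) (hyP : y ∉ P)
    {κ : Type} [Countable κ] {U W : κ → Set UnitAddCircle} (hP : P = (⋃ j, closure (U j)) ∪ R)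
    (hU : ∀ j, IsOpen (U j)) (hUc : ∀ j, IsConnected (U j))
    (hUf : ∀ j, (frontier (U j)).Countable) (hW : ∀ j, W j ⊆ V) (hWo : ∀ j, IsOpen (W j))
    (hUW : ∀ j, closure (U j) ⊆ W j) (hPW : ∀ j, P ∩ W j ⊆ closure (U j))
    (hUi : ∀ j, interior (closure (U j)) ⊆ U j) (hR : R.Countable)
    (hRM : Disjoint R (interior (filledSet G A P))) :
    interior (filledSet G A P) = (⋃ i : {φ // φ = 1 ∨ φ ∈ IFS G} × κ, i.1.1 '' U i.2) ∧
    componentBoundary (filledSet G A P) =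
      (⋃ i : {φ // φ = 1 ∨ φ ∈ IFS G} × κ, frontier (i.1.1 '' U i.2)) ∧
    IsDecomposition (filledSet G A P) (limitSet G A)
      ((⋃ i : {φ // φ = 1 ∨ φ ∈ IFS G} × κ, frontier (i.1.1 '' U i.2)) ∪
        ⋃ φ : {φ // φ = 1 ∨ φ ∈ IFS G}, φ.1 '' R) := by
  have hcount : Countable {φ // φ = 1 ∨ φ ∈ IFS G} :=
    ((countable_IFS h.finite.countable).insert 1).to_subtype
  have hRP : R ⊆ P := hP ▸ subset_union_right
  have hUP : ∀ j, closure (U j) ⊆ P := fun j => hP ▸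
    (subset_iUnion (fun j => closure (U j)) j).trans subset_union_left
  have hPA := hPV.trans hVA
  have hPd : ∀ f ∈ G, Disjoint P (f '' A) := fun f hf => (hV f hf).mono_left hPV
  have hPK : Disjoint P (limitSet G A) := h.disjoint_limitSet hPd
  have hφK : ∀ φ : {φ // φ = 1 ∨ φ ∈ IFS G}, Disjoint (limitSet G A) (φ.1 '' P) := by
    rintro ⟨φ, hφ⟩
    refine disjoint_left.2 ?_
    rintro _ hx ⟨x, hxP, rfl⟩
    rcases hφ with rfl | hφ
    · exact disjoint_left.1 hPK hxP hx
    · exact h.notMem_limitSet_of_apply hφ (hPA hxP) (disjoint_left.1 hPK hxP) hx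
  have e : ∀ (φ : UnitAddCircle ≃ₜ UnitAddCircle) j, closure (φ '' U j) = φ '' closure (U j) :=
    fun φ j => (φ.image_closure _).symm
  have hM : filledSet G A P =
      (⋃ i : {φ // φ = 1 ∨ φ ∈ IFS G} × κ, closure (i.1.1 '' U i.2)) ∪
        (limitSet G A ∪ ⋃ φ : {φ // φ = 1 ∨ φ ∈ IFS G}, φ.1 '' R) := by
    have hPφ : ∀ φ : {φ // φ = 1 ∨ φ ∈ IFS G}, φ.1 '' P ⊆
        (⋃ i : {φ // φ = 1 ∨ φ ∈ IFS G} × κ, closure (i.1.1 '' U i.2)) ∪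
        (limitSet G A ∪ ⋃ φ : {φ // φ = 1 ∨ φ ∈ IFS G}, φ.1 '' R) := by
      rintro φ _ ⟨x, hx, rfl⟩
      rw [hP] at hx
      rcases hx with hx | hx
      · obtain ⟨j, hj⟩ := mem_iUnion.1 hx
        exact .inl (mem_iUnion.2 ⟨(φ, j), by rw [e]; exact ⟨x, hj, rfl⟩⟩)
      · exact .inr (.inr (mem_iUnion.2 ⟨φ, x, hx, rfl⟩))
    have hφM : ∀ φ : {φ // φ = 1 ∨ φ ∈ IFS G}, φ.1 '' P ⊆ filledSet G A P := by
      rintro ⟨φ, rfl | hφ⟩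
      · rintro _ ⟨x, hx, rfl⟩
        exact subset_filledSet hx
      · exact image_subset_filledSet hφ
    refine subset_antisymm ?_ (union_subset (iUnion_subset fun i => ?_)
      (union_subset limitSet_subset_filledSet (iUnion_subset fun φ => ?_)))
    · refine union_subset (union_subset (subset_union_left.trans subset_union_right)
        (iUnion₂_subset fun φ hφ => hPφ ⟨φ, .inr hφ⟩)) fun x hx => hPφ ⟨1, .inl rfl⟩ ⟨x, hx, rfl⟩
    · rw [e]
      exact (image_mono (hUP i.2)).trans (hφM i.1)
    · exact (image_mono hRP).trans (hφM φ)
  -- The point `y` of the gap is the hole that keeps the limit set out of the interior.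
  have hyM : y ∉ filledSet G A P := fun hy => hyP (h.filledSet_inter_subset hV hPA ⟨hy, hyV⟩)
  obtain ⟨h1, h2, h3, h4⟩ := isDecomposition_iUnion (K := limitSet G A) hM
    (fun i => i.1.1.isOpenMap _ (hU i.2))
    (fun i => (hUc i.2).image _ i.1.1.continuous.continuousOn)
    (fun i => by rw [← i.1.1.image_frontier]; exact (hUf i.2).image _)
    (fun i => h.frontier_image_inter_interior hVA hV hPV i.1.2 (hW i.2) (hWo i.2) (hUW i.2)
      (hPW i.2) (hUi i.2))
    (.inr h.isCantorSet_limitSet) (h.disjoint_limitSet_interior hPA hPd (hVA hyV) hyM)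
    (by
      rw [disjoint_iUnion_left]
      rintro ⟨φ, hφ⟩
      refine disjoint_left.2 ?_
      rintro _ ⟨x, hx, rfl⟩
      rcases hφ with rfl | hφ
      · exact disjoint_left.1 hRM hx
      · exact h.apply_notMem_interior hPA hPd hφ (interior_maximal hVA hVo (hPV (hRP hx)))
          (disjoint_left.1 hRM hx))
    (countable_iUnion fun φ => hR.image _)
    (fun i => by rw [e]; exact (hφK i.1).mono_right (image_mono (hUP i.2)))
    (disjoint_iUnion_right.2 fun φ => (hφK φ).mono_right (image_mono hRP))
  exact ⟨h1, h3, h4⟩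

end IsContractingSystem

/-! ### Minimal sets made of intervals, a Cantor set and countably many points -/

theorem exists_intervals_cantor_endpoints :
    ∃ (f g h Tp Tm : UnitAddCircle ≃ₜ UnitAddCircle) (a b a' b' c d p q u' v' u v : ℝ)
        (M K N : Set UnitAddCircle),
      IsCantorPair f g K a b a' b' ∧ (a : UnitAddCircle) ∈ K ∧ (b : UnitAddCircle) ∈ K ∧
      openArc c d ∈ components Kᶜ ∧ openArc c d ⊆ arc a b ∧
      Disjoint (arc u v) (arc a' b') ∧ IsAuxMap h u' v' u v (arc p q) ∧
      IsTPair Tp Tm p q c d ∧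
      (∀ φ ∈ ({f, g, h, Tp, Tm} : Set (UnitAddCircle ≃ₜ UnitAddCircle)),
        HasRotationNumber φ 0) ∧
      M = K ∪ (⋃ φ ∈ IFS {f, g}, φ '' arc p q) ∪ arc p q ∧
      IsMinimalSet {f, g, h, Tp, Tm} M ∧ IsDecomposition M K N ∧
      (interior M).Nonempty ∧ K.Nonempty ∧ N.Nonempty ∧ componentBoundary M = N := by
  obtain ⟨f, g, hfg⟩ := exists_isTriadicPair
  have hS := hfg.isContractingSystem
  obtain ⟨Tp, Tm, hT, hTp, hTm⟩ := exists_isTPair (a' := 1 / 4) (a := 9 / 32) (b := 11 / 32)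
    (b' := 3 / 8) (by norm_num) (by norm_num) (by norm_num) (by norm_num)
  obtain ⟨k, hk, hk0⟩ := exists_isAuxMap (u := 11 / 16) (v := 15 / 16) (u' := 12 / 16)
    (v' := 14 / 16) (p := 9 / 32) (q := 11 / 32) (by norm_num) (by norm_num) (by norm_num)
    (by norm_num) (by norm_num) (by norm_num)
  set P : Set UnitAddCircle := arc (9 / 32) (11 / 32) with hPdef
  have hPV : P ⊆ openArc (1 / 4) (3 / 8) := arc_subset_openArc (by norm_num) (by norm_num)
  have hVA : openArc (1 / 4) (3 / 8) ⊆ arc (1 / 8) (1 / 2) :=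
    openArc_subset_arc.trans (arc_mono (by norm_num) (by norm_num))
  have hPA := hPV.trans hVA
  have hcl : closure (openArc (9 / 32) (11 / 32)) = P := closure_openArc (by norm_num)
  have hJ : Disjoint (arc (11 / 16) (15 / 16)) (arc (1 / 16) (9 / 16)) :=
    (disjoint_arc (by norm_num) (by norm_num)).symm
  have hMA := hS.filledSet_subset hPA
  have hkM : ∀ x ∈ filledSet {f, g} (arc (1 / 8) (1 / 2)) P, k x ∈ P := fun x hx =>
    hk.apply_mem (hJ.mono_right (arc_mono (by norm_num) (by norm_num))) (hMA hx)
  obtain ⟨h1, h2, h3⟩ := hS.isDecomposition_filledSet (P := P) (R := ∅) (κ := Unit)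
    (U := fun _ => openArc (9 / 32) (11 / 32)) (W := fun _ => openArc (1 / 4) (3 / 8))
    isOpen_openArc hVA hfg.disjoint_gap hPV
    -- The hole is taken between the left end `1 / 4` of the gap and the left end `9 / 32` of the
    -- filled arc.
    (coe_mem_openArc (x := 17 / 64) (by norm_num))
    (by rw [hPdef, coe_mem_arc_iff (by norm_num) (by norm_num)]; norm_num)
    (by rw [union_empty, iUnion_const, hcl]) (fun _ => isOpen_openArc)
    (fun _ => isConnected_openArc (by norm_num))
    (fun _ => countable_frontier_openArc (by norm_num) (by norm_num)) (fun _ => subset_rfl)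
    (fun _ => isOpen_openArc) (fun _ => by rw [hcl]; exact hPV)
    (fun _ => by rw [hcl]; exact inter_subset_left)
    (fun _ => by rw [hcl, hPdef, interior_arc (by norm_num) (by norm_num)])
    countable_empty (empty_disjoint _)
  have hN : (⋃ φ : {φ // φ = 1 ∨ φ ∈ IFS {f, g}}, φ.1 '' (∅ : Set UnitAddCircle)) = ∅ := by simp
  rw [hN, union_empty] at h3
  have hp : ((9 / 32 : ℝ) : UnitAddCircle) ∈ P := coe_mem_arc (by norm_num)
  refine ⟨f, g, k, Tp, Tm, 1 / 8, 1 / 2, 1 / 16, 9 / 16, 1 / 4, 3 / 8, 9 / 32, 11 / 32, 12 / 16,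
    14 / 16, 11 / 16, 15 / 16, filledSet {f, g} (arc (1 / 8) (1 / 2)) P, triadicLimit f g, _,
    hfg.isCantorPair, hfg.left_mem, hfg.right_mem, hfg.gap_mem_components, hVA, hJ, hk, hT, ?_,
    rfl, ?_, h3, ?_, hfg.isCantorPair.cantor.1, ?_, h2⟩
  · rintro φ (rfl | rfl | rfl | rfl | rfl)
    exacts [hfg.rotation_left, hfg.rotation_right, hk0, hTp, hTm]
  · refine isMinimalSet_of_reaches ⟨_, subset_filledSet hp⟩ (hS.isClosed_filledSet hPA isClosed_arc)
      ?_ ?_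
    · have hTM := hT.image_subset (M := filledSet {f, g} (arc (1 / 8) (1 / 2)) P) subset_filledSet
        (hS.filledSet_inter_subset hfg.disjoint_gap hPA)
      rintro φ (rfl | rfl | rfl | rfl | rfl)
      · exact hS.image_filledSet_subset (mem_IFS_of_mem (by simp))
      · exact hS.image_filledSet_subset (mem_IFS_of_mem (by simp))
      · rintro _ ⟨x, hx, rfl⟩
        exact subset_filledSet (hkM x hx)
      · exact hTM.1
      · exact hTM.2
    · intro x hx y hy
      -- The route: `k` throws `x` into `P`, `T⁺, T⁻` make its orbit dense in `P`, and `f, g` carry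
      -- `P` to the other intervals and accumulate on the Cantor set.
      refine (reaches_of_mem (φ := k) (by simp)).trans (hS.reaches_filledSet
        (by simp [insert_subset_iff]) (hPA (hkM x hx)) (fun y hy => ?_) y hy)
      exact (hT.reaches (by norm_num) (hkM x hx) hy).mono (by simp [insert_subset_iff])
  · rw [h1]
    exact ⟨((10 / 32 : ℝ) : UnitAddCircle), mem_iUnion.2 ⟨(⟨1, .inl rfl⟩, ()), _,
      coe_mem_openArc (by norm_num), rfl⟩⟩
  · refine ⟨((9 / 32 : ℝ) : UnitAddCircle), mem_iUnion.2 ⟨(⟨1, .inl rfl⟩, ()), ?_⟩⟩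
    change _ ∈ frontier ((1 : UnitAddCircle ≃ₜ UnitAddCircle) '' openArc (9 / 32) (11 / 32))
    rw [← Homeomorph.image_frontier, frontier_openArc (by norm_num) (by norm_num)]
    exact ⟨_, .inl rfl, rfl⟩

theorem exists_intervals_cantor_points :
    ∃ (f g φ₀ h Tp Tm : UnitAddCircle ≃ₜ UnitAddCircle)
        (a b a' b' c d s t p q p' q' u' v' u v : ℝ) (M K N : Set UnitAddCircle),
      IsCantorPair f g K a b a' b' ∧ (a : UnitAddCircle) ∈ K ∧ (b : UnitAddCircle) ∈ K ∧
      openArc c d ∈ components Kᶜ ∧ openArc c d ⊆ arc a b ∧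
      c < s ∧ t < d ∧ IsPush φ₀ s t ∧ s < p' ∧ q' < t ∧
      (∀ n : ℕ, 1 ≤ n → Disjoint (φ₀^[n] '' arc p q) (arc p q)) ∧
      Disjoint (φ₀ '' arc p q) (arc p' q') ∧
      Disjoint (arc u v) (arc a' b') ∧ IsAuxMap h u' v' u v (arc p q) ∧
      IsTPair Tp Tm p q p' q' ∧
      (∀ φ ∈ ({f, g, φ₀, h, Tp, Tm} : Set (UnitAddCircle ≃ₜ UnitAddCircle)),
        HasRotationNumber φ 0) ∧
      M = K ∪ (⋃ n : ℕ, φ₀^[n] '' arc p q) ∪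
        (⋃ φ ∈ IFS {f, g}, φ '' (⋃ n : ℕ, φ₀^[n] '' arc p q)) ∪
        (⋃ φ ∈ IFS {f, g}, {φ (t : UnitAddCircle)}) ∪ {(t : UnitAddCircle)} ∧
      IsMinimalSet {f, g, φ₀, h, Tp, Tm} M ∧ IsDecomposition M K N ∧
      (interior M).Nonempty ∧ K.Nonempty ∧
      (componentBoundary M ∩ N).Nonempty ∧ ¬ N ⊆ componentBoundary M := by
  obtain ⟨f, g, hfg⟩ := exists_isTriadicPair
  have hS := hfg.isContractingSystem
  obtain ⟨Tp, Tm, hT, hTp, hTm⟩ := exists_isTPair (a' := 9 / 32) (a := 37 / 128) (b := 39 / 128)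
    (b' := 5 / 16) (by norm_num) (by norm_num) (by norm_num) (by norm_num)
  obtain ⟨k, hk, hk0⟩ := exists_isAuxMap (u := 11 / 16) (v := 15 / 16) (u' := 12 / 16)
    (v' := 14 / 16) (p := 37 / 128) (q := 39 / 128) (by norm_num) (by norm_num) (by norm_num)
    (by norm_num) (by norm_num) (by norm_num)
  -- The image of `9 / 32` is `41 / 128 > 5 / 16`, so the arc `[9/32, 5/16]` has pairwise disjoint
  -- iterates, which serve as windows.
  obtain ⟨ψ, hψ⟩ := exists_isHalvingPush (s := 17 / 64) (m := 9 / 32) (t := 23 / 64)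
    (by norm_num) (by norm_num) (by norm_num)
  set t : ℝ := 23 / 64
  set Q : Set UnitAddCircle := arcSequence t (37 / 128) (39 / 128)
  have hQ : ⋃ n : ℕ, ψ^[n] '' arc (37 / 128) (39 / 128) = Q :=
    hψ.iUnion_image_arc (by norm_num) (by norm_num)
  set P : Set UnitAddCircle := Q ∪ {(t : UnitAddCircle)} with hPdef
  have hpt : (37 / 128 : ℝ) < t := by norm_num
  have hqt : (39 / 128 : ℝ) < t := by norm_num
  have hPt : P ⊆ arc (37 / 128) t := union_subset (arcSequence_subset hqt hpt.le)
    (singleton_subset_iff.2 (coe_mem_arc ⟨hpt.le, le_rfl⟩))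
  have hPV : P ⊆ openArc (1 / 4) (3 / 8) :=
    hPt.trans (arc_subset_openArc (by norm_num) (by norm_num))
  have hVA : openArc (1 / 4) (3 / 8) ⊆ arc (1 / 8) (1 / 2) :=
    openArc_subset_arc.trans (arc_mono (by norm_num) (by norm_num))
  have hPA := hPV.trans hVA
  have hbig : ∀ n, arc (halving t (9 / 32) n) (halving t (5 / 16) n) ⊆ openArc (1 / 4) (3 / 8) :=
    fun n => arc_subset_openArc (lt_of_lt_of_le (by norm_num) (le_halving (by norm_num)))
      ((halving_lt (by norm_num)).trans (by norm_num))
  have hPW : ∀ n, P ∩ arc (halving t (9 / 32) n) (halving t (5 / 16) n) ⊆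
      arc (halving t (37 / 128) n) (halving t (39 / 128) n) :=
    arcSequence_inter_subset (by norm_num) (by norm_num) (by norm_num) (by norm_num)
      (by norm_num) (by norm_num)
  have hpq : ∀ n, halving t (37 / 128) n < halving t (39 / 128) n :=
    fun n => halving_lt_halving (by norm_num)
  have hpp : ∀ n, halving t (9 / 32) n < halving t (37 / 128) n :=
    fun n => halving_lt_halving (by norm_num)
  have hqq : ∀ n, halving t (39 / 128) n < halving t (5 / 16) n :=
    fun n => halving_lt_halving (by norm_num)
  have hlen : ∀ n, halving t (39 / 128) n < halving t (37 / 128) n + 1 := fun n => by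
    linarith [halving_lt (n := n) hqt, le_halving (n := n) hpt.le]
  have hcl : ∀ n, closure (openArc (halving t (37 / 128) n) (halving t (39 / 128) n)) =
      arc (halving t (37 / 128) n) (halving t (39 / 128) n) := fun n => closure_openArc (hpq n)
  have hJ : Disjoint (arc (11 / 16) (15 / 16)) (arc (1 / 16) (9 / 16)) :=
    (disjoint_arc (by norm_num) (by norm_num)).symm
  have hMA := hS.filledSet_subset hPA
  have hkM : ∀ x ∈ filledSet {f, g} (arc (1 / 8) (1 / 2)) P, k x ∈ arc (37 / 128) (39 / 128) :=
    fun x hx => hk.apply_mem (hJ.mono_right (arc_mono (by norm_num) (by norm_num))) (hMA hx)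
  have hP0 : arc (37 / 128) (39 / 128) ⊆ P := by
    have := subset_iUnion (fun n => arc (halving t (37 / 128) n) (halving t (39 / 128) n)) 0
    rw [halving_zero, halving_zero] at this
    exact this.trans subset_union_left
  have hMV : filledSet {f, g} (arc (1 / 8) (1 / 2)) P ∩ openArc (1 / 4) (3 / 8) ⊆ P :=
    hS.filledSet_inter_subset hfg.disjoint_gap hPA
  have htP : (t : UnitAddCircle) ∈ P := .inr rfl
  -- The right ends of the windows lie in the gap but off `P`, and they tend to `t`.
  have htM : (t : UnitAddCircle) ∉ interior (filledSet {f, g} (arc (1 / 8) (1 / 2)) P) := by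
    refine notMem_interior_of_tendsto (fun n hn => ?_) (tendsto_coe_halving t (5 / 16))
    refine halving_notMem_arcSequence (p' := 9 / 32) (p := 37 / 128) (q := 39 / 128) (q' := 5 / 16)
      (by norm_num) (by norm_num) (by norm_num) (by norm_num) (by norm_num) (by norm_num) n
      (hMV ⟨hn, hbig n (coe_mem_arc ⟨?_, le_rfl⟩)⟩)
    exact halving_le_halving (by norm_num)
  obtain ⟨h1, h2, h3⟩ := hS.isDecomposition_filledSet (P := P) (R := {(t : UnitAddCircle)}) (κ := ℕ)
    (U := fun n => openArc (halving t (37 / 128) n) (halving t (39 / 128) n))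
    (W := fun n => openArc (halving t (9 / 32) n) (halving t (5 / 16) n))
    isOpen_openArc hVA hfg.disjoint_gap hPV
    (coe_mem_openArc (x := 17 / 64) (by norm_num))
    (fun hx => by
      have := hPt hx
      rw [coe_mem_arc_iff (by norm_num) (by norm_num)] at this
      norm_num at this)
    (by rw [hPdef, iUnion_congr hcl]; rfl) (fun _ => isOpen_openArc)
    (fun n => isConnected_openArc (hpq n))
    (fun n => countable_frontier_openArc (hpq n) (hlen n).le)
    (fun n => openArc_subset_arc.trans (hbig n)) (fun _ => isOpen_openArc)
    (fun n => by rw [hcl]; exact arc_subset_openArc (hpp n) (hqq n))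
    (fun n => by rw [hcl]; exact (inter_subset_inter_right _ openArc_subset_arc).trans (hPW n))
    (fun n => by rw [hcl, interior_arc (hpq n) (hlen n)])
    (countable_singleton _) (disjoint_singleton_left.2 htM)
  have hdisj : ∀ n : ℕ, 1 ≤ n → Disjoint (ψ^[n] '' arc (37 / 128) (39 / 128))
      (arc (9 / 32) (5 / 16)) := by
    intro n hn
    rw [hψ.image_arc (by norm_num) (by norm_num)]
    have := disjoint_halving_arcs (p := 9 / 32) (q' := 5 / 16) (t := t) (by norm_num) (by norm_num)
      (by norm_num) (by norm_num) (n := n) (k := 0) (by omega)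
    rw [halving_zero, halving_zero] at this
    exact this.mono_left (arc_mono (hpp n).le (hqq n).le)
  refine ⟨f, g, ψ, k, Tp, Tm, 1 / 8, 1 / 2, 1 / 16, 9 / 16, 1 / 4, 3 / 8, 17 / 64, t, 37 / 128,
    39 / 128, 9 / 32, 5 / 16, 12 / 16, 14 / 16, 11 / 16, 15 / 16,
    filledSet {f, g} (arc (1 / 8) (1 / 2)) P, triadicLimit f g, _, hfg.isCantorPair, hfg.left_mem,
    hfg.right_mem, hfg.gap_mem_components, hVA, by norm_num, by norm_num, hψ.isPush, by norm_num,
    by norm_num, fun n hn => (hdisj n hn).mono_right (arc_mono (by norm_num) (by norm_num)),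
    by simpa using hdisj 1 le_rfl, hJ, hk, hT, ?_, ?_, ?_, h3, ?_, hfg.isCantorPair.cantor.1,
    ?_, ?_⟩
  · rintro φ (rfl | rfl | rfl | rfl | rfl | rfl)
    exacts [hfg.rotation_left, hfg.rotation_right, hψ.hasRotationNumber, hk0, hTp, hTm]
  · rw [hQ, filledSet, hPdef]
    simp only [image_union, image_singleton, iUnion_union_distrib]
    change triadicLimit f g ∪ _ ∪ _ = _
    ext x
    simp only [mem_union]
    tauto
  · refine isMinimalSet_of_reaches ⟨_, subset_filledSet htP⟩
      (hS.isClosed_filledSet hPA (isClosed_arcSequence hqt)) ?_ ?_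
    · have hTM := hT.image_subset (M := filledSet {f, g} (arc (1 / 8) (1 / 2)) P)
        (hP0.trans subset_filledSet) (by
          have h0 := hPW 0
          have h0' := hbig 0
          simp only [halving_zero] at h0 h0'
          rintro x ⟨hx, hxI⟩
          exact h0 ⟨hMV ⟨hx, h0' (openArc_subset_arc hxI)⟩, openArc_subset_arc hxI⟩)
      rintro φ (rfl | rfl | rfl | rfl | rfl | rfl)
      · exact hS.image_filledSet_subset (mem_IFS_of_mem (by simp))
      · exact hS.image_filledSet_subset (mem_IFS_of_mem (by simp))
      · rintro _ ⟨x, hx, rfl⟩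
        by_cases hxs : x ∈ arc (17 / 64) t
        · have hxP := hMV ⟨hx, arc_subset_openArc (by norm_num) (by norm_num) hxs⟩
          apply subset_filledSet
          rcases hxP with hxQ | rfl
          · obtain ⟨n, hn⟩ := mem_iUnion.1 (hQ ▸ hxQ)
            refine .inl (hQ ▸ mem_iUnion.2 ⟨n + 1, ?_⟩)
            obtain ⟨z, hz, rfl⟩ := hn
            exact ⟨z, hz, Function.iterate_succ_apply' _ _ _⟩
          · rw [hψ.apply_right (by norm_num)]
            exact htP
        · rwa [hψ.isPush.eq_self x hxs]
      · rintro _ ⟨x, hx, rfl⟩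
        exact subset_filledSet (hP0 (hkM x hx))
      · exact hTM.1
      · exact hTM.2
    · intro x hx y hy
      have hz := hkM x hx
      refine (reaches_of_mem (φ := k) (by simp)).trans (hS.reaches_filledSet
        (by simp [insert_subset_iff]) (hPA (hP0 hz)) (fun y hy => ?_) y hy)
      have hT0 : ∀ w ∈ arc (37 / 128) (39 / 128), ∀ n, Reaches {f, g, ψ, k, Tp, Tm} (k x)
          (ψ^[n] w) := fun w hw n =>
        ((hT.reaches (by norm_num) hz hw).mono (by simp [insert_subset_iff])).iterate (by simp) n
      rcases hy with hy | rfl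
      · obtain ⟨n, w, hw, rfl⟩ := mem_iUnion.1 (hQ ▸ hy)
        exact hT0 w hw n
      -- The single point `t` is reached only as the limit of the iterates of an endpoint of the
      -- first interval.
      · refine reaches_of_tendsto (fun n => ?_) (tendsto_coe_halving t (37 / 128))
        rw [← hψ.iterate_apply (by norm_num)]
        exact hT0 _ (coe_mem_arc (by norm_num)) n
  · rw [h1]
    exact ⟨((38 / 128 : ℝ) : UnitAddCircle), mem_iUnion.2 ⟨(⟨1, .inl rfl⟩, 0), _,
      coe_mem_openArc (by norm_num), rfl⟩⟩
  · have : ((37 / 128 : ℝ) : UnitAddCircle) ∈ ⋃ i : {φ // φ = 1 ∨ φ ∈ IFS {f, g}} × ℕ,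
        frontier (i.1.1 '' openArc (halving t (37 / 128) i.2) (halving t (39 / 128) i.2)) := by
      refine mem_iUnion.2 ⟨(⟨1, .inl rfl⟩, 0), ?_⟩
      rw [← Homeomorph.image_frontier, frontier_openArc (hpq 0) (hlen 0).le]
      exact ⟨_, .inl rfl, by simp⟩
    rw [h2]
    exact ⟨_, this, .inl this⟩
  · rw [h2]
    intro hsub
    -- The point `t` belongs to `N` without being an endpoint: the arcs in the gap end strictly
    -- before `t`, and images under words lie in first-level images of `A`, which avoid the gap.
    have htN := hsub (.inr (mem_iUnion.2 ⟨⟨1, .inl rfl⟩, _, rfl, rfl⟩))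
    obtain ⟨⟨⟨φ, hφ⟩, n⟩, hi⟩ := mem_iUnion.1 htN
    have hi' := frontier_subset_closure hi
    change _ ∈ closure (φ '' openArc _ _) at hi'
    rw [← φ.image_closure, hcl] at hi'
    change (t : UnitAddCircle) ∈ _ at hi'
    rcases hφ with rfl | hφ
    · obtain ⟨w, hw, hwt⟩ := hi'
      change w = _ at hwt
      subst hwt
      have := halving_lt (n := n) hqt
      rw [coe_mem_arc_iff (by linarith [le_halving (n := n) hpt.le]) (by linarith)] at hw
      linarith [hw.2]
    · refine disjoint_left.1 (hS.disjoint_image_of_mem_IFS hfg.disjoint_gap hφ) (hPV htP)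
        (image_mono ?_ hi')
      exact (arc_mono (hpp n).le (hqq n).le).trans ((hbig n).trans hVA)

/-! ### Unions of intervals -/

section Unions

variable {M : Set UnitAddCircle} {a b a' b' t p q p' q' : ℝ}

theorem closure_openArc_inter_interior_subset (ha : a' < a) (hab : a < b) (hb : b < b')
    (hper : b < a + 1) (hM : M ∩ openArc a' b' ⊆ arc a b) :
    closure (openArc a b) ∩ interior M ⊆ openArc a b := by
  refine closure_inter_interior_subset (W := openArc a' b') isOpen_openArc ?_ ?_ ?_
  · rw [closure_openArc hab]
    exact arc_subset_openArc ha hb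
  · rwa [closure_openArc hab]
  · rw [closure_openArc hab, interior_arc hab hper]

theorem nontrivial_component {x : UnitAddCircle} (hab : a < b) (hper : b < a + 1)
    (hM : arc a b ⊆ M) (hx : x ∈ arc a b) : (connectedComponentIn M x).Nontrivial := by
  have hsub := (isConnected_arc hab.le).isPreconnected.subset_connectedComponentIn hx hM
  refine ⟨a, hsub (coe_mem_arc ⟨le_rfl, hab.le⟩), b, hsub (coe_mem_arc ⟨hab.le, le_rfl⟩),
    fun h => ?_⟩
  exact hab.ne (coe_inj_of_lt h (by linarith) hper)

end Unions

/-- The extra interval `[c, d]` absorbs the limit point of the sequence `ψⁿ(I₀)`, so that no single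
point is left over. From the basic interval the sequence is reached by `ψ` and the extra interval by
`H`. -/
theorem exists_intervals_infinite :
    ∃ (Tp Tm H ψ h : UnitAddCircle ≃ₜ UnitAddCircle) (p q p' q' s c d u' v' u v : ℝ)
        (M N : Set UnitAddCircle),
      IsPush ψ s c ∧ s < p' ∧ q' < c ∧ c < d ∧ d < s + 1 ∧ IsTPair Tp Tm p q p' q' ∧
      (∀ n : ℕ, 1 ≤ n → Disjoint (ψ^[n] '' arc p' q') (arc p' q')) ∧
      Disjoint (arc u v) ((⋃ n : ℕ, ψ^[n] '' arc p' q') ∪ arc c d) ∧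
      IsAuxMap h u' v' u v (arc p q) ∧
      H '' arc p q = arc c d ∧
      H '' ((⋃ n : ℕ, ψ^[n + 1] '' arc p q) ∪ arc c d) ⊆ ψ '' arc p q ∧
      (∀ φ ∈ ({Tp, Tm, H, ψ, h} : Set (UnitAddCircle ≃ₜ UnitAddCircle)),
        HasRotationNumber φ 0) ∧
      M = (⋃ n : ℕ, ψ^[n] '' arc p q) ∪ arc c d ∧
      IsMinimalSet {Tp, Tm, H, ψ, h} M ∧ IsDecomposition M ∅ N ∧
      (components M).Infinite ∧ (∀ C ∈ components M, C.Nontrivial) ∧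
      componentBoundary M = N := by
  obtain ⟨Tp, Tm, hT, hTp, hTm⟩ := exists_isTPair (a' := 8 / 64) (a := 10 / 64) (b := 14 / 64)
    (b' := 16 / 64) (by norm_num) (by norm_num) (by norm_num) (by norm_num)
  obtain ⟨k, hk, hk0⟩ := exists_isAuxMap (u := 52 / 64) (v := 56 / 64) (u' := 53 / 64)
    (v' := 54 / 64) (p := 10 / 64) (q := 14 / 64) (by norm_num) (by norm_num) (by norm_num)
    (by norm_num) (by norm_num) (by norm_num)
  obtain ⟨ψ, hψ⟩ := exists_isHalvingPush (s := 4 / 64) (m := 8 / 64) (t := 40 / 64)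
    (by norm_num) (by norm_num) (by norm_num)
  -- Here `ψ(I₀) = [25/64, 27/64]`. Fixing `25 / 64` and sending `48 / 64` to `27 / 64` squeezes the
  -- later intervals and `I` into `ψ(I₀)`, while `I₀`, translated by `1`, goes onto `I = [40/64,
  -- 48/64]`.
  obtain ⟨H, F, hH, F1, F2, F3, F4, -⟩ := exists_interpolation_three (a := 25 / 64) (b := 89 / 64)
    (m := 48 / 64) (m' := 27 / 64) (n := 10 / 64 + 1) (n' := 40 / 64) (o := 14 / 64 + 1)
    (o' := 48 / 64) (by norm_num) (by norm_num) (by norm_num) (by norm_num) (by norm_num)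
    (by norm_num) (by norm_num) (by norm_num) (by norm_num)
  set t : ℝ := 40 / 64
  set d : ℝ := 48 / 64 with hd
  set p : ℝ := 10 / 64
  set q : ℝ := 14 / 64
  set p' : ℝ := 8 / 64
  set q' : ℝ := 16 / 64
  have hpt : p < t := by norm_num
  have hqt : q < t := by norm_num
  have hqt' : q' < t := by norm_num
  have hp0 : t < p + 1 := by norm_num
  have hp0' : d < p' + 1 := by norm_num
  have hq0' : d < q' + 1 := by norm_num
  have hpq : ∀ n, halving t p n < halving t q n := fun n => halving_lt_halving (by norm_num)
  have hpp : ∀ n, halving t p' n < halving t p n := fun n => halving_lt_halving (by norm_num)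
  have hqq : ∀ n, halving t q n < halving t q' n := fun n => halving_lt_halving (by norm_num)
  have hlen : ∀ n, halving t q n < halving t p n + 1 := fun n => by
    linarith [halving_lt (n := n) hqt, le_halving (n := n) hpt.le]
  have hQ : ⋃ n : ℕ, ψ^[n] '' arc p q = arcSequence t p q :=
    hψ.iUnion_image_arc (by norm_num) (by norm_num)
  set M : Set UnitAddCircle := arcSequence t p q ∪ arc t d with hMdef
  have hseq : ∀ n, arc (halving t p n) (halving t q n) ⊆ M := fun n =>
    (subset_iUnion (fun n => arc (halving t p n) (halving t q n)) n).trans subset_union_left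
  have hP0 : arc p q ⊆ M := by
    simpa using hseq 0
  have hI : arc t d ⊆ M := subset_union_right
  have hMd : M ⊆ arc p d := union_subset
    ((arcSequence_subset hqt hpt.le).trans (arc_mono le_rfl (by norm_num)))
    (arc_mono (by norm_num) le_rfl)
  have hMP : M = arcSequence t p q ∪ {(t : UnitAddCircle)} ∪ arc t d := by
    rw [union_assoc, union_eq_self_of_subset_left
      (singleton_subset_iff.2 (coe_mem_arc ⟨le_rfl, by norm_num⟩))]
  have hMW : ∀ n, M ∩ arc (halving t p' n) (halving t q' n) ⊆
      arc (halving t p n) (halving t q n) := by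
    rintro n x ⟨hx | hx, hxn⟩
    · exact arcSequence_inter_subset (by norm_num) (by norm_num) (by norm_num) (by norm_num)
        (by norm_num) (by norm_num) n ⟨.inl hx, hxn⟩
    · refine absurd hx (disjoint_left.1 (disjoint_arc (halving_lt hqt') ?_) hxn)
      linarith [le_halving (n := n) (x := p') (t := t) (by norm_num)]
  have hkM : ∀ x ∈ M, k x ∈ arc p q := fun x hx =>
    hk.apply_mem (disjoint_arc (by norm_num) (by norm_num)).symm (hMd hx)
  have hH1 : H '' arc p q = arc t d := by
    rw [← arc_add_one, hH.image_arc, F3, F4]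
  have hψ1 : ψ '' arc p q = arc (25 / 64) (27 / 64) := by
    rw [hψ.image_arc_one (by norm_num) (by norm_num)]
    norm_num [halving]
  have htail : ∀ n, arc (halving t p (n + 1)) (halving t q (n + 1)) ⊆ arc (25 / 64) d := by
    intro n
    have h1 : halving t p 1 ≤ halving t p (n + 1) := halving_mono hpt.le (by omega)
    have h2 : halving t p 1 = 25 / 64 := by norm_num [halving]
    exact arc_mono (h2 ▸ h1) ((halving_lt hqt).le.trans (by norm_num))
  have hH2 : H '' ((⋃ n : ℕ, ψ^[n + 1] '' arc p q) ∪ arc t d) ⊆ ψ '' arc p q := by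
    have : (⋃ n : ℕ, ψ^[n + 1] '' arc p q) ∪ arc t d ⊆ arc (25 / 64) d := by
      refine union_subset (iUnion_subset fun n => ?_) (arc_mono (by norm_num) le_rfl)
      rw [hψ.image_arc (by norm_num) (by norm_num)]
      exact htail n
    refine (image_mono this).trans ?_
    rw [hH.image_arc, F1, F2, hψ1]
  have hψM : ψ '' arcSequence t p q ⊆ arcSequence t p q := by
    rw [← hQ]
    rintro _ ⟨x, hx, rfl⟩
    obtain ⟨n, w, hw, rfl⟩ := mem_iUnion.1 hx
    exact mem_iUnion.2 ⟨n + 1, w, hw, Function.iterate_succ_apply' _ _ _⟩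
  have hdisj : ∀ n : ℕ, 1 ≤ n → Disjoint (ψ^[n] '' arc p' q') (arc p' q') := by
    intro n hn
    rw [hψ.image_arc (by norm_num) (by norm_num)]
    have := disjoint_halving_arcs (p := p') (q' := q') (t := t) (by norm_num) (by norm_num)
      (by norm_num) (by norm_num) (n := n) (k := 0) (by omega)
    rwa [halving_zero, halving_zero] at this
  have htM : (t : UnitAddCircle) ∉ interior M := by
    refine notMem_interior_of_tendsto (fun n hn => ?_) (tendsto_coe_halving t q')
    have h1 := halving_lt (n := n) hqt'
    have h2 := le_halving (n := n) hqt'.le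
    rw [hMP] at hn
    rcases hn with hn | hn
    · exact halving_notMem_arcSequence (p' := p') (p := p) (q := q) (by norm_num) (by norm_num)
        (by norm_num) (by norm_num) (by norm_num) (by norm_num) n hn
    · rw [coe_mem_arc_iff (by linarith) (by linarith)] at hn
      linarith [hn.1]
  have hdM : (d : UnitAddCircle) ∉ interior M := by
    -- Starting to the right of `d`, halving produces a decreasing sequence, which approaches `d`
    -- from outside `M`.
    refine notMem_interior_of_tendsto (fun n hn => ?_) (tendsto_coe_halving d (52 / 64))
    have h0 : (0 : ℝ) < 2 ^ n := by positivity
    have h1 : halving d (52 / 64) n = d + 4 / 64 / 2 ^ n := by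
      rw [halving, hd]
      ring
    have h2 : (0 : ℝ) < 4 / 64 / 2 ^ n := by positivity
    have h3 : (4 : ℝ) / 64 / 2 ^ n ≤ 4 / 64 :=
      div_le_self (by norm_num) (one_le_pow₀ (by norm_num))
    have hn' := hMd hn
    rw [h1, coe_mem_arc_iff (by linarith) (by linarith)] at hn'
    linarith [hn'.2]
  -- The index `none` stands for the extra interval, the others for the sequence.
  let V : Option ℕ → Set UnitAddCircle := fun i =>
    i.elim (openArc t d) fun n => openArc (halving t p n) (halving t q n)
  have htd : t < d := by norm_num
  have hdt : d < t + 1 := by norm_num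
  have hVcl : ∀ n, closure (openArc (halving t p n) (halving t q n)) =
      arc (halving t p n) (halving t q n) := fun n => closure_openArc (hpq n)
  have hMV : M = (⋃ i, closure (V i)) ∪ (∅ ∪ ∅) := by
    rw [iUnion_option, union_empty, union_empty]
    change _ = closure (openArc t d) ∪
      ⋃ n, closure (openArc (halving t p n) (halving t q n))
    rw [closure_openArc htd, iUnion_congr hVcl, union_comm]
    rfl
  obtain ⟨-, -, h3, h4⟩ := isDecomposition_iUnion hMV
    (by rintro (_ | n) <;> exact isOpen_openArc)
    (by
      rintro (_ | n)
      · exact isConnected_openArc htd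
      · exact isConnected_openArc (hpq n))
    (by
      rintro (_ | n)
      · exact countable_frontier_openArc htd hdt.le
      · exact countable_frontier_openArc (hpq n) (hlen n).le)
    (by
      rintro (_ | n)
      · change closure (openArc t d) ∩ _ ⊆ openArc t d
        rw [closure_openArc htd, arc_eq_openArc_union htd.le]
        rintro x ⟨hx | rfl | rfl, hxi⟩
        · exact hx
        · exact absurd hxi htM
        · exact absurd hxi hdM
      · exact closure_openArc_inter_interior_subset (hpp n) (hpq n) (hqq n) (hlen n)
          ((inter_subset_inter_right _ openArc_subset_arc).trans (hMW n)))
    (.inl rfl) (empty_disjoint _) (empty_disjoint _) countable_empty (fun _ => empty_disjoint _)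
    (empty_disjoint _)
  rw [union_empty] at h4
  refine ⟨Tp, Tm, H, ψ, k, p, q, p', q', 4 / 64, t, d, 53 / 64, 54 / 64, 52 / 64, 56 / 64, M, _,
    hψ.isPush, by norm_num, by norm_num, by norm_num, by norm_num, hT, hdisj, ?_, hk, hH1, hH2, ?_,
    by rw [hQ], ?_, h4, ?_, ?_, h3⟩
  · rw [hψ.iUnion_image_arc (by norm_num) (by norm_num)]
    refine (disjoint_arc (a := p') (b := d) (by norm_num) (by norm_num)).symm.mono_right ?_
    exact union_subset ((arcSequence_subset hqt' (by norm_num)).trans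
      (arc_mono le_rfl (by norm_num))) (arc_mono (by norm_num) le_rfl)
  · rintro φ (rfl | rfl | rfl | rfl | rfl)
    exacts [hTp, hTm, hH.hasRotationNumber F1, hψ.hasRotationNumber, hk0]
  · refine isMinimalSet_of_reaches ⟨_, hI (coe_mem_arc ⟨le_rfl, htd.le⟩)⟩
      (hMP ▸ (isClosed_arcSequence hqt).union isClosed_arc) ?_ ?_
    · have hTM := hT.image_subset hP0 (by
        have := hMW 0
        simp only [halving_zero] at this
        exact (inter_subset_inter_right _ openArc_subset_arc).trans this)
      rintro φ (rfl | rfl | rfl | rfl | rfl)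
      · exact hTM.1
      · exact hTM.2
      · have hsplit : M ⊆ arc p q ∪ ((⋃ n : ℕ, ψ^[n + 1] '' arc p q) ∪ arc t d) := by
          rintro x (hx | hx)
          · obtain ⟨n, hn⟩ := mem_iUnion.1 (hQ ▸ hx)
            cases n with
            | zero => exact .inl (by simpa using hn)
            | succ n => exact .inr (.inl (mem_iUnion.2 ⟨n, hn⟩))
          · exact .inr (.inr hx)
        refine (image_mono hsplit).trans ?_
        rw [image_union, hH1]
        refine union_subset hI (hH2.trans ?_)
        rw [hψ.image_arc_one (by norm_num) (by norm_num)]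
        exact hseq 1
      · rw [hMdef, image_union]
        refine union_subset_union hψM ?_
        rintro _ ⟨x, hx, rfl⟩
        -- The extra interval meets the support of the push only at its endpoint `t`, which is
        -- fixed.
        rwa [eq_self_of_notMem_openArc (by norm_num) hψ.isPush.eq_self]
        exact fun hxs => disjoint_left.1 (disjoint_openArc_arc le_rfl (by norm_num)) hxs hx
      · rintro _ ⟨x, hx, rfl⟩
        exact hP0 (hkM x hx)
    · intro x hx y hy
      have hz := hkM x hx
      have hT0 : ∀ w ∈ arc p q, Reaches {Tp, Tm, H, ψ, k} x w := fun w hw =>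
        (reaches_of_mem (φ := k) (by simp)).trans
          ((hT.reaches (by norm_num) hz hw).mono (by simp [insert_subset_iff]))
      rcases hy with hy | hy
      · obtain ⟨n, w, hw, rfl⟩ := mem_iUnion.1 (hQ ▸ hy)
        exact (hT0 w hw).iterate (by simp) n
      · obtain ⟨w, hw, rfl⟩ := hH1.symm.subset hy
        exact (hT0 w hw).apply (mem_IFS_of_mem (by simp))
  · have hmem : ∀ n, (halving t p n : UnitAddCircle) ∈ arc (halving t p n) (halving t q n) :=
      fun n => coe_mem_arc ⟨le_rfl, (hpq n).le⟩
    have hsub : ∀ n, connectedComponentIn M (halving t p n) ⊆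
        arc (halving t p n) (halving t q n) := fun n =>
      connectedComponentIn_subset_of_isClosed (V := openArc (halving t p' n) (halving t q' n))
        isOpen_openArc isClosed_arc ((inter_subset_inter_right _ openArc_subset_arc).trans (hMW n))
        (arc_subset_openArc (hpp n) (hqq n)) (hmem n)
    refine infinite_of_injective_forall_mem (f := fun n => connectedComponentIn M (halving t p n))
      (fun n k hnk => ?_) (fun n => ⟨_, hseq n (hmem n), rfl⟩)
    by_contra hne
    have h1 : (halving t p n : UnitAddCircle) ∈ connectedComponentIn M (halving t p n) :=
      mem_connectedComponentIn (hseq n (hmem n))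
    refine disjoint_left.1 (disjoint_halving_arcs (p := p) (q' := q) (t := t) (by norm_num)
      (by norm_num) (by norm_num) (by norm_num) hne) (hsub n h1) (hsub k ?_)
    exact (show connectedComponentIn M (halving t p n) = connectedComponentIn M (halving t p k)
      from hnk) ▸ h1
  · rintro C ⟨x, hx | hx, rfl⟩
    · obtain ⟨n, hn⟩ := mem_iUnion.1 hx
      exact nontrivial_component (hpq n) (hlen n) (hseq n) hn
    · exact nontrivial_component htd hdt hI hx

/-- Half of the circle is cut into `k` cells, whose middle thirds form `M`. Each cell has its own
`T⁺, T⁻` and its own auxiliary map throwing `M` into its middle third, so a target interval is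
reached in one throw. -/
theorem exists_intervals_finite (k : ℕ) (hk : 1 ≤ k) :
      ∃ (G : Set (UnitAddCircle ≃ₜ UnitAddCircle)) (M N : Set UnitAddCircle),
        G.Finite ∧ (∀ φ ∈ G, HasRotationNumber φ 0) ∧ IsMinimalSet G M ∧
        IsDecomposition M ∅ N ∧ M ≠ univ ∧
        (components M).Finite ∧ (components M).ncard = k ∧
        (∀ C ∈ components M, C.Nontrivial) ∧ componentBoundary M = N := by
  have hk0 : (1 : ℝ) ≤ k := by exact_mod_cast hk
  -- With this `w` the `k` cells of length `3 * w` fill exactly `[0, 1/2]`, which leaves room for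
  -- `J` in the other half.
  set w : ℝ := 1 / (6 * k) with hw
  have hw0 : 0 < w := by positivity
  have hwk : 3 * k * w = 1 / 2 := by
    rw [hw]
    field_simp
    norm_num
  have hik : ∀ i : Fin k, (3 * (i : ℕ) + 3 : ℝ) * w ≤ 1 / 2 := by
    intro i
    have : ((i : ℕ) : ℝ) + 1 ≤ k := by exact_mod_cast i.2
    rw [← hwk]
    exact mul_le_mul_of_nonneg_right (by linarith) hw0.le
  have hi0 : ∀ i : Fin k, (0 : ℝ) ≤ 3 * (i : ℕ) * w := fun i => by positivity
  let l : Fin k → ℝ := fun i => 3 * (i : ℕ) * w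
  have hl0 : ∀ i, 0 ≤ l i := hi0
  have hl1 : ∀ i, l i + 3 * w ≤ 1 / 2 := fun i => by linarith [hik i]
  have hll : ∀ i j, i < j → l i + 3 * w ≤ l j := by
    intro i j hij
    have : ((i : ℕ) : ℝ) + 1 ≤ (j : ℕ) := by exact_mod_cast hij
    have := mul_le_mul_of_nonneg_right this (show 0 ≤ 3 * w by positivity)
    simp only [l]
    linarith
  choose Tp Tm hT hTp hTm using fun i : Fin k => exists_isTPair (a' := l i) (a := l i + w)
    (b := l i + 2 * w) (b' := l i + 3 * w) (by linarith) (by linarith) (by linarith)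
    (by linarith [hl0 i, hl1 i])
  choose h hh hh0 using fun i : Fin k => exists_isAuxMap (u := 9 / 16) (v := 12 / 16)
    (u' := 10 / 16) (v' := 11 / 16) (p := l i + w) (q := l i + 2 * w) (by norm_num) (by norm_num)
    (by norm_num) (by linarith) (by linarith [hl1 i]) (by linarith [hl0 i])
  set G : Set (UnitAddCircle ≃ₜ UnitAddCircle) := ⋃ i, {h i, Tp i, Tm i}
  set B : Fin k → Set UnitAddCircle := fun i => arc (l i + w) (l i + 2 * w) with hB
  set M : Set UnitAddCircle := ⋃ i, B i
  have hBM : ∀ i, B i ⊆ M := subset_iUnion B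
  have hMhalf : M ⊆ arc 0 (1 / 2) := iUnion_subset fun i =>
    arc_mono (by linarith [hl0 i]) (by linarith [hl1 i])
  have hMW : ∀ i, M ∩ openArc (l i) (l i + 3 * w) ⊆ B i := by
    rintro i x ⟨hx, hxi⟩
    obtain ⟨j, hj⟩ := mem_iUnion.1 hx
    rcases lt_trichotomy i j with hij | rfl | hij
    · refine absurd hj (disjoint_left.1 (disjoint_openArc_arc ?_ ?_) hxi) <;>
      linarith [hll i j hij, hl1 j, hl0 i]
    · exact hj
    · simp only [hB] at hj
      rw [← arc_add_one] at hj
      refine absurd hj (disjoint_left.1 (disjoint_openArc_arc ?_ ?_) hxi) <;>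
      linarith [hll j i hij, hl1 i, hl0 j]
  have hBW : ∀ i, B i ⊆ openArc (l i) (l i + 3 * w) := fun i =>
    arc_subset_openArc (by linarith) (by linarith)
  have hlt : ∀ i, l i + w < l i + 2 * w := fun i => by linarith
  have hper : ∀ i, l i + 2 * w < l i + w + 1 := fun i => by linarith [hl0 i, hl1 i]
  have hcl : ∀ i, closure (openArc (l i + w) (l i + 2 * w)) = B i := fun i =>
    closure_openArc (hlt i)
  have hkM : ∀ i, ∀ x ∈ M, h i x ∈ B i := fun i x hx =>
    (hh i).apply_mem (disjoint_arc (by norm_num) (by norm_num)).symm (hMhalf hx)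
  have hmem : ∀ i, ((l i + w : ℝ) : UnitAddCircle) ∈ B i := fun i =>
    coe_mem_arc ⟨le_rfl, (hlt i).le⟩
  have hcomp : ∀ i, ∀ x ∈ B i, connectedComponentIn M x = B i := fun i x hx =>
    subset_antisymm (connectedComponentIn_subset_of_isClosed isOpen_openArc isClosed_arc (hMW i)
      (hBW i) hx) ((isConnected_arc (hlt i).le).isPreconnected.subset_connectedComponentIn hx
      (hBM i))
  have hcomps : components M = range B := by
    ext C
    constructor
    · rintro ⟨x, hx, rfl⟩
      obtain ⟨i, hi⟩ := mem_iUnion.1 hx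
      exact ⟨i, (hcomp i x hi).symm⟩
    · rintro ⟨i, rfl⟩
      exact ⟨_, hBM i (hmem i), (hcomp i _ (hmem i)).symm⟩
  have hinj : Function.Injective B := by
    intro i j hij
    have h1 := hmem i
    have h2 := hmem j
    rw [← hij] at h2
    rw [hij] at h1
    have := hl0 i
    have := hl0 j
    have := hl1 i
    have := hl1 j
    rw [hB, coe_mem_arc_iff (by linarith) (by linarith)] at h1 h2
    rcases lt_trichotomy i j with hij | rfl | hij
    · linarith [hll i j hij, h1.1]
    · rfl
    · linarith [hll j i hij, h2.1]
  obtain ⟨-, -, h3, h4⟩ := isDecomposition_iUnion (M := M) (K := ∅) (R := ∅)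
    (V := fun i => openArc (l i + w) (l i + 2 * w))
    (by rw [union_empty, union_empty, iUnion_congr hcl]) (fun i => isOpen_openArc)
    (fun i => isConnected_openArc (hlt i))
    (fun i => countable_frontier_openArc (hlt i) (hper i).le)
    (fun i => closure_openArc_inter_interior_subset (a' := l i) (b' := l i + 3 * w) (by linarith)
      (hlt i) (by linarith) (hper i) (hMW i))
    (.inl rfl) (empty_disjoint _) (empty_disjoint _) countable_empty (fun _ => empty_disjoint _)
    (empty_disjoint _)
  rw [union_empty] at h4
  refine ⟨G, M, _, finite_iUnion fun i => by simp, ?_, ?_, h4, ?_, ?_, ?_, ?_, h3⟩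
  · intro φ hφ
    obtain ⟨i, rfl | rfl | rfl⟩ := mem_iUnion.1 hφ
    exacts [hh0 i, hTp i, hTm i]
  · refine isMinimalSet_of_reaches ⟨_, hBM ⟨0, hk⟩ (hmem ⟨0, hk⟩)⟩
      (isClosed_iUnion_of_finite fun i => isClosed_arc) ?_ ?_
    · intro φ hφ
      obtain ⟨i, rfl | rfl | rfl⟩ := mem_iUnion.1 hφ
      · rintro _ ⟨x, hx, rfl⟩
        exact hBM i (hkM i x hx)
      · exact ((hT i).image_subset (hBM i) (hMW i)).1
      · exact ((hT i).image_subset (hBM i) (hMW i)).2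
    · intro x hx y hy
      obtain ⟨i, hi⟩ := mem_iUnion.1 hy
      have hsub : ({h i, Tp i, Tm i} : Set (UnitAddCircle ≃ₜ UnitAddCircle)) ⊆ G :=
        subset_iUnion (fun i => ({h i, Tp i, Tm i} : Set (UnitAddCircle ≃ₜ UnitAddCircle))) i
      refine (reaches_of_mem (φ := h i) (hsub (by simp))).trans
        (((hT i).reaches ?_ (hkM i x hx) hi).mono (subset_trans (by simp) hsub))
      linarith [hl0 i, hl1 i]
  · intro hu
    have : ((3 / 4 : ℝ) : UnitAddCircle) ∈ M := hu ▸ mem_univ _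
    have := hMhalf this
    rw [coe_mem_arc_iff (by norm_num) (by norm_num)] at this
    norm_num at this
  · rw [hcomps]
    exact finite_range B
  · rw [hcomps, ← image_univ, ncard_image_of_injective _ hinj, ncard_univ, Nat.card_fin]
  · rintro C ⟨x, hx, rfl⟩
    obtain ⟨i, hi⟩ := mem_iUnion.1 hx
    exact nontrivial_component (hlt i) (hper i) (hBM i) hi

/-! ### Infinitely many intervals and one isolated type of limit point -/

theorem exists_intervals_point :
    ∃ (ψ h Tp Tm : UnitAddCircle ≃ₜ UnitAddCircle) (p q p' q' u' v' u v : ℝ)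
        (M N : Set UnitAddCircle),
      IsPush ψ 0 1 ∧ 0 < p' ∧ q' < 1 ∧ IsTPair Tp Tm p q p' q' ∧
      Disjoint (arc p' q') (ψ '' arc p' q') ∧
      (∀ n : ℕ, Disjoint (arc u v) (ψ^[n] '' arc p' q')) ∧
      IsAuxMap h u' v' u v (arc p q) ∧
      (∀ φ ∈ ({ψ, h, Tp, Tm} : Set (UnitAddCircle ≃ₜ UnitAddCircle)),
        HasRotationNumber φ 0) ∧
      M = {0} ∪ ⋃ n : ℕ, ψ^[n] '' arc p q ∧
      IsMinimalSet {ψ, h, Tp, Tm} M ∧ IsDecomposition M ∅ N ∧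
      (components (interior M)).Infinite ∧ N = componentBoundary M ∪ {0} ∧
      (0 : UnitAddCircle) ∉ componentBoundary M := by
  obtain ⟨Tp, Tm, hT, hTp, hTm⟩ := exists_isTPair (a' := 16 / 32) (a := 17 / 32) (b := 19 / 32)
    (b' := 20 / 32) (by norm_num) (by norm_num) (by norm_num) (by norm_num)
  obtain ⟨k, hk, hk0⟩ := exists_isAuxMap (u := 42 / 64) (v := 45 / 64) (u' := 43 / 64)
    (v' := 44 / 64) (p := 17 / 32) (q := 19 / 32) (by norm_num) (by norm_num) (by norm_num)
    (by norm_num) (by norm_num) (by norm_num)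
  obtain ⟨ψ, hψ⟩ := exists_isHalvingPush (s := 0) (m := 16 / 32) (t := 1)
    (by norm_num) (by norm_num) (by norm_num)
  set p : ℝ := 17 / 32
  set q : ℝ := 19 / 32
  set p' : ℝ := 16 / 32
  set q' : ℝ := 20 / 32
  have h10 : ((1 : ℝ) : UnitAddCircle) = 0 := AddCircle.coe_period 1
  have hpt : p < 1 := by norm_num
  have hqt : q < 1 := by norm_num
  have hqt' : q' < 1 := by norm_num
  have hp0 : 0 < p := by norm_num
  have hpq : ∀ n, halving 1 p n < halving 1 q n := fun n => halving_lt_halving (by norm_num)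
  have hpp : ∀ n, halving 1 p' n < halving 1 p n := fun n => halving_lt_halving (by norm_num)
  have hqq : ∀ n, halving 1 q n < halving 1 q' n := fun n => halving_lt_halving (by norm_num)
  have hlen : ∀ n, halving 1 q n < halving 1 p n + 1 := fun n => by
    linarith [halving_lt (n := n) hqt, le_halving (n := n) hpt.le]
  have hQ : ⋃ n : ℕ, ψ^[n] '' arc p q = arcSequence 1 p q :=
    hψ.iUnion_image_arc (by norm_num) (by norm_num)
  set M : Set UnitAddCircle := arcSequence 1 p q ∪ {((1 : ℝ) : UnitAddCircle)} with hMdef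
  have hseq : ∀ n, arc (halving 1 p n) (halving 1 q n) ⊆ M := fun n =>
    (subset_iUnion (fun n => arc (halving 1 p n) (halving 1 q n)) n).trans subset_union_left
  have hP0 : arc p q ⊆ M := by
    simpa using hseq 0
  have hMW : ∀ n, M ∩ arc (halving 1 p' n) (halving 1 q' n) ⊆
      arc (halving 1 p n) (halving 1 q n) :=
    arcSequence_inter_subset (by norm_num) (by norm_num) (by norm_num) (by norm_num)
      (by norm_num) (by norm_num)
  -- The arc `J` lies between `I = [40/64, 48/64 - 8/64]` and `ψ(I)`, which starts at `48 / 64`;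
  -- later iterates lie further to the right.
  have hJ : ∀ n : ℕ, Disjoint (arc (42 / 64) (45 / 64)) (ψ^[n] '' arc p' q') := by
    intro n
    rw [hψ.image_arc (by norm_num) (by norm_num)]
    cases n with
    | zero =>
      rw [halving_zero, halving_zero]
      exact (disjoint_arc (by norm_num) (by norm_num)).symm
    | succ n =>
      have h1 : halving 1 p' 1 ≤ halving 1 p' (n + 1) := halving_mono (by norm_num) (by omega)
      have h2 : halving 1 p' 1 = 3 / 4 := by norm_num [halving]
      exact disjoint_arc (lt_of_lt_of_le (by norm_num) (h2 ▸ h1))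
        ((halving_lt hqt').trans (by norm_num))
  have hJM : Disjoint (arc (42 / 64) (45 / 64)) M := by
    rw [hMdef, disjoint_union_right, arcSequence, disjoint_iUnion_right, disjoint_singleton_right]
    refine ⟨fun n => (hJ n).mono_right ?_, ?_⟩
    · rw [hψ.image_arc (by norm_num) (by norm_num)]
      exact arc_mono (hpp n).le (hqq n).le
    · rw [coe_mem_arc_iff (by norm_num) (by norm_num)]
      norm_num
  have hkM : ∀ x ∈ M, k x ∈ arc p q := fun x hx => hk.apply_mem hJM hx
  have htM : ((1 : ℝ) : UnitAddCircle) ∉ interior M := notMem_interior_of_tendsto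
    (halving_notMem_arcSequence (p' := p') (p := p) (q := q) (by norm_num) (by norm_num)
      (by norm_num) (by norm_num) (by norm_num) (by norm_num)) (tendsto_coe_halving 1 q')
  have hVcl : ∀ n, closure (openArc (halving 1 p n) (halving 1 q n)) =
      arc (halving 1 p n) (halving 1 q n) := fun n => closure_openArc (hpq n)
  obtain ⟨-, h2, h3, h4⟩ := isDecomposition_iUnion (M := M) (K := ∅)
    (R := {((1 : ℝ) : UnitAddCircle)})
    (V := fun n => openArc (halving 1 p n) (halving 1 q n))
    (by rw [empty_union, iUnion_congr hVcl]; rfl) (fun _ => isOpen_openArc)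
    (fun n => isConnected_openArc (hpq n))
    (fun n => countable_frontier_openArc (hpq n) (hlen n).le)
    (fun n => closure_openArc_inter_interior_subset (hpp n) (hpq n) (hqq n) (hlen n)
          ((inter_subset_inter_right _ openArc_subset_arc).trans (hMW n)))
    (.inl rfl) (empty_disjoint _) (disjoint_singleton_left.2 htM) (countable_singleton _)
    (fun _ => empty_disjoint _) (empty_disjoint _)
  refine ⟨ψ, k, Tp, Tm, p, q, p', q', 43 / 64, 44 / 64, 42 / 64, 45 / 64, M, _, hψ.isPush,
    by norm_num, by norm_num, hT, ?_, hJ, hk, ?_, ?_, ?_, h4, ?_, ?_, ?_⟩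
  · rw [hψ.image_arc_one (by norm_num) (by norm_num)]
    have := disjoint_halving_arcs (p := p') (q' := q') (t := 1) (by norm_num) (by norm_num)
      (by norm_num) (by norm_num) (n := 0) (k := 1) (by omega)
    rwa [halving_zero, halving_zero] at this
  · rintro φ (rfl | rfl | rfl | rfl)
    exacts [hψ.hasRotationNumber, hk0, hTp, hTm]
  · rw [hQ, hMdef, h10, union_comm]
  · refine isMinimalSet_of_reaches ⟨_, .inr rfl⟩ (isClosed_arcSequence hqt) ?_ ?_
    · have hTM := hT.image_subset hP0 (by
        have := hMW 0
        simp only [halving_zero] at this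
        exact (inter_subset_inter_right _ openArc_subset_arc).trans this)
      rintro φ (rfl | rfl | rfl | rfl)
      · rintro _ ⟨x, hx | rfl, rfl⟩
        · obtain ⟨n, w, hw, rfl⟩ := mem_iUnion.1 (hQ ▸ hx)
          exact .inl (hQ ▸ mem_iUnion.2 ⟨n + 1, w, hw, Function.iterate_succ_apply' _ _ _⟩)
        · exact .inr (hψ.apply_right (by norm_num))
      · rintro _ ⟨x, hx, rfl⟩
        exact hP0 (hkM x hx)
      · exact hTM.1
      · exact hTM.2
    · intro x hx y hy
      have hT0 : ∀ w ∈ arc p q, ∀ n, Reaches {ψ, k, Tp, Tm} x (ψ^[n] w) := fun w hw n =>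
        ((reaches_of_mem (φ := k) (by simp)).trans ((hT.reaches (by norm_num) (hkM x hx) hw).mono
          (by simp [insert_subset_iff]))).iterate (by simp) n
      rcases hy with hy | rfl
      · obtain ⟨n, w, hw, rfl⟩ := mem_iUnion.1 (hQ ▸ hy)
        exact hT0 w hw n
      · refine reaches_of_tendsto (fun n => ?_) (tendsto_coe_halving 1 p)
        rw [← hψ.iterate_apply (by norm_num)]
        exact hT0 _ (coe_mem_arc (by norm_num)) n
  · rw [h2]
    refine infinite_range_of_injective fun n k hnk => ?_
    by_contra hne
    obtain ⟨x, hx⟩ := (isConnected_openArc (hpq n)).nonempty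
    refine disjoint_left.1 (disjoint_halving_arcs (p := p) (q' := q) (t := 1) (by norm_num)
      (by norm_num) (by norm_num) (by norm_num) hne) (openArc_subset_arc hx) (openArc_subset_arc ?_)
    exact (show openArc (halving 1 p n) (halving 1 q n) = openArc (halving 1 p k) (halving 1 q k)
      from hnk) ▸ hx
  · rw [h3, h10]
  · rw [h3, ← h10, mem_iUnion]
    rintro ⟨n, hn⟩
    have hn' := frontier_subset_closure hn
    have h5 := halving_lt (n := n) hqt
    have h6 := le_halving (n := n) hpt.le
    rw [hVcl, coe_mem_arc_iff (by linarith) (by linarith)] at hn'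
    linarith [hn'.2]

/-! ### Symmetric Cantorvals -/

theorem mul_image (f g : UnitAddCircle ≃ₜ UnitAddCircle) (S : Set UnitAddCircle) :
    (f * g : UnitAddCircle ≃ₜ UnitAddCircle) '' S = f '' (g '' S) := (image_image f g S).symm

theorem IsCantorSet.image {K : Set UnitAddCircle} (h : IsCantorSet K)
    (φ : UnitAddCircle ≃ₜ UnitAddCircle) : IsCantorSet (φ '' K) := by
  refine ⟨h.1.image φ, ⟨φ.isClosedMap _ h.2.1.closed, preperfect_iff_nhds.2 ?_⟩,
    φ.isEmbedding.isTotallyDisconnected_image.2 h.2.2⟩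
  rintro _ ⟨x, hx, rfl⟩ U hU
  obtain ⟨y, ⟨hyU, hyK⟩, hyx⟩ :=
    preperfect_iff_nhds.1 h.2.1.acc x hx _ (φ.continuous.continuousAt.preimage_mem_nhds hU)
  exact ⟨φ y, ⟨hyU, y, hyK, rfl⟩, fun he => hyx (φ.injective he)⟩

/-- Total disconnectedness is inherited from the common superset `K`, which avoids an argument for
general unions. -/
theorem IsCantorSet.union_of_subset {K K₁ K₂ : Set UnitAddCircle} (h : IsTotallyDisconnected K)
    (h₁ : IsCantorSet K₁) (h₂ : IsCantorSet K₂) (hs₁ : K₁ ⊆ K) (hs₂ : K₂ ⊆ K) :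
    IsCantorSet (K₁ ∪ K₂) := by
  refine ⟨h₁.1.mono subset_union_left, ⟨h₁.2.1.closed.union h₂.2.1.closed, ?_⟩,
    fun t ht => h t (ht.trans (union_subset hs₁ hs₂))⟩
  rintro x (hx | hx)
  · exact (h₁.2.1.acc x hx).mono (principal_mono.2 subset_union_left)
  · exact (h₂.2.1.acc x hx).mono (principal_mono.2 subset_union_right)

namespace IsContractingSystem

variable {G : Set (UnitAddCircle ≃ₜ UnitAddCircle)} {A P : Set UnitAddCircle}
  {f g φ T : UnitAddCircle ≃ₜ UnitAddCircle} {x y : UnitAddCircle}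

theorem filledSet_inter_image (h : IsContractingSystem G A) (hP : P ⊆ A)
    (hd : ∀ f ∈ G, Disjoint P (f '' A)) (hφ : φ ∈ IFS G) :
    filledSet G A P ∩ φ '' A = φ '' filledSet G A P := by
  refine subset_antisymm ?_ (subset_inter (h.image_filledSet_subset hφ)
    (image_mono (h.filledSet_subset hP)))
  rintro _ ⟨hx, x, hxA, rfl⟩
  exact ⟨x, h.mem_filledSet_of_apply hP hd hφ hxA hx, rfl⟩

/-- A map which undoes the second letter of a word `f g` carries images of a gap inside the image
of `A` under that word to images of the gap. -/
theorem image_gap_mem (h : IsContractingSystem G A) (hPA : P ⊆ A) (hPne : P.Nonempty)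
    (hd : ∀ f ∈ G, Disjoint P (f '' A)) (hf : f ∈ G) (hg : g ∈ G)
    (hT : ∀ x ∈ A, T (f (g x)) = f x) {C : Set UnitAddCircle}
    (hC : C ∈ {C | ∃ φ ∈ IFS G, C = φ '' P}) (hCsub : C ⊆ f '' (g '' A)) :
    T '' C ∈ {C | ∃ φ ∈ IFS G, C = φ '' P} := by
  obtain ⟨φ, hφ, rfl⟩ := hC
  obtain ⟨x, hx⟩ := hPne
  obtain ⟨_, ⟨y, hy, rfl⟩, hyx⟩ := hCsub ⟨x, hx, rfl⟩
  have hgA : ∀ k ∈ G, ∀ z ∈ A, k z ∈ A := fun k hk z hz => h.maps k hk ⟨z, hz, rfl⟩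
  have hTim : ∀ S ⊆ A, T '' (f '' (g '' S)) = f '' S := by
    intro S hS
    rw [image_image, image_image]
    exact image_congr fun z hz => hT z (hS hz)
  -- The word of `C` must begin with the letters `f g`. It cannot be the single letter `f`, since
  -- `P` avoids `g(A)`; after that, deleting `g` gives the word of the image.
  rcases mem_IFS_cases hφ with hφG | ⟨k, hk, ψ, hψ, rfl⟩
  · obtain ⟨-, hxy⟩ := h.eq_of_apply_mem hφG hf (hPA hx) (hgA g hg y hy) hyx.symm
    exact absurd ⟨y, hy, hxy.symm⟩ (disjoint_left.1 (hd g hg) hx)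
  · have hψA := image_subset_of_mem_IFS h.maps hψ
    obtain ⟨rfl, hxy⟩ := h.eq_of_apply_mem hk hf (hψA ⟨x, hPA hx, rfl⟩) (hgA g hg y hy) hyx.symm
    rcases mem_IFS_cases hψ with hψG | ⟨l, hl, χ, hχ, rfl⟩
    · obtain ⟨rfl, -⟩ := h.eq_of_apply_mem hψG hg (hPA hx) hy hxy
      exact ⟨k, mem_IFS_of_mem hk, by rw [mul_image, hTim P hPA]⟩
    · have hχA := image_subset_of_mem_IFS h.maps hχ
      obtain ⟨rfl, -⟩ := h.eq_of_apply_mem hl hg (hχA ⟨x, hPA hx, rfl⟩) hy hxy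
      refine ⟨k * χ, mul_mem (mem_IFS_of_mem hk) hχ, ?_⟩
      rw [mul_image, mul_image, hTim _ ((image_mono hPA).trans hχA), mul_image]

theorem dist_le_of_mem_IFS (h : IsContractingSystem G A) (hφ : φ ∈ IFS G) (hx : x ∈ A)
    (hy : y ∈ A) : dist (φ x) (φ y) ≤ dist x y := by
  obtain ⟨r, hr0, hr, hcon⟩ := h.contract
  induction hφ using Subsemigroup.closure_induction generalizing x y with
  | mem f hf =>
    exact (hcon f hf x hx y hy).trans (mul_le_of_le_one_left dist_nonneg hr.le)
  | mul f g hf hg ihf ihg =>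
    have hgA := image_subset_of_mem_IFS h.maps hg
    exact (ihf (hgA ⟨x, hx, rfl⟩) (hgA ⟨y, hy, rfl⟩)).trans (ihg hx hy)

theorem mul_pow_mem_IFS (hφ : φ ∈ IFS G) (hg : g ∈ G) (n : ℕ) : φ * g ^ n ∈ IFS G := by
  induction n with
  | zero => simpa using hφ
  | succ n ih =>
    rw [pow_succ, ← mul_assoc]
    exact mul_mem ih (mem_IFS_of_mem hg)

/-- If the fixed point `x` of a generator lies in an open connected set `V` whose boundary points
are not in the filled set, then all images of `x` are components of the filled set. -/
theorem singleton_mem_components (h : IsContractingSystem G A) (hP : P ⊆ A)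
    (hd : ∀ f ∈ G, Disjoint P (f '' A)) (hg : g ∈ G) (hgx : g x = x) {V : Set UnitAddCircle}
    (hV : IsOpen V) (hxV : x ∈ V) (hVA : closure V ⊆ A)
    (hfr : Disjoint (closure V \ V) (filledSet G A P)) (hφ : φ ∈ IFS G) :
    {φ x} ∈ components (filledSet G A P) := by
  have hxA : x ∈ A := hVA (subset_closure hxV)
  have hxK := mem_limitSet_of_fixed hg hxA hgx
  have hin : ∀ ψ ∈ IFS G, ψ x ∈ filledSet G A P := fun ψ hψ =>
    h.image_filledSet_subset hψ ⟨x, limitSet_subset_filledSet hxK, rfl⟩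
  -- By peeling, the boundary points of `ψ(V)` are missing from the filled set, so the component
  -- cannot leave `ψ(V)`.
  have hcomp : ∀ ψ ∈ IFS G, connectedComponentIn (filledSet G A P) (ψ x) ⊆ ψ '' A := by
    intro ψ hψ
    refine subset_trans ?_ (image_mono (subset_closure.trans hVA))
    refine isPreconnected_connectedComponentIn.subset_of_closure_inter_subset (ψ.isOpenMap _ hV)
      ⟨ψ x, mem_connectedComponentIn (hin ψ hψ), x, hxV, rfl⟩ ?_
    rintro y ⟨hy, hyC⟩
    rw [← ψ.image_closure] at hy
    obtain ⟨w, hw, rfl⟩ := hy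
    refine ⟨w, ?_, rfl⟩
    by_contra hwV
    exact disjoint_left.1 hfr ⟨hw, hwV⟩
      (h.mem_filledSet_of_apply hP hd hψ (hVA hw) (connectedComponentIn_subset _ _ hyC))
  refine ⟨φ x, hin φ hφ, (subset_antisymm ?_ (singleton_subset_iff.2
    (mem_connectedComponentIn (hin φ hφ)))).symm⟩
  intro y hy
  obtain ⟨r, hr0, hr, hcon⟩ := h.contract
  obtain ⟨D, hD⟩ := Metric.isBounded_iff.1 h.isBounded
  have hpx : ∀ n : ℕ, (g ^ n) x = x := by
    intro n
    induction n with
    | zero => rfl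
    | succ n ih =>
      rw [pow_succ']
      change g ((g ^ n) x) = x
      rw [ih, hgx]
  have hpow : ∀ n : ℕ, ∀ w ∈ A, (g ^ n) w ∈ A ∧ dist ((g ^ n) w) x ≤ r ^ n * D := by
    intro n w hw
    induction n with
    | zero => exact ⟨hw, by simpa using hD hw hxA⟩
    | succ n ih =>
      rw [pow_succ']
      change g ((g ^ n) w) ∈ A ∧ dist (g ((g ^ n) w)) x ≤ _
      refine ⟨h.maps g hg ⟨_, ih.1, rfl⟩, ?_⟩
      calc dist (g ((g ^ n) w)) x = dist (g ((g ^ n) w)) (g x) := by rw [hgx]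
        _ ≤ r * dist ((g ^ n) w) x := hcon g hg _ ih.1 _ hxA
        _ ≤ r * (r ^ n * D) := mul_le_mul_of_nonneg_left ih.2 hr0
        _ = r ^ (n + 1) * D := by ring
  have hlim : Tendsto (fun n : ℕ => r ^ n * D) atTop (𝓝 0) := by
    simpa using (tendsto_pow_atTop_nhds_zero_of_lt_one hr0 hr).mul_const D
  refine dist_le_zero.1 (ge_of_tendsto' hlim fun n => ?_)
  -- Since `g` fixes `x`, the words `φ gⁿ` all send `x` to `φ x`; the component lies in each of the
  -- images of `A` under them, and these shrink to a point.
  have hmem := mul_pow_mem_IFS hφ hg n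
  have e : (φ * g ^ n) x = φ x := by
    change φ ((g ^ n) x) = φ x
    rw [hpx]
  obtain ⟨w, hw, rfl⟩ := hcomp _ hmem (by rwa [e])
  exact (h.dist_le_of_mem_IFS hφ (hpow n w hw).1 hxA).trans (hpow n w hw).2

end IsContractingSystem

/-- A point of `M` off `K` is interior to its component, so `e` lies in `K` and is a limit of points
of `S`. None of these equals `e`, because the component of `e` is nontrivial. -/
theorem accPt_of_mem_frontier_component {M K S : Set UnitAddCircle} (hM : IsClosed M)
    (hMK : ∀ x ∈ M, x ∉ K → ∃ U, IsOpen U ∧ IsPreconnected U ∧ x ∈ U ∧ U ⊆ M)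
    (hKS : K ⊆ closure S) (hS : ∀ y ∈ S, {y} ∈ components M) {C : Set UnitAddCircle}
    (hC : C ∈ components M) (hCn : C.Nontrivial) {e : UnitAddCircle} (he : e ∈ frontier C) :
    AccPt e (𝓟 {y | {y} ∈ components M}) := by
  obtain ⟨x, hx, rfl⟩ := hC
  have hcl : closure (connectedComponentIn M x) ⊆ connectedComponentIn M x :=
    isPreconnected_connectedComponentIn.closure.subset_connectedComponentIn
      (subset_closure (mem_connectedComponentIn hx))
      (closure_minimal (connectedComponentIn_subset M x) hM)
  have heC := hcl (frontier_subset_closure he)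
  have heq := connectedComponentIn_eq heC
  have heM := connectedComponentIn_subset _ _ heC
  have heK : e ∈ K := by
    by_contra heK
    obtain ⟨U, hU, hUc, heU, hUM⟩ := hMK e heM heK
    have hsub := hUc.subset_connectedComponentIn heU hUM
    rw [← heq] at hsub
    exact he.2 (interior_maximal hsub hU heU)
  have heS : ∀ y ∈ S, y ≠ e := by
    rintro y hy rfl
    obtain ⟨z, hz, hzy⟩ := hS y hy
    have h1 : y ∈ connectedComponentIn M z := hzy ▸ mem_singleton y
    rw [connectedComponentIn_eq h1, ← heq] at hzy
    rw [← hzy] at hCn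
    exact not_nontrivial_singleton hCn
  rw [accPt_iff_nhds]
  intro U hU
  obtain ⟨y, hyU, hyS⟩ := mem_closure_iff_nhds.1 (hKS heK) U hU
  exact ⟨y, ⟨hyU, hS y hyS⟩, heS y hyS⟩

/-! ### Limit sets with filled gaps -/

namespace IsContractingSystem

variable {G : Set (UnitAddCircle ≃ₜ UnitAddCircle)} {A P : Set UnitAddCircle}
  {φ : UnitAddCircle ≃ₜ UnitAddCircle} {y : UnitAddCircle}

/-- The endpoints of the gap are already in the limit set. Thus the closed arc can be used for
closedness and the open one for the interior. -/
theorem filledSet_closure (h : IsContractingSystem G A) (hP : frontier P ⊆ limitSet G A) :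
    filledSet G A (closure P) = filledSet G A P := by
  have hcl : closure P ⊆ filledSet G A P := by
    rw [closure_eq_self_union_frontier]
    exact union_subset subset_filledSet (hP.trans limitSet_subset_filledSet)
  refine subset_antisymm (union_subset (union_subset limitSet_subset_filledSet
    (iUnion₂_subset fun φ hφ => (image_mono hcl).trans (h.image_filledSet_subset hφ))) hcl) ?_
  exact union_subset_union (union_subset_union subset_rfl
    (iUnion₂_mono fun φ _ => image_mono subset_closure)) subset_closure

theorem filledSet_eq_union_iUnion :
    filledSet G A P = limitSet G A ∪ ⋃ i : {φ // φ = 1 ∨ φ ∈ IFS G}, i.1 '' P := by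
  refine subset_antisymm (union_subset (union_subset subset_union_left ?_) ?_)
    (union_subset limitSet_subset_filledSet (iUnion_subset ?_))
  · exact iUnion₂_subset fun φ hφ =>
      (subset_iUnion (fun i : {φ // φ = 1 ∨ φ ∈ IFS G} => i.1 '' P) ⟨φ, .inr hφ⟩).trans
        subset_union_right
  · exact fun x hx => .inr (mem_iUnion.2 ⟨⟨1, .inl rfl⟩, x, hx, rfl⟩)
  · rintro ⟨φ, rfl | hφ⟩
    · exact (image_id P).subset.trans subset_filledSet
    · exact image_subset_filledSet hφ

theorem image_frontier_subset (h : IsContractingSystem G A) (hP : frontier P ⊆ limitSet G A)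
    (hφ : φ = 1 ∨ φ ∈ IFS G) : frontier (φ '' P) ⊆ limitSet G A := by
  rw [← φ.image_frontier]
  refine (image_mono hP).trans ?_
  rcases hφ with rfl | hφ
  · exact (image_id _).subset
  · exact image_subset_of_mem_IFS (fun f hf => h.image_limitSet_subset hf) hφ

theorem interior_filledSet (hPo : IsOpen P)
    (hK : Disjoint (limitSet G A) (interior (filledSet G A P))) :
    interior (filledSet G A P) = ⋃ i : {φ // φ = 1 ∨ φ ∈ IFS G}, i.1 '' P := by
  refine subset_antisymm (fun x hx => ?_) (interior_maximal ?_
    (isOpen_iUnion fun i => i.1.isOpenMap _ hPo))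
  · have hxM := interior_subset hx
    rw [filledSet_eq_union_iUnion] at hxM
    exact hxM.resolve_left fun hxK => disjoint_left.1 hK hxK hx
  · rw [filledSet_eq_union_iUnion]
    exact subset_union_right

/-- The boundary of each image of `P` lies in the limit set, which misses the interior; hence these
images are the components. -/
theorem componentBoundary_filledSet_subset (h : IsContractingSystem G A) (hPo : IsOpen P)
    (hPc : IsConnected P) (hP : frontier P ⊆ limitSet G A)
    (hK : Disjoint (limitSet G A) (interior (filledSet G A P))) :
    componentBoundary (filledSet G A P) ⊆ limitSet G A := by
  rw [componentBoundary_eq (components_eq_range (interior_filledSet hPo hK)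
    (fun i => i.1.isOpenMap _ hPo) (fun i => hPc.image _ i.1.continuous.continuousOn) ?_)]
  · exact iUnion_subset fun i => h.image_frontier_subset hP i.2
  · rintro i x ⟨hx, hxU⟩
    rw [closure_eq_self_union_frontier] at hx
    exact hx.resolve_right fun hx => disjoint_left.1 hK (h.image_frontier_subset hP i.2 hx) hxU

theorem isDecomposition_filledSet_empty (h : IsContractingSystem G A) (hPo : IsOpen P)
    (hK : Disjoint (limitSet G A) (interior (filledSet G A P))) :
    IsDecomposition (filledSet G A P) (limitSet G A) ∅ := by
  have he : filledSet G A P \ (interior (filledSet G A P) ∪ limitSet G A) = ∅ := by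
    rw [sdiff_eq_empty, interior_filledSet hPo hK, union_comm, ← filledSet_eq_union_iUnion]
  have := isDecomposition_of_countable (M := filledSet G A P) (.inr h.isCantorSet_limitSet)
    (fun x hx => ⟨limitSet_subset_filledSet hx, disjoint_left.1 hK hx⟩)
    (by rw [he]; exact countable_empty)
  rwa [he] at this

/-- The orbit of a point of `P` stays in the interior and accumulates on the whole limit set. -/
theorem closure_interior_filledSet (h : IsContractingSystem G A) (hPo : IsOpen P) (hPA : P ⊆ A)
    (hPne : P.Nonempty) (hP : frontier P ⊆ limitSet G A)
    (hK : Disjoint (limitSet G A) (interior (filledSet G A P))) :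
    closure (interior (filledSet G A P)) = filledSet G A P := by
  have hcl : IsClosed (filledSet G A P) := by
    rw [← h.filledSet_closure hP]
    refine h.isClosed_filledSet ?_ isClosed_closure
    rw [closure_eq_self_union_frontier]
    exact union_subset hPA (hP.trans h.limitSet_subset)
  refine subset_antisymm (closure_minimal interior_subset hcl) ?_
  conv_lhs => rw [filledSet_eq_union_iUnion, ← interior_filledSet hPo hK]
  refine union_subset (fun y hy => ?_) subset_closure
  obtain ⟨x, hx⟩ := hPne
  refine closure_mono ?_ (h.reaches_limitSet (hPA hx) hy)
  rintro _ ⟨φ, hφ, rfl⟩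
  rw [interior_filledSet hPo hK]
  exact mem_iUnion.2 ⟨⟨φ, .inr hφ⟩, x, hx, rfl⟩

theorem exists_preconnected_of_notMem_limitSet (hPo : IsOpen P) (hPc : IsConnected P)
    {x : UnitAddCircle} (hx : x ∈ filledSet G A P) (hxK : x ∉ limitSet G A) :
    ∃ U, IsOpen U ∧ IsPreconnected U ∧ x ∈ U ∧ U ⊆ filledSet G A P := by
  rw [filledSet_eq_union_iUnion] at hx
  obtain ⟨i, hi⟩ := mem_iUnion.1 (hx.resolve_left hxK)
  refine ⟨i.1 '' P, i.1.isOpenMap _ hPo,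
    (hPc.image _ i.1.continuous.continuousOn).isPreconnected, hi, ?_⟩
  rw [filledSet_eq_union_iUnion]
  exact (subset_iUnion (fun i : {φ // φ = 1 ∨ φ ∈ IFS G} => i.1 '' P) i).trans subset_union_right

end IsContractingSystem

/-! ### Three maps of slope `1/5` -/

/-- Three contractions of the arc `[1/4, 3/4]` onto its first, third and fifth fifths, which are
the identity off the arc `[1/8, 7/8]`. -/
structure IsQuinaryTriple (f g h : UnitAddCircle ≃ₜ UnitAddCircle) : Prop where
  first : ∀ x ∈ Icc (1 / 4 : ℝ) (3 / 4), f x = ((1 / 5 * x + 1 / 5 : ℝ) : UnitAddCircle)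
  third : ∀ x ∈ Icc (1 / 4 : ℝ) (3 / 4), g x = ((1 / 5 * x + 2 / 5 : ℝ) : UnitAddCircle)
  fifth : ∀ x ∈ Icc (1 / 4 : ℝ) (3 / 4), h x = ((1 / 5 * x + 3 / 5 : ℝ) : UnitAddCircle)
  eq_self : ∀ x ∉ arc (1 / 8) (7 / 8), f x = x ∧ g x = x ∧ h x = x
  rotation : HasRotationNumber f 0 ∧ HasRotationNumber g 0 ∧ HasRotationNumber h 0

theorem exists_isQuinaryTriple : ∃ f g h, IsQuinaryTriple f g h := by
  have key : ∀ z ∈ Icc (1 / 4 : ℝ) (3 / 4), ∃ f : UnitAddCircle ≃ₜ UnitAddCircle,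
      (∀ x ∈ Icc (1 / 4 : ℝ) (3 / 4), f x = ((1 / 5 * x + 4 / 5 * z : ℝ) : UnitAddCircle)) ∧
      (∀ x ∉ arc (1 / 8) (7 / 8), f x = x) ∧ HasRotationNumber f 0 := by
    intro z hz
    obtain ⟨f, F, hF, h1, h2, h3, -⟩ := exists_contraction (a' := 1 / 8) (b' := 7 / 8) (r := 1 / 5)
      (by norm_num) (by norm_num) hz (by norm_num) (by norm_num) (by norm_num)
    refine ⟨f, fun x hx => ?_, h3, hF.hasRotationNumber h2⟩
    rw [hF.coe, h1 x hx]
    congr 1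
    ring
  -- The three contractions have their fixed points at the left end, the centre and the right end of
  -- the arc.
  obtain ⟨f, hf, hf', hf0⟩ := key (1 / 4) (by norm_num)
  obtain ⟨g, hg, hg', hg0⟩ := key (1 / 2) (by norm_num)
  obtain ⟨h, hh, hh', hh0⟩ := key (3 / 4) (by norm_num)
  norm_num only at hf hg hh
  exact ⟨f, g, h, by norm_num only; exact hf, by norm_num only; exact hg,
    by norm_num only; exact hh,
    fun x hx => ⟨hf' x hx, hg' x hx, hh' x hx⟩, hf0, hg0, hh0⟩

namespace IsQuinaryTriple

variable {f g h : UnitAddCircle ≃ₜ UnitAddCircle} {x y : ℝ}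

theorem image_first (H : IsQuinaryTriple f g h) (hx : 1 / 4 ≤ x) (hy : y ≤ 3 / 4) :
    f '' arc x y = arc (1 / 5 * x + 1 / 5) (1 / 5 * y + 1 / 5) :=
  image_arc_of_affine (by norm_num) fun w hw => H.first w ⟨hx.trans hw.1, hw.2.trans hy⟩

theorem image_third (H : IsQuinaryTriple f g h) (hx : 1 / 4 ≤ x) (hy : y ≤ 3 / 4) :
    g '' arc x y = arc (1 / 5 * x + 2 / 5) (1 / 5 * y + 2 / 5) :=
  image_arc_of_affine (by norm_num) fun w hw => H.third w ⟨hx.trans hw.1, hw.2.trans hy⟩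

theorem image_fifth (H : IsQuinaryTriple f g h) (hx : 1 / 4 ≤ x) (hy : y ≤ 3 / 4) :
    h '' arc x y = arc (1 / 5 * x + 3 / 5) (1 / 5 * y + 3 / 5) :=
  image_arc_of_affine (by norm_num) fun w hw => H.fifth w ⟨hx.trans hw.1, hw.2.trans hy⟩

theorem image_first_arc (H : IsQuinaryTriple f g h) :
    f '' arc (1 / 4) (3 / 4) = arc (1 / 4) (7 / 20) := by
  rw [H.image_first le_rfl le_rfl]
  norm_num

theorem image_third_arc (H : IsQuinaryTriple f g h) :
    g '' arc (1 / 4) (3 / 4) = arc (9 / 20) (11 / 20) := by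
  rw [H.image_third le_rfl le_rfl]
  norm_num

theorem image_fifth_arc (H : IsQuinaryTriple f g h) :
    h '' arc (1 / 4) (3 / 4) = arc (13 / 20) (3 / 4) := by
  rw [H.image_fifth le_rfl le_rfl]
  norm_num

theorem image_first_first (H : IsQuinaryTriple f g h) :
    f '' (f '' arc (1 / 4) (3 / 4)) = arc (1 / 4) (27 / 100) := by
  rw [H.image_first_arc, H.image_first le_rfl (by norm_num)]
  norm_num

theorem image_third_fifth (H : IsQuinaryTriple f g h) :
    g '' (h '' arc (1 / 4) (3 / 4)) = arc (53 / 100) (11 / 20) := by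
  rw [H.image_fifth_arc, H.image_third (by norm_num) le_rfl]
  norm_num

theorem isContractingSystem (H : IsQuinaryTriple f g h) :
    IsContractingSystem {f, g, h} (arc (1 / 4) (3 / 4)) where
  finite := by simp
  nontrivial := by
    refine ⟨f, by simp, g, by simp, fun hfg => ?_⟩
    have e := H.image_first_arc
    rw [hfg, H.image_third_arc] at e
    have : ((9 / 20 : ℝ) : UnitAddCircle) ∈ arc (1 / 4) (7 / 20) :=
      e ▸ coe_mem_arc (by norm_num)
    rw [coe_mem_arc_iff (by norm_num) (by norm_num)] at this
    norm_num at this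
  compact := isCompact_arc
  nonempty := ⟨_, coe_mem_arc (x := 1 / 4) (by norm_num)⟩
  maps := by
    rintro k (rfl | rfl | rfl)
    · rw [H.image_first_arc]
      exact arc_mono (by norm_num) (by norm_num)
    · rw [H.image_third_arc]
      exact arc_mono (by norm_num) (by norm_num)
    · rw [H.image_fifth_arc]
      exact arc_mono (by norm_num) (by norm_num)
  disjoint := by
    have h1 : Disjoint (f '' arc (1 / 4) (3 / 4)) (g '' arc (1 / 4) (3 / 4)) := by
      rw [H.image_first_arc, H.image_third_arc]
      exact disjoint_arc (by norm_num) (by norm_num)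
    have h2 : Disjoint (f '' arc (1 / 4) (3 / 4)) (h '' arc (1 / 4) (3 / 4)) := by
      rw [H.image_first_arc, H.image_fifth_arc]
      exact disjoint_arc (by norm_num) (by norm_num)
    have h3 : Disjoint (g '' arc (1 / 4) (3 / 4)) (h '' arc (1 / 4) (3 / 4)) := by
      rw [H.image_third_arc, H.image_fifth_arc]
      exact disjoint_arc (by norm_num) (by norm_num)
    rintro k (rfl | rfl | rfl) l (rfl | rfl | rfl) hkl
    exacts [absurd rfl hkl, h1, h2, h1.symm, absurd rfl hkl, h3, h2.symm, h3.symm, absurd rfl hkl]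
  contract := by
    refine ⟨1 / 5, by norm_num, by norm_num, ?_⟩
    rintro k (rfl | rfl | rfl)
    · exact dist_affine_le (by norm_num) le_rfl (by norm_num) H.first fun x _ y _ => by ring
    · exact dist_affine_le (by norm_num) le_rfl (by norm_num) H.third fun x _ y _ => by ring
    · exact dist_affine_le (by norm_num) le_rfl (by norm_num) H.fifth fun x _ y _ => by ring

end IsQuinaryTriple

/-- Two maps for the gap `[7/20, 9/20]`: the first one stretches `[1/4, 27/100]` to `[1/4, 7/20]`
and contracts `[27/100, 9/20]` to the gap, the second one contracts `[7/20, 53/100]` to the gap and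
stretches `[53/100, 11/20]` to `[9/20, 11/20]`. -/
structure IsGapPair (Tp Tm : UnitAddCircle ≃ₜ UnitAddCircle) : Prop where
  plus_left : ∀ x ∈ Icc (1 / 4 : ℝ) (27 / 100), Tp x = ((5 * x + -1 : ℝ) : UnitAddCircle)
  plus_right : ∀ x ∈ Icc (27 / 100 : ℝ) (9 / 20), Tp x = ((5 / 9 * x + 1 / 5 : ℝ) : UnitAddCircle)
  plus_eq_self : ∀ x ∉ arc (1 / 4) (9 / 20), Tp x = x
  minus_left : ∀ x ∈ Icc (7 / 20 : ℝ) (53 / 100), Tm x = ((5 / 9 * x + 7 / 45 : ℝ) : UnitAddCircle)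
  minus_right : ∀ x ∈ Icc (53 / 100 : ℝ) (11 / 20), Tm x = ((5 * x + -11 / 5 : ℝ) : UnitAddCircle)
  minus_eq_self : ∀ x ∉ arc (7 / 20) (11 / 20), Tm x = x
  rotation : HasRotationNumber Tp 0 ∧ HasRotationNumber Tm 0

theorem exists_isGapPair : ∃ Tp Tm, IsGapPair Tp Tm := by
  obtain ⟨Tp, F, hF, F1, F2, F3⟩ := exists_bump (a := 1 / 4) (m := 27 / 100) (m' := 7 / 20)
    (b := 9 / 20) (by norm_num) (by norm_num) (by norm_num) (by norm_num) (by norm_num)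
  obtain ⟨Tm, E, hE, E1, E2, E3⟩ := exists_bump (a := 7 / 20) (m := 53 / 100) (m' := 9 / 20)
    (b := 11 / 20) (by norm_num) (by norm_num) (by norm_num) (by norm_num) (by norm_num)
  refine ⟨Tp, Tm, fun x hx => ?_, fun x hx => ?_, hF.eq_self F3, fun x hx => ?_, fun x hx => ?_,
    hE.eq_self E3, hF.hasRotationNumber (F3 (1 / 2) (by norm_num)),
    hE.hasRotationNumber (E3 (3 / 5) (by norm_num))⟩
  · rw [hF.coe, F1 x hx]
    congr 1
    ring
  · rw [hF.coe, F2 x hx]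
    congr 1
    ring
  · rw [hE.coe, E1 x hx]
    congr 1
    ring
  · rw [hE.coe, E2 x hx]
    congr 1
    ring

namespace IsGapPair

variable {Tp Tm : UnitAddCircle ≃ₜ UnitAddCircle}

theorem plus_image_left (h : IsGapPair Tp Tm) :
    Tp '' arc (1 / 4) (27 / 100) = arc (1 / 4) (7 / 20) := by
  rw [image_arc_of_affine (by norm_num) h.plus_left]
  norm_num

theorem plus_image_right (h : IsGapPair Tp Tm) :
    Tp '' arc (27 / 100) (9 / 20) = arc (7 / 20) (9 / 20) := by
  rw [image_arc_of_affine (by norm_num) h.plus_right]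
  norm_num

theorem plus_image_gap (h : IsGapPair Tp Tm) :
    Tp '' arc (7 / 20) (9 / 20) = arc (71 / 180) (9 / 20) := by
  rw [image_arc_of_affine (by norm_num) fun x hx =>
    h.plus_right x ⟨le_trans (by norm_num) hx.1, hx.2⟩]
  norm_num

theorem minus_image_left (h : IsGapPair Tp Tm) :
    Tm '' arc (7 / 20) (53 / 100) = arc (7 / 20) (9 / 20) := by
  rw [image_arc_of_affine (by norm_num) h.minus_left]
  norm_num

theorem minus_image_right (h : IsGapPair Tp Tm) :
    Tm '' arc (53 / 100) (11 / 20) = arc (9 / 20) (11 / 20) := by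
  rw [image_arc_of_affine (by norm_num) h.minus_right]
  norm_num

theorem minus_image_gap (h : IsGapPair Tp Tm) :
    Tm '' arc (7 / 20) (9 / 20) = arc (7 / 20) (73 / 180) := by
  rw [image_arc_of_affine (by norm_num) fun x hx =>
    h.minus_left x ⟨hx.1, le_trans hx.2 (by norm_num)⟩]
  norm_num

theorem image_gap_subset (h : IsGapPair Tp Tm) :
    ∀ T ∈ ({Tp, Tm} : Set (UnitAddCircle ≃ₜ UnitAddCircle)),
      T '' arc (7 / 20) (9 / 20) ⊆ arc (7 / 20) (9 / 20) := by
  rintro T (rfl | rfl)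
  · rw [h.plus_image_gap]
    exact arc_mono (by norm_num) le_rfl
  · rw [h.minus_image_gap]
    exact arc_mono le_rfl (by norm_num)

theorem reaches (h : IsGapPair Tp Tm) {x y : UnitAddCircle} (hx : x ∈ arc (7 / 20) (9 / 20))
    (hy : y ∈ arc (7 / 20) (9 / 20)) : Reaches {Tp, Tm} x y := by
  refine reaches_of_contraction (r := 5 / 9) isCompact_arc.isBounded (by norm_num) (by norm_num)
    h.image_gap_subset ?_ subset_rfl ?_ hx hy
  · rintro T (rfl | rfl)
    · exact dist_affine_le (by norm_num) le_rfl (by norm_num) (fun x hx =>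
        h.plus_right x ⟨le_trans (by norm_num) hx.1, hx.2⟩) fun x _ y _ => by ring
    · exact dist_affine_le (by norm_num) le_rfl (by norm_num) (fun x hx =>
        h.minus_left x ⟨hx.1, le_trans hx.2 (by norm_num)⟩) fun x _ y _ => by ring
  · rw [biUnion_pair, h.plus_image_gap, h.minus_image_gap, union_comm]
    -- The ratio `5 / 9` exceeds `1 / 2`, so the two images overlap around the midpoint `2 / 5` and
    -- together cover the gap.
    rw [← arc_union_arc (a := 7 / 20) (b := 2 / 5) (c := 9 / 20) (by norm_num) (by norm_num)]
    exact union_subset_union (arc_mono le_rfl (by norm_num)) (arc_mono (by norm_num) le_rfl)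

theorem isMinimalSet (h : IsGapPair Tp Tm) : IsMinimalSet {Tp, Tm} (arc (7 / 20) (9 / 20)) :=
  isMinimalSet_of_reaches ⟨_, coe_mem_arc (x := 7 / 20) (by norm_num)⟩ isClosed_arc
    h.image_gap_subset fun _ hx _ hy => h.reaches hx hy

end IsGapPair

namespace IsQuinaryTriple

variable {f g h Tp Tm : UnitAddCircle ≃ₜ UnitAddCircle}

theorem isFifthsTriple (H : IsQuinaryTriple f g h) :
    IsFifthsTriple f g h (1 / 4) (3 / 4) (1 / 8) (7 / 8) where
  left := by norm_num
  lt := by norm_num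
  right := by norm_num
  proper := by norm_num
  first x hx := by
    rw [H.first x hx]
    congr 1
    ring
  third x hx := by
    rw [H.third x hx]
    congr 1
    ring
  fifth x hx := by
    rw [H.fifth x hx]
    congr 1
    ring
  eq_self := H.eq_self

theorem disjoint_gap (H : IsQuinaryTriple f g h) :
    ∀ k ∈ ({f, g, h} : Set (UnitAddCircle ≃ₜ UnitAddCircle)),
      Disjoint (openArc (7 / 20) (9 / 20)) (k '' arc (1 / 4) (3 / 4)) := by
  rintro k (rfl | rfl | rfl)
  · rw [H.image_first_arc, ← arc_add_one]
    exact disjoint_openArc_arc (by norm_num) (by norm_num)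
  · rw [H.image_third_arc]
    exact disjoint_openArc_arc (by norm_num) (by norm_num)
  · rw [H.image_fifth_arc]
    exact disjoint_openArc_arc (by norm_num) (by norm_num)

theorem disjoint_unfilled_gap (H : IsQuinaryTriple f g h) :
    ∀ k ∈ ({f, g, h} : Set (UnitAddCircle ≃ₜ UnitAddCircle)),
      Disjoint (openArc (11 / 20) (13 / 20)) (k '' arc (1 / 4) (3 / 4)) := by
  rintro k (rfl | rfl | rfl)
  · rw [H.image_first_arc, ← arc_add_one]
    exact disjoint_openArc_arc (by norm_num) (by norm_num)
  · rw [H.image_third_arc, ← arc_add_one]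
    exact disjoint_openArc_arc (by norm_num) (by norm_num)
  · rw [H.image_fifth_arc]
    exact disjoint_openArc_arc (by norm_num) (by norm_num)

theorem first_mem : f ∈ IFS {f, g, h} := mem_IFS_of_mem (by simp)

theorem third_mem : g ∈ IFS {f, g, h} := mem_IFS_of_mem (by simp)

theorem fifth_mem : h ∈ IFS {f, g, h} := mem_IFS_of_mem (by simp)

/-- The left end of the arc is fixed by the first map and the right end by the third one; the other
points are images of these ends. -/
theorem endpoints_mem (H : IsQuinaryTriple f g h) :
    ∀ x ∈ ({1 / 4, 27 / 100, 7 / 20, 9 / 20, 53 / 100, 11 / 20} : Set ℝ),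
      (x : UnitAddCircle) ∈ limitSet {f, g, h} (arc (1 / 4) (3 / 4)) := by
  have hS := H.isContractingSystem
  have hinv : ∀ k ∈ ({f, g, h} : Set (UnitAddCircle ≃ₜ UnitAddCircle)), ∀ x ∈
      limitSet {f, g, h} (arc (1 / 4) (3 / 4)), k x ∈ limitSet {f, g, h} (arc (1 / 4) (3 / 4)) :=
    fun k hk x hx => hS.image_limitSet_subset hk ⟨x, hx, rfl⟩
  have ha : ((1 / 4 : ℝ) : UnitAddCircle) ∈ limitSet {f, g, h} (arc (1 / 4) (3 / 4)) :=
    mem_limitSet_of_fixed (f := f) (by simp) (coe_mem_arc (by norm_num))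
      (by rw [H.first _ (by norm_num)]; norm_num)
  have hb : ((3 / 4 : ℝ) : UnitAddCircle) ∈ limitSet {f, g, h} (arc (1 / 4) (3 / 4)) :=
    mem_limitSet_of_fixed (f := h) (by simp) (coe_mem_arc (by norm_num))
      (by rw [H.fifth _ (by norm_num)]; norm_num)
  have hfb := hinv f (by simp) _ hb
  rw [H.first _ (by norm_num)] at hfb
  have hffb := hinv f (by simp) _ hfb
  rw [H.first _ (by norm_num)] at hffb
  have hga := hinv g (by simp) _ ha
  rw [H.third _ (by norm_num)] at hga
  have hha := hinv h (by simp) _ ha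
  rw [H.fifth _ (by norm_num)] at hha
  have hgha := hinv g (by simp) _ hha
  rw [H.third _ (by norm_num)] at hgha
  have hgb := hinv g (by simp) _ hb
  rw [H.third _ (by norm_num)] at hgb
  rintro x (rfl | rfl | rfl | rfl | rfl | rfl)
  · exact ha
  · convert hffb using 2; norm_num
  · convert hfb using 2; norm_num
  · convert hga using 2; norm_num
  · convert hgha using 2; norm_num
  · convert hgb using 2; norm_num

theorem frontier_gap_subset (H : IsQuinaryTriple f g h) :
    frontier (openArc (7 / 20) (9 / 20)) ⊆ limitSet {f, g, h} (arc (1 / 4) (3 / 4)) := by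
  rw [frontier_openArc (by norm_num) (by norm_num)]
  rintro _ (rfl | rfl)
  · exact H.endpoints_mem _ (by simp)
  · exact H.endpoints_mem _ (by simp)

/-- On `[1/4, 27/100] = f(f(A))` the map `x ↦ 5 x - 1` is the inverse of `f`. -/
theorem plus_apply (H : IsQuinaryTriple f g h) (hT : IsGapPair Tp Tm) :
    ∀ x ∈ arc (1 / 4) (3 / 4), Tp (f (f x)) = f x := by
  rintro _ ⟨x, hx, rfl⟩
  have h1 : 1 / 5 * x + 1 / 5 ∈ Icc (1 / 4 : ℝ) (3 / 4) :=
    ⟨by linarith [hx.1], by linarith [hx.2]⟩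
  simp only
  rw [H.first x hx, H.first _ h1, hT.plus_left _ ⟨by linarith [hx.1], by linarith [hx.2]⟩]
  congr 1
  ring

theorem minus_apply (H : IsQuinaryTriple f g h) (hT : IsGapPair Tp Tm) :
    ∀ x ∈ arc (1 / 4) (3 / 4), Tm (g (h x)) = g x := by
  rintro _ ⟨x, hx, rfl⟩
  have h1 : 1 / 5 * x + 3 / 5 ∈ Icc (1 / 4 : ℝ) (3 / 4) :=
    ⟨by linarith [hx.1], by linarith [hx.2]⟩
  simp only
  -- On `[53/100, 11/20] = g(h(A))` the map deletes the letter `h` and keeps `g`.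
  rw [H.fifth x hx, H.third _ h1, hT.minus_right _ ⟨by linarith [hx.1], by linarith [hx.2]⟩,
    H.third x hx]
  congr 1
  ring

theorem plus_image (H : IsQuinaryTriple f g h) (hT : IsGapPair Tp Tm) {S : Set UnitAddCircle}
    (hS : S ⊆ arc (1 / 4) (3 / 4)) :
    Tp '' ((f * f : UnitAddCircle ≃ₜ UnitAddCircle) '' S) = f '' S := by
  rw [image_image]
  exact image_congr fun x hx => H.plus_apply hT x (hS hx)

theorem minus_image (H : IsQuinaryTriple f g h) (hT : IsGapPair Tp Tm) {S : Set UnitAddCircle}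
    (hS : S ⊆ arc (1 / 4) (3 / 4)) :
    Tm '' ((g * h : UnitAddCircle ≃ₜ UnitAddCircle) '' S) = g '' S := by
  rw [image_image]
  exact image_congr fun x hx => H.minus_apply hT x (hS hx)

theorem first_first_image (H : IsQuinaryTriple f g h) :
    (f * f : UnitAddCircle ≃ₜ UnitAddCircle) '' arc (1 / 4) (3 / 4) = arc (1 / 4) (27 / 100) := by
  rw [mul_image, H.image_first_first]

theorem third_fifth_image (H : IsQuinaryTriple f g h) :
    (g * h : UnitAddCircle ≃ₜ UnitAddCircle) '' arc (1 / 4) (3 / 4) = arc (53 / 100) (11 / 20) := by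
  rw [mul_image, H.image_third_fifth]

theorem isAdaptedTPair (H : IsQuinaryTriple f g h) (hT : IsGapPair Tp Tm) :
    IsAdaptedTPair Tp Tm (limitSet {f, g, h} (arc (1 / 4) (3 / 4)))
      {C | ∃ φ ∈ IFS {f, g, h}, C = φ '' openArc (7 / 20) (9 / 20)}
      (1 / 4) (27 / 100) (7 / 20) (9 / 20) (53 / 100) (11 / 20) := by
  have hS := H.isContractingSystem
  set K := limitSet {f, g, h} (arc (1 / 4) (3 / 4))
  have hKA : K ⊆ arc (1 / 4) (3 / 4) := hS.limitSet_subset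
  have hPA : openArc (7 / 20) (9 / 20) ⊆ arc (1 / 4) (3 / 4) :=
    openArc_subset_arc.trans (arc_mono (by norm_num) (by norm_num))
  have hPne : (openArc (7 / 20) (9 / 20)).Nonempty :=
    ⟨_, coe_mem_openArc (x := 2 / 5) (by norm_num)⟩
  have hff : K ∩ arc (1 / 4) (27 / 100) = (f * f : UnitAddCircle ≃ₜ UnitAddCircle) '' K := by
    rw [← H.first_first_image, hS.limitSet_inter_image (mul_mem first_mem first_mem)]
  have hgh : K ∩ arc (53 / 100) (11 / 20) = (g * h : UnitAddCircle ≃ₜ UnitAddCircle) '' K := by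
    rw [← H.third_fifth_image, hS.limitSet_inter_image (mul_mem third_mem fifth_mem)]
  have hf : K ∩ arc (1 / 4) (7 / 20) = f '' K := by
    rw [← H.image_first_arc, hS.limitSet_inter_image first_mem]
  have hg : K ∩ arc (9 / 20) (11 / 20) = g '' K := by
    rw [← H.image_third_arc, hS.limitSet_inter_image third_mem]
  -- Only the two endpoints of the gap are in `K`, and they belong to `f(K)` and `g(K)`
  -- respectively.
  have hgap : K ∩ arc (7 / 20) (9 / 20) ⊆ f '' K ∪ g '' K := by
    rintro x ⟨hxK, hx⟩
    rw [arc_eq_openArc_union (by norm_num)] at hx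
    rcases hx with hx | rfl | rfl
    · exact absurd hxK (disjoint_left.1 (hS.disjoint_limitSet H.disjoint_gap) hx)
    · exact .inl (hf ▸ ⟨hxK, coe_mem_arc (by norm_num)⟩)
    · exact .inr (hg ▸ ⟨hxK, coe_mem_arc (by norm_num)⟩)
  have hfg : K ∩ arc (1 / 4) (11 / 20) = f '' K ∪ g '' K := by
    rw [← arc_union_arc (a := 1 / 4) (b := 9 / 20) (c := 11 / 20) (by norm_num) (by norm_num),
      ← arc_union_arc (a := 1 / 4) (b := 7 / 20) (c := 9 / 20) (by norm_num) (by norm_num),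
      inter_union_distrib_left, inter_union_distrib_left, hf, hg, union_right_comm,
      union_eq_left.2 hgap]
  have hC : IsCantorSet K := hS.isCantorSet_limitSet
  exact
  { lt₁ := by norm_num
    lt₂ := by norm_num
    lt₃ := by norm_num
    lt₄ := by norm_num
    lt₅ := by norm_num
    mem₁ := H.endpoints_mem _ (by simp)
    mem₂ := H.endpoints_mem _ (by simp)
    mem₃ := H.endpoints_mem _ (by simp)
    mem₄ := H.endpoints_mem _ (by simp)
    cantor := by
      rw [hfg]
      exact (hC.image f).union_of_subset hC.2.2 (hC.image g)
        (hS.image_limitSet_subset (by simp)) (hS.image_limitSet_subset (by simp))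
    cantor_left := hff ▸ hC.image _
    cantor_right := hgh ▸ hC.image _
    plus_image := hT.plus_image_left
    plus_cantor := by rw [hff, hf, H.plus_image hT hKA]
    plus_gaps := fun C hC hCsub => hS.image_gap_mem hPA hPne H.disjoint_gap (by simp) (by simp)
      (H.plus_apply hT) hC (by rwa [H.image_first_first])
    -- The value `71 / 180` is the image of `c = 7 / 20`; both required affine pieces belong to the
    -- single piece of slope `5 / 9`.
    plus_affine := ⟨71 / 180, by norm_num, by norm_num,
      fun x hx => by
        rw [hT.plus_right x ⟨hx.1, hx.2.trans (by norm_num)⟩]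
        congr 1
        ring,
      fun x hx => by
        rw [hT.plus_right x ⟨le_trans (by norm_num) hx.1, hx.2⟩]
        congr 1
        ring⟩
    plus_eq_self := hT.plus_eq_self
    minus_image := hT.minus_image_right
    minus_cantor := by rw [hgh, hg, H.minus_image hT hKA]
    minus_gaps := fun C hC hCsub => hS.image_gap_mem hPA hPne H.disjoint_gap (by simp) (by simp)
      (H.minus_apply hT) hC (by rwa [H.image_third_fifth])
    minus_affine := ⟨73 / 180, by norm_num, by norm_num,
      fun x hx => by
        rw [hT.minus_left x ⟨hx.1, hx.2.trans (by norm_num)⟩]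
        congr 1
        ring,
      fun x hx => by
        rw [hT.minus_left x ⟨le_trans (by norm_num) hx.1, hx.2⟩]
        congr 1
        ring⟩
    minus_eq_self := hT.minus_eq_self
    minimal := hT.isMinimalSet }

end IsQuinaryTriple

namespace IsQuinaryTriple

variable {f g h Tp Tm : UnitAddCircle ≃ₜ UnitAddCircle}

theorem gap_subset : openArc (7 / 20) (9 / 20) ⊆ arc (1 / 4) (3 / 4) :=
  openArc_subset_arc.trans (arc_mono (by norm_num) (by norm_num))

theorem filledSet_arc (H : IsQuinaryTriple f g h) :
    filledSet {f, g, h} (arc (1 / 4) (3 / 4)) (arc (7 / 20) (9 / 20)) =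
      filledSet {f, g, h} (arc (1 / 4) (3 / 4)) (openArc (7 / 20) (9 / 20)) := by
  rw [← closure_openArc (a := 7 / 20) (by norm_num),
    H.isContractingSystem.filledSet_closure H.frontier_gap_subset]

theorem arc_gap_subset (H : IsQuinaryTriple f g h) : arc (7 / 20) (9 / 20) ⊆
    filledSet {f, g, h} (arc (1 / 4) (3 / 4)) (openArc (7 / 20) (9 / 20)) := by
  rw [← H.filledSet_arc]
  exact subset_filledSet

/-- The centre of the fourth fifth, which is never filled, is the hole that keeps the limit set out
of the interior and cuts off one-point components. -/
theorem notMem_filledSet (H : IsQuinaryTriple f g h) : ((3 / 5 : ℝ) : UnitAddCircle) ∉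
    filledSet {f, g, h} (arc (1 / 4) (3 / 4)) (openArc (7 / 20) (9 / 20)) := by
  intro hM
  have := H.isContractingSystem.filledSet_inter_subset H.disjoint_unfilled_gap gap_subset
    ⟨hM, coe_mem_openArc (by norm_num)⟩
  rw [coe_mem_openArc_iff (by norm_num) (by norm_num)] at this
  norm_num at this

theorem disjoint_limitSet_interior (H : IsQuinaryTriple f g h) :
    Disjoint (limitSet {f, g, h} (arc (1 / 4) (3 / 4)))
      (interior (filledSet {f, g, h} (arc (1 / 4) (3 / 4)) (openArc (7 / 20) (9 / 20)))) :=
  H.isContractingSystem.disjoint_limitSet_interior gap_subset H.disjoint_gap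
    (coe_mem_arc (by norm_num)) H.notMem_filledSet

/-- Three zones: on `f(f(A))` a letter is deleted, `[27/100, 9/20]` goes into the filled gap, and
elsewhere the map is the identity. -/
theorem plus_image_filledSet (H : IsQuinaryTriple f g h) (hT : IsGapPair Tp Tm) :
    Tp '' filledSet {f, g, h} (arc (1 / 4) (3 / 4)) (openArc (7 / 20) (9 / 20)) ⊆
      filledSet {f, g, h} (arc (1 / 4) (3 / 4)) (openArc (7 / 20) (9 / 20)) := by
  have hS := H.isContractingSystem
  rintro _ ⟨x, hx, rfl⟩
  by_cases h1 : x ∈ arc (1 / 4) (27 / 100)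
  · have hmem : x ∈ filledSet {f, g, h} (arc (1 / 4) (3 / 4)) (openArc (7 / 20) (9 / 20)) ∩
        (f * f : UnitAddCircle ≃ₜ UnitAddCircle) '' arc (1 / 4) (3 / 4) :=
      ⟨hx, by rwa [H.first_first_image]⟩
    rw [hS.filledSet_inter_image gap_subset H.disjoint_gap (mul_mem first_mem first_mem)] at hmem
    refine hS.image_filledSet_subset first_mem ?_
    rw [← H.plus_image hT (hS.filledSet_subset gap_subset)]
    exact mem_image_of_mem Tp hmem
  by_cases h2 : x ∈ arc (27 / 100) (9 / 20)
  · refine H.arc_gap_subset ?_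
    rw [← hT.plus_image_right]
    exact mem_image_of_mem Tp h2
  rwa [hT.plus_eq_self x]
  rw [← arc_union_arc (b := 27 / 100) (by norm_num) (by norm_num)]
  exact fun hx => hx.elim h1 h2

theorem minus_image_filledSet (H : IsQuinaryTriple f g h) (hT : IsGapPair Tp Tm) :
    Tm '' filledSet {f, g, h} (arc (1 / 4) (3 / 4)) (openArc (7 / 20) (9 / 20)) ⊆
      filledSet {f, g, h} (arc (1 / 4) (3 / 4)) (openArc (7 / 20) (9 / 20)) := by
  have hS := H.isContractingSystem
  rintro _ ⟨x, hx, rfl⟩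
  by_cases h1 : x ∈ arc (53 / 100) (11 / 20)
  · have hmem : x ∈ filledSet {f, g, h} (arc (1 / 4) (3 / 4)) (openArc (7 / 20) (9 / 20)) ∩
        (g * h : UnitAddCircle ≃ₜ UnitAddCircle) '' arc (1 / 4) (3 / 4) :=
      ⟨hx, by rwa [H.third_fifth_image]⟩
    rw [hS.filledSet_inter_image gap_subset H.disjoint_gap (mul_mem third_mem fifth_mem)] at hmem
    refine hS.image_filledSet_subset third_mem ?_
    rw [← H.minus_image hT (hS.filledSet_subset gap_subset)]
    exact mem_image_of_mem Tm hmem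
  by_cases h2 : x ∈ arc (7 / 20) (53 / 100)
  · refine H.arc_gap_subset ?_
    rw [← hT.minus_image_left]
    exact mem_image_of_mem Tm h2
  rwa [hT.minus_eq_self x]
  rw [← arc_union_arc (b := 53 / 100) (by norm_num) (by norm_num)]
  exact fun hx => hx.elim h2 h1

theorem isClosed_filledSet (H : IsQuinaryTriple f g h) :
    IsClosed (filledSet {f, g, h} (arc (1 / 4) (3 / 4)) (openArc (7 / 20) (9 / 20))) := by
  rw [← H.filledSet_arc]
  exact H.isContractingSystem.isClosed_filledSet (arc_mono (by norm_num) (by norm_num)) isClosed_arc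

/-- The end `7 / 20` of the gap lies in the limit set, so every orbit accumulates there; from it
`T⁺, T⁻` reach the whole gap, and `f, g, h` spread the gap over the set. -/
theorem isMinimalSet_filledSet (H : IsQuinaryTriple f g h) (hT : IsGapPair Tp Tm) :
    IsMinimalSet {f, g, h, Tp, Tm}
      (filledSet {f, g, h} (arc (1 / 4) (3 / 4)) (openArc (7 / 20) (9 / 20))) := by
  have hS := H.isContractingSystem
  have hc := H.endpoints_mem (7 / 20) (by simp)
  refine isMinimalSet_of_reaches ⟨_, limitSet_subset_filledSet hc⟩ H.isClosed_filledSet ?_ ?_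
  · rintro φ (rfl | rfl | rfl | rfl | rfl)
    exacts [hS.image_filledSet_subset first_mem, hS.image_filledSet_subset third_mem,
      hS.image_filledSet_subset fifth_mem, H.plus_image_filledSet hT, H.minus_image_filledSet hT]
  · intro x hx y hy
    have hxA := hS.filledSet_subset gap_subset hx
    refine hS.reaches_filledSet (by simp [insert_subset_iff]) hxA (fun y hy => ?_) y hy
    refine ((hS.reaches_limitSet hxA hc).mono (by simp [insert_subset_iff])).trans ?_
    exact (hT.reaches (coe_mem_arc (by norm_num)) (openArc_subset_arc hy)).mono
      (by simp [insert_subset_iff])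

theorem singleton_mem_components (H : IsQuinaryTriple f g h) {φ : UnitAddCircle ≃ₜ UnitAddCircle}
    (hφ : φ ∈ IFS {f, g, h}) : {φ ((1 / 2 : ℝ) : UnitAddCircle)} ∈
      components (filledSet {f, g, h} (arc (1 / 4) (3 / 4)) (openArc (7 / 20) (9 / 20))) := by
  have hS := H.isContractingSystem
  have hcl : closure (openArc (8 / 25) (3 / 5)) = arc (8 / 25) (3 / 5) :=
    closure_openArc (by norm_num)
  refine hS.singleton_mem_components gap_subset H.disjoint_gap (g := g) (by simp) ?_
    -- Both ends of `V` are missing points: `3 / 5` is the hole and `8 / 25` is its image under `f`.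
    -- The fixed point `1 / 2` of `g` lies between them.
    (V := openArc (8 / 25) (3 / 5)) isOpen_openArc (coe_mem_openArc (by norm_num)) ?_ ?_ hφ
  · rw [H.third _ (by norm_num)]
    norm_num
  · rw [hcl]
    exact arc_mono (by norm_num) (by norm_num)
  · rw [hcl, arc_eq_openArc_union (by norm_num), union_sdiff_left]
    refine Disjoint.mono_left sdiff_subset (disjoint_left.2 ?_)
    rintro _ (rfl | rfl) hM
    · have e : f ((3 / 5 : ℝ) : UnitAddCircle) = ((8 / 25 : ℝ) : UnitAddCircle) := by
        rw [H.first _ (by norm_num)]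
        norm_num
      rw [← e] at hM
      exact H.notMem_filledSet (hS.mem_filledSet_of_apply gap_subset H.disjoint_gap first_mem
        (coe_mem_arc (by norm_num)) hM)
    · exact H.notMem_filledSet hM

theorem isSymmetricCantorval (H : IsQuinaryTriple f g h) : IsSymmetricCantorval
    (filledSet {f, g, h} (arc (1 / 4) (3 / 4)) (openArc (7 / 20) (9 / 20))) where
  nonempty := H.isContractingSystem.limitSet_nonempty.mono limitSet_subset_filledSet
  isCompact := H.isClosed_filledSet.isCompact
  closure_interior := H.isContractingSystem.closure_interior_filledSet isOpen_openArc gap_subset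
    (isConnected_openArc (by norm_num)).nonempty H.frontier_gap_subset H.disjoint_limitSet_interior
  endpoints C hC hCn e he := by
    refine accPt_of_mem_frontier_component H.isClosed_filledSet
      (S := {y | {y} ∈ components
        (filledSet {f, g, h} (arc (1 / 4) (3 / 4)) (openArc (7 / 20) (9 / 20)))})
      (fun x => IsContractingSystem.exists_preconnected_of_notMem_limitSet isOpen_openArc
        (isConnected_openArc (by norm_num))) ?_ (fun _ => id) hC hCn he
    -- The one-point components include the orbit of `1 / 2`, which accumulates on the whole limit
    -- set.
    intro y hy
    refine closure_mono ?_ (H.isContractingSystem.reaches_limitSet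
      (coe_mem_arc (x := 1 / 2) (by norm_num)) hy)
    rintro _ ⟨φ, hφ, rfl⟩
    exact H.singleton_mem_components hφ

end IsQuinaryTriple

theorem exists_symmetricCantorval :
    ∃ (f g h Tp Tm : UnitAddCircle ≃ₜ UnitAddCircle) (a b a' b' c d α x₀ y₀ β : ℝ)
        (M K : Set UnitAddCircle),
      IsFifthsTriple f g h a b a' b' ∧ K = limitSet {f, g, h} (arc a b) ∧
      c = a + (b - a) / 5 ∧ d = a + 2 * (b - a) / 5 ∧
      a ≤ α ∧ β ≤ b ∧
      Disjoint (arc α β) (openArc (a + 3 * (b - a) / 5) (a + 4 * (b - a) / 5)) ∧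
      IsAdaptedTPair Tp Tm K {C | ∃ φ ∈ IFS {f, g, h}, C = φ '' openArc c d}
        α x₀ c d y₀ β ∧
      (∀ φ ∈ ({f, g, h, Tp, Tm} : Set (UnitAddCircle ≃ₜ UnitAddCircle)),
        HasRotationNumber φ 0) ∧
      M = K ∪ (⋃ φ ∈ IFS {f, g, h}, φ '' arc c d) ∪ arc c d ∧
      IsMinimalSet {f, g, h, Tp, Tm} M ∧ IsDecomposition M K ∅ ∧
      (interior M).Nonempty ∧ K.Nonempty ∧ componentBoundary M ⊆ K ∧
      IsSymmetricCantorval M := by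
  obtain ⟨f, g, h, H⟩ := exists_isQuinaryTriple
  obtain ⟨Tp, Tm, hT⟩ := exists_isGapPair
  have hS := H.isContractingSystem
  have hK := H.disjoint_limitSet_interior
  have hPc : IsConnected (openArc (7 / 20) (9 / 20)) := isConnected_openArc (by norm_num)
  refine ⟨f, g, h, Tp, Tm, 1 / 4, 3 / 4, 1 / 8, 7 / 8, 7 / 20, 9 / 20, 1 / 4, 27 / 100, 53 / 100,
    11 / 20, filledSet {f, g, h} (arc (1 / 4) (3 / 4)) (openArc (7 / 20) (9 / 20)),
    limitSet {f, g, h} (arc (1 / 4) (3 / 4)), H.isFifthsTriple, rfl, by norm_num, by norm_num,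
    le_rfl, by norm_num, ?_, H.isAdaptedTPair hT, ?_, H.filledSet_arc.symm,
    H.isMinimalSet_filledSet hT, hS.isDecomposition_filledSet_empty isOpen_openArc hK, ?_,
    hS.limitSet_nonempty, hS.componentBoundary_filledSet_subset isOpen_openArc hPc
    H.frontier_gap_subset hK, H.isSymmetricCantorval⟩
  · rw [← arc_add_one]
    exact (disjoint_openArc_arc (by norm_num) (by norm_num)).symm
  · rintro φ (rfl | rfl | rfl | rfl | rfl)
    exacts [H.rotation.1, H.rotation.2.1, H.rotation.2.2, hT.rotation.1, hT.rotation.2]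
  · exact hPc.nonempty.mono (interior_maximal subset_filledSet isOpen_openArc)

/-! ### The main theorem -/

theorem mainTheorem6 :
    -- a Cantor set (the triadic set), with smooth generators; the minimal set is not unique
    (∃ (f g : UnitAddCircle ≃ₜ UnitAddCircle) (a b a' b' : ℝ) (M : Set UnitAddCircle),
      IsCantorPair f g M a b a' b' ∧
      (∀ x ∈ Icc a b, f x = ((a + (x - a) / 3 : ℝ) : UnitAddCircle)) ∧
      (∀ x ∈ Icc a b, g x = ((b + (x - b) / 3 : ℝ) : UnitAddCircle)) ∧
      M = limitSet {f, g} (arc a b) ∧ M = triadicSet a b ∧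
      IsSmoothDiffeo f ∧ IsSmoothDiffeo g ∧
      (∀ φ ∈ ({f, g} : Set (UnitAddCircle ≃ₜ UnitAddCircle)), HasRotationNumber φ 0) ∧
      IsMinimalSet {f, g} M ∧ IsCantorSet M ∧ interior M = ∅ ∧ IsDecomposition M M ∅ ∧
      ∃ M' : Set UnitAddCircle, IsMinimalSet {f, g} M' ∧ M' ≠ M) ∧
    -- a finite set
    (∀ f : UnitAddCircle ≃ₜ UnitAddCircle, (∃ x, f x = x) →
      ∃ M : Set UnitAddCircle, M.Finite ∧ IsMinimalSet {f} M) ∧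
    (∀ f : UnitAddCircle ≃ₜ UnitAddCircle, HasRotationNumber f 0 →
      ∃ M : Set UnitAddCircle, M.Finite ∧ IsMinimalSet {f} M) ∧
    -- the circle
    (∃ (Tp Tm H₁ H₂ : UnitAddCircle ≃ₜ UnitAddCircle) (a b a' b' c d : ℝ),
      IsTPair Tp Tm a b a' b' ∧ c < d ∧ arc c d ⊆ arc a b ∧
      (arc a b)ᶜ ⊆ H₁ '' arc c d ∧ H₂ '' (arc a b)ᶜ ⊆ arc c d ∧
      (∀ φ ∈ ({Tp, Tm, H₁, H₂} : Set (UnitAddCircle ≃ₜ UnitAddCircle)),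
        HasRotationNumber φ 0) ∧
      IsMinimalSet {Tp, Tm, H₁, H₂} univ) ∧
    -- intervals, a Cantor set and countably many points, which are the endpoints
    (∃ (f g h Tp Tm : UnitAddCircle ≃ₜ UnitAddCircle) (a b a' b' c d p q u' v' u v : ℝ)
        (M K N : Set UnitAddCircle),
      IsCantorPair f g K a b a' b' ∧ (a : UnitAddCircle) ∈ K ∧ (b : UnitAddCircle) ∈ K ∧
      openArc c d ∈ components Kᶜ ∧ openArc c d ⊆ arc a b ∧
      Disjoint (arc u v) (arc a' b') ∧ IsAuxMap h u' v' u v (arc p q) ∧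
      IsTPair Tp Tm p q c d ∧
      (∀ φ ∈ ({f, g, h, Tp, Tm} : Set (UnitAddCircle ≃ₜ UnitAddCircle)),
        HasRotationNumber φ 0) ∧
      M = K ∪ (⋃ φ ∈ IFS {f, g}, φ '' arc p q) ∪ arc p q ∧
      IsMinimalSet {f, g, h, Tp, Tm} M ∧ IsDecomposition M K N ∧
      (interior M).Nonempty ∧ K.Nonempty ∧ N.Nonempty ∧ componentBoundary M = N) ∧
    -- intervals, a Cantor set and countably many points, not all of which are endpoints
    (∃ (f g φ₀ h Tp Tm : UnitAddCircle ≃ₜ UnitAddCircle)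
        (a b a' b' c d s t p q p' q' u' v' u v : ℝ) (M K N : Set UnitAddCircle),
      IsCantorPair f g K a b a' b' ∧ (a : UnitAddCircle) ∈ K ∧ (b : UnitAddCircle) ∈ K ∧
      openArc c d ∈ components Kᶜ ∧ openArc c d ⊆ arc a b ∧
      c < s ∧ t < d ∧ IsPush φ₀ s t ∧ s < p' ∧ q' < t ∧
      (∀ n : ℕ, 1 ≤ n → Disjoint (φ₀^[n] '' arc p q) (arc p q)) ∧
      Disjoint (φ₀ '' arc p q) (arc p' q') ∧
      Disjoint (arc u v) (arc a' b') ∧ IsAuxMap h u' v' u v (arc p q) ∧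
      IsTPair Tp Tm p q p' q' ∧
      (∀ φ ∈ ({f, g, φ₀, h, Tp, Tm} : Set (UnitAddCircle ≃ₜ UnitAddCircle)),
        HasRotationNumber φ 0) ∧
      M = K ∪ (⋃ n : ℕ, φ₀^[n] '' arc p q) ∪
        (⋃ φ ∈ IFS {f, g}, φ '' (⋃ n : ℕ, φ₀^[n] '' arc p q)) ∪
        (⋃ φ ∈ IFS {f, g}, {φ (t : UnitAddCircle)}) ∪ {(t : UnitAddCircle)} ∧
      IsMinimalSet {f, g, φ₀, h, Tp, Tm} M ∧ IsDecomposition M K N ∧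
      (interior M).Nonempty ∧ K.Nonempty ∧
      (componentBoundary M ∩ N).Nonempty ∧ ¬ N ⊆ componentBoundary M) ∧
    -- an infinite union of disjoint nondegenerate closed intervals
    (∃ (Tp Tm H ψ h : UnitAddCircle ≃ₜ UnitAddCircle) (p q p' q' s c d u' v' u v : ℝ)
        (M N : Set UnitAddCircle),
      IsPush ψ s c ∧ s < p' ∧ q' < c ∧ c < d ∧ d < s + 1 ∧ IsTPair Tp Tm p q p' q' ∧
      (∀ n : ℕ, 1 ≤ n → Disjoint (ψ^[n] '' arc p' q') (arc p' q')) ∧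
      Disjoint (arc u v) ((⋃ n : ℕ, ψ^[n] '' arc p' q') ∪ arc c d) ∧
      IsAuxMap h u' v' u v (arc p q) ∧
      H '' arc p q = arc c d ∧
      H '' ((⋃ n : ℕ, ψ^[n + 1] '' arc p q) ∪ arc c d) ⊆ ψ '' arc p q ∧
      (∀ φ ∈ ({Tp, Tm, H, ψ, h} : Set (UnitAddCircle ≃ₜ UnitAddCircle)),
        HasRotationNumber φ 0) ∧
      M = (⋃ n : ℕ, ψ^[n] '' arc p q) ∪ arc c d ∧
      IsMinimalSet {Tp, Tm, H, ψ, h} M ∧ IsDecomposition M ∅ N ∧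
      (components M).Infinite ∧ (∀ C ∈ components M, C.Nontrivial) ∧
      componentBoundary M = N) ∧
    -- a union of any finite number of disjoint nondegenerate closed intervals
    (∀ k : ℕ, 1 ≤ k →
      ∃ (G : Set (UnitAddCircle ≃ₜ UnitAddCircle)) (M N : Set UnitAddCircle),
        G.Finite ∧ (∀ φ ∈ G, HasRotationNumber φ 0) ∧ IsMinimalSet G M ∧
        IsDecomposition M ∅ N ∧ M ≠ univ ∧
        (components M).Finite ∧ (components M).ncard = k ∧
        (∀ C ∈ components M, C.Nontrivial) ∧ componentBoundary M = N) ∧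
    -- intervals and countably many points: the endpoints and one more point
    (∃ (ψ h Tp Tm : UnitAddCircle ≃ₜ UnitAddCircle) (p q p' q' u' v' u v : ℝ)
        (M N : Set UnitAddCircle),
      IsPush ψ 0 1 ∧ 0 < p' ∧ q' < 1 ∧ IsTPair Tp Tm p q p' q' ∧
      Disjoint (arc p' q') (ψ '' arc p' q') ∧
      (∀ n : ℕ, Disjoint (arc u v) (ψ^[n] '' arc p' q')) ∧
      IsAuxMap h u' v' u v (arc p q) ∧
      (∀ φ ∈ ({ψ, h, Tp, Tm} : Set (UnitAddCircle ≃ₜ UnitAddCircle)),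
        HasRotationNumber φ 0) ∧
      M = {0} ∪ ⋃ n : ℕ, ψ^[n] '' arc p q ∧
      IsMinimalSet {ψ, h, Tp, Tm} M ∧ IsDecomposition M ∅ N ∧
      (components (interior M)).Infinite ∧ N = componentBoundary M ∪ {0} ∧
      (0 : UnitAddCircle) ∉ componentBoundary M) ∧
    -- intervals and a Cantor set: a symmetric Cantorval
    (∃ (f g h Tp Tm : UnitAddCircle ≃ₜ UnitAddCircle) (a b a' b' c d α x₀ y₀ β : ℝ)
        (M K : Set UnitAddCircle),
      IsFifthsTriple f g h a b a' b' ∧ K = limitSet {f, g, h} (arc a b) ∧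
      c = a + (b - a) / 5 ∧ d = a + 2 * (b - a) / 5 ∧
      a ≤ α ∧ β ≤ b ∧
      Disjoint (arc α β) (openArc (a + 3 * (b - a) / 5) (a + 4 * (b - a) / 5)) ∧
      IsAdaptedTPair Tp Tm K {C | ∃ φ ∈ IFS {f, g, h}, C = φ '' openArc c d}
        α x₀ c d y₀ β ∧
      (∀ φ ∈ ({f, g, h, Tp, Tm} : Set (UnitAddCircle ≃ₜ UnitAddCircle)),
        HasRotationNumber φ 0) ∧
      M = K ∪ (⋃ φ ∈ IFS {f, g, h}, φ '' arc c d) ∪ arc c d ∧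
      IsMinimalSet {f, g, h, Tp, Tm} M ∧ IsDecomposition M K ∅ ∧
      (interior M).Nonempty ∧ K.Nonempty ∧ componentBoundary M ⊆ K ∧
      IsSymmetricCantorval M) :=
  ⟨exists_cantor_minimalSet,
    exists_finite_minimalSet_of_fixed,
    fun f hf => exists_finite_minimalSet_of_fixed f hf.exists_fixed,
    exists_minimal_circle,
    exists_intervals_cantor_endpoints,
    exists_intervals_cantor_points,
    exists_intervals_infinite,
    exists_intervals_finite,
    exists_intervals_point,
    exists_symmetricCantorval⟩
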